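/- Let $(\mathcal C,\otimes,I,C)$ be a braided tensor (monoidal) category, and let $H$ be a Hopf algebra in $\mathcal C$ with multiplication $m$, comultiplication $\Delta$, unit $\eta$, counit $\epsilon$ and antipode $S$ (not assumed invertible). Assume that $H$ is finite, i.e. it has a left dual $H^*$ with evaluation $d:H^*\otimes H\to I$ and coevaluation $b:I\to H\otimes H^*$ satisfying $(d\otimes\mathrm{id})(\mathrm{id}\otimes b)=\mathrm{id}_{H^*}$ and $(\mathrm{id}\otimes d)(b\otimes\mathrm{id})=\mathrm{id}_H$, and assume $C_{H,H}=C_{H,H}^{-1}$. Let $R$ be a left $H$-module algebra in $\mathcal C$ with action $\alpha:H\otimes R\to R$; that is, $R$ is an algebra and a left $H$-module with $\alpha(\mathrm{id}\otimes\eta_R)=\eta_R\,\epsilon$ and $\alpha(\mathrm{id}\otimes m_R)=m_R(\alpha\otimes\alpha)(\mathrm{id}\otimes C_{H,R}\otimes\mathrm{id})(\Delta\otimes\mathrm{id}\otimes\mathrm{id})$. Notation (associativity and unit isomorphisms are suppressed): * The smash product $A\# K$ of a Hopf algebra $K$ and a left $K$-module algebra $(A,\alpha_A)$ is the object $A\otimes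 K$ with unit $\eta_A\otimes\eta_K$ and multiplication $$(m_A\otimes m_K)(\mathrm{id}\otimes\alpha_A\otimes\mathrm{id}\otimes\mathrm{id})(\mathrm{id}\otimes\mathrm{id}\otimes C_{K,A}\otimes\mathrm{id})(\mathrm{id}\otimes\Delta_K\otimes\mathrm{id}\otimes\mathrm{id}).$$ * $H^*$ is the dual Hopf algebra, whose structure morphisms are the transposes of those of $H$, where $H^*\otimes H^*$ is the left dual of $H\otimes H$ with evaluation $d(\mathrm{id}\otimes d\otimes\mathrm{id})$. Then $H^{\hat *}=((H^*)^{op})^{cop}$ is the Hopf algebra on the object $H^*$ with multiplication $m_{H^*}C_{H^*,H^*}$ and comultiplication $C_{H^*,H^*}\Delta_{H^*}$. * $H^{\hat *}$ acts on $H$ by $\rightharpoonup\;=(\mathrm{id}\otimes d)(C_{H^{\hat *},H}\otimes\mathrm{id})(\mathrm{id}\otimes\Delta)$, and $R\#H$ is a left $H^{\hat *}$-module algebra under $(\mathrm{id}_R\otimes\rightharpoonup)(C_{H^{\hat *},R}\otimes\mathrm{id}_H)$. * $H\,\bar\otimes\,H^{\hat *}$ is the object $H\otimes H^{\hat *}$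 with multiplication $\mathrm{id}_H\otimes d\otimes\mathrm{id}_{H^{\hat *}}$ and unit $b$. * The tensor product $A\otimes B$ of two algebras has multiplication $(m_A\otimes m_B)(\mathrm{id}\otimes C_{B,A}\otimes\mathrm{id})$ and unit $\eta_A\otimes\eta_B$. Then there is an isomorphism of algebras in $\mathcal C$ $$(R\#H)\#H^{\hat *}\;\cong\;R\otimes(H\,\bar\otimes\,H^{\hat *}).$$ -/

import Mathlib

open CategoryTheory MonoidalCategory BraidedCategory
open scoped MonObj ComonObj

universe v u

namespace BraidedDuality

set_option linter.unusedSectionVars false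
variable {C : Type u} [Category.{v} C] [MonoidalCategory C]

section Transpose
variable {X Y Z X' Y' Z' : C} [ExactPairing X X'] [ExactPairing Y Y'] [ExactPairing Z Z']

/-- The transpose `Y' ⟶ X'` of `f : X ⟶ Y`, where `X'` and `Y'` are left duals of `X` and `Y` with
evaluations `X' ⊗ X ⟶ 𝟙` and `Y' ⊗ Y ⟶ 𝟙`. -/
def transpose (f : X ⟶ Y) : Y' ⟶ X' :=
  (ρ_ Y').inv ≫ Y' ◁ η_ X X' ≫ Y' ◁ f ▷ X' ≫ (α_ _ _ _).inv ≫ ε_ Y Y' ▷ X' ≫ (λ_ X').hom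

theorem eval_ext {W : C} {g g' : W ⟶ X'} (h : g ▷ X ≫ ε_ X X' = g' ▷ X ≫ ε_ X X') : g = g' := by
  have key : ∀ k : W ⟶ X', k = (ρ_ W).inv ≫ W ◁ η_ X X' ≫ (α_ _ _ _).inv ≫ (k ▷ X ≫ ε_ X X') ▷ X' ≫ (λ_ X').hom := by
    intro k
    calc k = k ⊗≫ (X' ◁ η_ X X' ⊗≫ ε_ X X' ▷ X') ⊗≫ 𝟙 _ := by
            rw [ExactPairing.coevaluation_evaluation'']; monoidal
      _ = 𝟙 _ ⊗≫ (k ▷ (𝟙_ C) ≫ X' ◁ η_ X X') ⊗≫ ε_ X X' ▷ X' ⊗≫ 𝟙 _ := by monoidal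
      _ = _ := by rw [← whisker_exchange]; monoidal
  rw [key g, key g', h]

theorem transpose_eval (f : X ⟶ Y) :
    transpose f ▷ X ≫ ε_ X X' = Y' ◁ f ≫ ε_ Y Y' := by
  calc _ = 𝟙 _ ⊗≫ Y' ◁ η_ X X' ▷ X ⊗≫ Y' ◁ f ▷ (X' ⊗ X) ⊗≫ (ε_ Y Y' ▷ (X' ⊗ X) ≫ (𝟙_ C) ◁ ε_ X X') ⊗≫ 𝟙 _ := by
        simp only [transpose]; monoidal
    _ = 𝟙 _ ⊗≫ Y' ◁ η_ X X' ▷ X ⊗≫ Y' ◁ (f ▷ (X' ⊗ X) ≫ Y ◁ ε_ X X') ⊗≫ ε_ Y Y' := by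
        rw [← whisker_exchange]; monoidal
    _ = 𝟙 _ ⊗≫ Y' ◁ (η_ X X' ▷ X ⊗≫ X ◁ ε_ X X') ⊗≫ Y' ◁ f ⊗≫ ε_ Y Y' := by
        rw [← whisker_exchange]; monoidal
    _ = _ := by rw [ExactPairing.evaluation_coevaluation'']; monoidal

theorem transpose_unique {f : X ⟶ Y} {g : Y' ⟶ X'} (h : g ▷ X ≫ ε_ X X' = Y' ◁ f ≫ ε_ Y Y') :
    transpose f = g := eval_ext (by rw [transpose_eval, h])

theorem transpose_id : transpose (𝟙 X) = 𝟙 X' := transpose_unique (by simp)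

theorem transpose_comp (f : X ⟶ Y) (g : Y ⟶ Z) :
    (transpose (f ≫ g) : Z' ⟶ X') = (transpose g : Z' ⟶ Y') ≫ transpose f :=
  transpose_unique (by
    rw [comp_whiskerRight, Category.assoc, transpose_eval, ← whisker_exchange_assoc, transpose_eval,
      MonoidalCategory.whiskerLeft_comp, Category.assoc])

/-- The left dual of `X ⊗ Y` is `Y' ⊗ X'`, with the nested evaluation. -/
theorem tensor_eval : ε_ (X ⊗ Y) (Y' ⊗ X') =
    𝟙 _ ⊗≫ Y' ◁ (ε_ X X' ▷ Y) ⊗≫ ε_ Y Y' := rfl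

theorem transpose_whiskerLeft (f : X ⟶ Y) :
    (transpose (Z ◁ f) : Y' ⊗ Z' ⟶ X' ⊗ Z') = transpose f ▷ Z' :=
  transpose_unique (by
    rw [tensor_eval, tensor_eval]
    calc _ = 𝟙 _ ⊗≫ ((transpose f : Y' ⟶ X') ▷ ((Z' ⊗ Z) ⊗ X) ≫ X' ◁ (ε_ Z Z' ▷ X)) ⊗≫ ε_ X X' := by monoidal
      _ = 𝟙 _ ⊗≫ Y' ◁ (ε_ Z Z' ▷ X) ⊗≫ ((transpose f : Y' ⟶ X') ▷ X ≫ ε_ X X') := by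
        rw [← whisker_exchange]; monoidal
      _ = 𝟙 _ ⊗≫ Y' ◁ (ε_ Z Z' ▷ X ≫ 𝟙_ C ◁ f) ⊗≫ ε_ Y Y' := by
        rw [transpose_eval]; monoidal
      _ = _ := by rw [← whisker_exchange]; monoidal)

theorem transpose_whiskerRight (f : X ⟶ Y) :
    (transpose (f ▷ Z) : Z' ⊗ Y' ⟶ Z' ⊗ X') = Z' ◁ transpose f :=
  transpose_unique (by
    rw [tensor_eval, tensor_eval]
    calc _ = 𝟙 _ ⊗≫ Z' ◁ ((transpose f : Y' ⟶ X') ▷ X ≫ ε_ X X') ▷ Z ⊗≫ ε_ Z Z' := by monoidal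
      _ = _ := by rw [transpose_eval]; monoidal)

theorem transpose_tensorHom {W W' : C} [ExactPairing W W'] (f : X ⟶ Y) (g : Z ⟶ W) :
    (transpose (f ⊗ₘ g) : W' ⊗ Y' ⟶ Z' ⊗ X') = transpose g ⊗ₘ transpose f := by
  rw [MonoidalCategory.tensorHom_def, transpose_comp (Y' := Z' ⊗ Y'), transpose_whiskerLeft,
    transpose_whiskerRight, MonoidalCategory.tensorHom_def]

theorem transpose_associator_hom :
    (transpose (α_ X Y Z).hom : (Z' ⊗ Y') ⊗ X' ⟶ Z' ⊗ Y' ⊗ X') = (α_ Z' Y' X').hom :=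
  transpose_unique (by simp only [tensor_eval]; monoidal)

theorem transpose_associator_inv :
    (transpose (α_ X Y Z).inv :  Z' ⊗ Y' ⊗ X' ⟶ (Z' ⊗ Y') ⊗ X') = (α_ Z' Y' X').inv :=
  transpose_unique (by simp only [tensor_eval]; monoidal)

theorem unit_eval : ε_ (𝟙_ C) (𝟙_ C) = (ρ_ (𝟙_ C)).hom := rfl

theorem transpose_leftUnitor_hom :
    (transpose (λ_ X).hom : X' ⟶ X' ⊗ 𝟙_ C) = (ρ_ X').inv :=
  transpose_unique (by simp only [tensor_eval, unit_eval]; monoidal)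

theorem transpose_rightUnitor_hom :
    (transpose (ρ_ X).hom : X' ⟶ 𝟙_ C ⊗ X') = (λ_ X').inv :=
  transpose_unique (by simp only [tensor_eval, unit_eval]; monoidal)

theorem transpose_leftUnitor_inv :
    (transpose (λ_ X).inv : X' ⊗ 𝟙_ C ⟶ X') = (ρ_ X').hom :=
  transpose_unique (by simp only [tensor_eval, unit_eval]; monoidal)

theorem transpose_rightUnitor_inv :
    (transpose (ρ_ X).inv : 𝟙_ C ⊗ X' ⟶ X') = (λ_ X').hom :=
  transpose_unique (by simp only [tensor_eval, unit_eval]; monoidal)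

theorem eval_ext' {W Z X X' : C} [ExactPairing X X'] {g g' : W ⟶ Z ⊗ X'}
    (h : g ▷ X ⊗≫ Z ◁ ε_ X X' = g' ▷ X ⊗≫ Z ◁ ε_ X X') : g = g' := by
  apply (tensorRightHomEquiv W X X' Z).symm.injective
  have key : ∀ k : W ⟶ Z ⊗ X', (tensorRightHomEquiv W X X' Z).symm k =
      (k ▷ X ⊗≫ Z ◁ ε_ X X') ≫ (ρ_ Z).hom := by
    intro k
    simp only [tensorRightHomEquiv, Equiv.coe_fn_symm_mk]; monoidal
  rw [key, key, h]

end Transpose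

section Br
variable [BraidedCategory C]
variable {X Y X' Y' : C} [ExactPairing X X'] [ExactPairing Y Y']

theorem braid_eval_left (W : C) :
    (β_ X' W).hom ▷ X ⊗≫ W ◁ ε_ X X' =
      𝟙 _ ⊗≫ X' ◁ (β_ X W).inv ⊗≫ ε_ X X' ▷ W ⊗≫ 𝟙 _ := by
  calc _ = 𝟙 _ ⊗≫ X' ◁ ((β_ X W).inv ≫ (β_ X W).hom) ⊗≫ (β_ X' W).hom ▷ X ⊗≫ W ◁ ε_ X X' := by
        rw [Iso.inv_hom_id]; monoidal
    _ = 𝟙 _ ⊗≫ X' ◁ (β_ X W).inv ⊗≫ ((β_ (X' ⊗ X) W).hom ≫ W ◁ ε_ X X') := by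
        rw [braiding_tensor_left_hom]; monoidal
    _ = _ := by
        rw [← braiding_naturality_left, braiding_tensorUnit_left]; monoidal

theorem braid_eval_right (W : C) :
    X' ◁ (β_ W X).hom ⊗≫ ε_ X X' ▷ W =
      𝟙 _ ⊗≫ (β_ W X').inv ▷ X ⊗≫ W ◁ ε_ X X' ⊗≫ 𝟙 _ := by
  calc _ = 𝟙 _ ⊗≫ ((β_ W X').inv ≫ (β_ W X').hom) ▷ X ⊗≫ X' ◁ (β_ W X).hom ⊗≫ ε_ X X' ▷ W := by
        rw [Iso.inv_hom_id]; monoidal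
    _ = 𝟙 _ ⊗≫ (β_ W X').inv ▷ X ⊗≫ ((β_ W (X' ⊗ X)).hom ≫ ε_ X X' ▷ W) := by
        rw [braiding_tensor_right_hom]; monoidal
    _ = _ := by
        rw [← braiding_naturality_right, braiding_tensorUnit_right]; monoidal

theorem transpose_braiding :
    (transpose (β_ X Y).hom : X' ⊗ Y' ⟶ Y' ⊗ X') = (β_ X' Y').hom :=
  transpose_unique (by
    simp only [tensor_eval]
    calc _ = 𝟙 _ ⊗≫ ((β_ X' Y').hom ▷ X ⊗≫ Y' ◁ ε_ X X') ▷ Y ⊗≫ ε_ Y Y' := by monoidal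
      _ = 𝟙 _ ⊗≫ X' ◁ (β_ X Y').inv ▷ Y ⊗≫ (ε_ X X' ▷ (Y' ⊗ Y) ≫ 𝟙_ C ◁ ε_ Y Y') ⊗≫ 𝟙 _ := by
        rw [braid_eval_left]; monoidal
      _ = 𝟙 _ ⊗≫ X' ◁ (𝟙 (Y' ⊗ X ⊗ Y) ⊗≫ (β_ X Y').inv ▷ Y ⊗≫ X ◁ ε_ Y Y' ⊗≫ 𝟙 (𝟙_ C ⊗ X)) ⊗≫ ε_ X X' := by
        rw [← whisker_exchange]; monoidal
      _ = _ := by rw [← braid_eval_right (X := Y) (X' := Y') X]; monoidal)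

end Br

section Dual

/-- The left dual `D` of `H`, as a carrier of the Hopf algebra structure dual to that of `H`: all
structure morphisms are transposes, where `D ⊗ D` is the left dual of `H ⊗ H` through the nested
evaluation. -/
def Dual (H D : C) [ExactPairing H D] : C := D

variable (H D : C) [ExactPairing H D]

instance : ExactPairing H (Dual H D) := inferInstanceAs (ExactPairing H D)

instance [ComonObj H] : MonObj (Dual H D) where
  one := transpose ε[H]
  mul := transpose Δ[H]
  one_mul := by
    rw [← transpose_whiskerLeft (Z := H) (Z' := Dual H D), ← transpose_comp, ComonObj.comul_counit, transpose_rightUnitor_inv]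
  mul_one := by
    rw [← transpose_whiskerRight (Z := H) (Z' := Dual H D), ← transpose_comp, ComonObj.counit_comul, transpose_leftUnitor_inv]
  mul_assoc := by
    rw [← transpose_whiskerLeft (Z := H) (Z' := Dual H D),
      ← transpose_whiskerRight (Z := H) (Z' := Dual H D),
      ← transpose_associator_hom (X := H) (Y := H) (Z := H), ← transpose_comp, ← transpose_comp, ← transpose_comp, Category.assoc, ComonObj.comul_assoc]
instance [MonObj H] : ComonObj (Dual H D) where
  counit := transpose η[H]
  comul := transpose μ[H]
  counit_comul := by
    rw [← transpose_whiskerLeft (Z := H) (Z' := Dual H D), ← transpose_comp, MonObj.mul_one, transpose_rightUnitor_hom]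
  comul_counit := by
    rw [← transpose_whiskerRight (Z := H) (Z' := Dual H D), ← transpose_comp, MonObj.one_mul, transpose_leftUnitor_hom]
  comul_assoc := by
    rw [← transpose_whiskerLeft (Z := H) (Z' := Dual H D),
      ← transpose_whiskerRight (Z := H) (Z' := Dual H D),
      ← transpose_associator_hom (X := H) (Y := H) (Z := H),
      ← transpose_comp (Y' := Dual H D ⊗ Dual H D),
      ← transpose_comp (Y' := (Dual H D ⊗ Dual H D) ⊗ Dual H D), ← transpose_comp, MonObj.mul_assoc, Category.assoc]

theorem Dual.mul_def [ComonObj H] : μ[Dual H D] = transpose Δ[H] := rfl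
theorem Dual.one_def [ComonObj H] : η[Dual H D] = transpose ε[H] := rfl
theorem Dual.comul_def [MonObj H] : Δ[Dual H D] = transpose μ[H] := rfl
theorem Dual.counit_def [MonObj H] : ε[Dual H D] = transpose η[H] := rfl

variable [BraidedCategory C]

theorem transpose_tensorμ :
    (transpose (tensorμ H H H H) : (Dual H D ⊗ Dual H D) ⊗ (Dual H D ⊗ Dual H D) ⟶
      (Dual H D ⊗ Dual H D) ⊗ (Dual H D ⊗ Dual H D)) =
      tensorμ (Dual H D) (Dual H D) (Dual H D) (Dual H D) := by
  rw [tensorμ, tensorμ, transpose_comp (Y' := ((Dual H D ⊗ Dual H D) ⊗ Dual H D) ⊗ Dual H D),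
    transpose_comp (Y' := (Dual H D ⊗ Dual H D ⊗ Dual H D) ⊗ Dual H D),
    transpose_comp (Y' := (Dual H D ⊗ Dual H D ⊗ Dual H D) ⊗ Dual H D),
    transpose_comp (Y' := ((Dual H D ⊗ Dual H D) ⊗ Dual H D) ⊗ Dual H D),
    transpose_whiskerLeft (X' := (Dual H D ⊗ Dual H D) ⊗ Dual H D)
      (Y' := Dual H D ⊗ Dual H D ⊗ Dual H D),
    transpose_whiskerLeft (Y' := (Dual H D ⊗ Dual H D) ⊗ Dual H D)
      (X' := Dual H D ⊗ Dual H D ⊗ Dual H D),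
    transpose_whiskerLeft (X' := Dual H D ⊗ Dual H D ⊗ Dual H D)
      (Y' := Dual H D ⊗ Dual H D ⊗ Dual H D),
    transpose_whiskerRight (X' := Dual H D ⊗ Dual H D) (Y' := Dual H D ⊗ Dual H D),
    transpose_braiding, transpose_associator_hom, transpose_associator_hom,
    transpose_associator_inv, transpose_associator_inv]
  monoidal

instance [BimonObj H] : BimonObj (Dual H D) where
  mul_comul := by
    simp only [Dual.mul_def, Dual.comul_def, ← transpose_tensorHom, ← transpose_tensorμ]
    rw [← transpose_comp, ← transpose_comp, ← transpose_comp, BimonObj.mul_comul, Category.assoc]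
  one_comul := by
    rw [Dual.one_def, Dual.comul_def, ← transpose_comp, BimonObj.mul_counit,
      Comon.tensorObj_counit, MonObj.tensorObj.one_def, transpose_comp (Y' := 𝟙_ C ⊗ 𝟙_ C),
      transpose_tensorHom, transpose_leftUnitor_hom, unitors_inv_equal]
    rfl
  mul_counit := by
    rw [Dual.mul_def, Dual.counit_def, ← transpose_comp, BimonObj.one_comul,
      Comon.tensorObj_counit, MonObj.tensorObj.one_def, transpose_comp (Y' := 𝟙_ C ⊗ 𝟙_ C),
      transpose_tensorHom, transpose_leftUnitor_inv, unitors_equal]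
    rfl
  one_counit := by
    rw [Dual.counit_def, Dual.one_def, ← transpose_comp, BimonObj.one_counit, transpose_id]

instance [HopfObj H] : HopfObj (Dual H D) where
  antipode := transpose (HopfObj.antipode (X := H))
  antipode_left := by
    rw [Dual.counit_def, Dual.one_def, Dual.mul_def, Dual.comul_def, ← transpose_whiskerLeft (Z := H) (Z' := Dual H D), ← transpose_comp (Y' := Dual H D ⊗ Dual H D), ← transpose_comp (Y' := Dual H D ⊗ Dual H D),
      ← transpose_comp (Y' := 𝟙_ C), Category.assoc, HopfObj.antipode_right]
  antipode_right := by
    rw [Dual.counit_def, Dual.one_def, Dual.mul_def, Dual.comul_def, ← transpose_whiskerRight (Z := H) (Z' := Dual H D), ← transpose_comp (Y' := Dual H D ⊗ Dual H D), ← transpose_comp (Y' := Dual H D ⊗ Dual H D),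
      ← transpose_comp (Y' := 𝟙_ C), Category.assoc, HopfObj.antipode_left]

end Dual
section OpCop

variable [BraidedCategory C]

/-- The condition that the self-braiding of `X` is its own inverse. -/
class SelfSymmetric (X : C) : Prop where
  braiding_eq_inv : (β_ X X).hom = (β_ X X).inv

theorem SelfSymmetric.braiding_braiding (X : C) [SelfSymmetric X] :
    (β_ X X).hom ≫ (β_ X X).hom = 𝟙 _ := by
  nth_rw 2 [SelfSymmetric.braiding_eq_inv (X := X)]
  simp

/-- A copy of `B`, which carries the opposite multiplication `μ ∘ C` and the co-opposite
comultiplication `C ∘ Δ`, and the unit, counit and antipode of `B`. -/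
def OpCop (B : C) : C := B

variable (B : C)

instance [SelfSymmetric B] : SelfSymmetric (OpCop B) := inferInstanceAs (SelfSymmetric B)

theorem one_braid (X Y : C) (f : 𝟙_ C ⟶ X) : f ▷ Y ≫ (β_ X Y).hom = (λ_ Y).hom ≫ (ρ_ Y).inv ≫ Y ◁ f := by
  rw [braiding_naturality_left, braiding_tensorUnit_left, Category.assoc]

theorem one_braid' (X Y : C) (f : 𝟙_ C ⟶ X) : Y ◁ f ≫ (β_ Y X).hom = (ρ_ Y).hom ≫ (λ_ Y).inv ≫ f ▷ Y := by
  rw [braiding_naturality_right, braiding_tensorUnit_right, Category.assoc]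

theorem braid_counit (X Y : C) (f : X ⟶ 𝟙_ C) : (β_ X Y).hom ≫ Y ◁ f = f ▷ Y ≫ (λ_ Y).hom ≫ (ρ_ Y).inv := by
  rw [← braiding_naturality_left, braiding_tensorUnit_left]

theorem braid_counit' (X Y : C) (f : X ⟶ 𝟙_ C) : (β_ Y X).hom ≫ f ▷ Y = Y ◁ f ≫ (ρ_ Y).hom ≫ (λ_ Y).inv := by
  rw [← braiding_naturality_right, braiding_tensorUnit_right]

instance OpCop.monObj [MonObj B] : MonObj (OpCop B) where
  one := η[B]
  mul := (β_ B B).hom ≫ μ[B]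
  one_mul := by
    change η[B] ▷ B ≫ (β_ B B).hom ≫ μ[B] = (λ_ B).hom
    rw [reassoc_of% @one_braid, MonObj.mul_one]; simp
  mul_one := by
    change B ◁ η[B] ≫ (β_ B B).hom ≫ μ[B] = (ρ_ B).hom
    rw [reassoc_of% @one_braid', MonObj.one_mul]; simp
  mul_assoc := by
    change ((β_ B B).hom ≫ μ[B]) ▷ B ≫ (β_ B B).hom ≫ μ[B] =
      (α_ B B B).hom ≫ B ◁ ((β_ B B).hom ≫ μ[B]) ≫ (β_ B B).hom ≫ μ[B]
    simp only [comp_whiskerRight, MonoidalCategory.whiskerLeft_comp, Category.assoc,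
      braiding_naturality_left_assoc, braiding_naturality_right_assoc, braiding_tensor_left_hom,
      braiding_tensor_right_hom, MonObj.mul_assoc, Iso.inv_hom_id_assoc]
    rw [← yang_baxter_assoc, Iso.hom_inv_id_assoc]

instance OpCop.comonObj [ComonObj B] : ComonObj (OpCop B) where
  counit := ε[B]
  comul := Δ[B] ≫ (β_ B B).hom
  counit_comul := by
    change (Δ[B] ≫ (β_ B B).hom) ≫ ε[B] ▷ B = (λ_ B).inv
    rw [Category.assoc, braid_counit', ComonObj.comul_counit_assoc]; simp
  comul_counit := by
    change (Δ[B] ≫ (β_ B B).hom) ≫ B ◁ ε[B] = (ρ_ B).inv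
    rw [Category.assoc, braid_counit, ComonObj.counit_comul_assoc]; simp
  comul_assoc := by
    change (Δ[B] ≫ (β_ B B).hom) ≫ B ◁ (Δ[B] ≫ (β_ B B).hom) =
      (Δ[B] ≫ (β_ B B).hom) ≫ (Δ[B] ≫ (β_ B B).hom) ▷ B ≫ (α_ B B B).hom
    have h := ComonObj.comul_assoc B
    simp only [comp_whiskerRight, MonoidalCategory.whiskerLeft_comp, Category.assoc,
      ← braiding_naturality_left_assoc, ← braiding_naturality_right_assoc, braiding_tensor_left_hom,
      braiding_tensor_right_hom, reassoc_of% h, yang_baxter]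

variable {B} in
theorem OpCop.mul_def [MonObj B] : μ[OpCop B] = (β_ B B).hom ≫ μ[B] := rfl

theorem tensorμ_braiding_swap [SelfSymmetric B] :
    tensorμ B B B B ≫ (β_ (B ⊗ B) (B ⊗ B)).hom =
      ((β_ B B).hom ⊗ₘ (β_ B B).hom) ≫ tensorμ B B B B := by
  have h : B ◁ (β_ B B).hom ▷ B ≫ B ◁ (β_ B B).hom ▷ B = 𝟙 _ := by
    rw [← MonoidalCategory.whiskerLeft_comp, ← comp_whiskerRight,
      SelfSymmetric.braiding_braiding]
    simp
  simp [tensorμ, reassoc_of% h, MonoidalCategory.tensorHom_def]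

theorem braiding_swap_tensorμ [SelfSymmetric B] :
    (β_ (B ⊗ B) (B ⊗ B)).hom ≫ tensorμ B B B B =
      tensorμ B B B B ≫ ((β_ B B).hom ⊗ₘ (β_ B B).hom) := by
  have h : B ◁ (β_ B B).hom ▷ B ≫ B ◁ (β_ B B).hom ▷ B = 𝟙 _ := by
    rw [← MonoidalCategory.whiskerLeft_comp, ← comp_whiskerRight,
      SelfSymmetric.braiding_braiding]
    simp
  simp [tensorμ, reassoc_of% h, MonoidalCategory.tensorHom_def]

theorem braiding_swap_conj [SelfSymmetric B] :
    (β_ (B ⊗ B) (B ⊗ B)).hom ≫ tensorμ B B B B ≫ (β_ (B ⊗ B) (B ⊗ B)).hom =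
      ((β_ B B).hom ⊗ₘ (β_ B B).hom) ≫ tensorμ B B B B ≫ ((β_ B B).hom ⊗ₘ (β_ B B).hom) := by
  rw [tensorμ_braiding_swap, ← braiding_naturality_assoc, braiding_swap_tensorμ]

instance OpCop.bimonObj [BimonObj B] [SelfSymmetric B] : BimonObj (OpCop B) where
  mul_comul := by
    change ((β_ B B).hom ≫ μ[B]) ≫ Δ[B] ≫ (β_ B B).hom =
      ((Δ[B] ≫ (β_ B B).hom) ⊗ₘ (Δ[B] ≫ (β_ B B).hom)) ≫ tensorμ B B B B ≫
        (((β_ B B).hom ≫ μ[B]) ⊗ₘ ((β_ B B).hom ≫ μ[B]))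
    rw [← tensorHom_comp_tensorHom, ← tensorHom_comp_tensorHom]
    simp only [Category.assoc, BimonObj.mul_comul_assoc, braiding_naturality]
    rw [← reassoc_of% braiding_swap_conj B, braiding_naturality_assoc]
  one_comul := by
    change η[B] ≫ Δ[B] ≫ (β_ B B).hom = η[B ⊗ B]
    rw [BimonObj.one_comul_assoc, MonObj.one_braiding]
  mul_counit := by
    change ((β_ B B).hom ≫ μ[B]) ≫ ε[B] = ε[B ⊗ B]
    rw [Category.assoc, BimonObj.mul_counit, Comon.tensorObj_counit, ← braiding_naturality_assoc, braiding_tensorUnit_left, unitors_equal]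
    simp
  one_counit := BimonObj.one_counit B

instance OpCop.hopfObj [HopfObj B] [SelfSymmetric B] : HopfObj (OpCop B) where
  antipode := HopfObj.antipode (X := B)
  antipode_left := by
    change (Δ[B] ≫ (β_ B B).hom) ≫ HopfObj.antipode (X := B) ▷ B ≫ (β_ B B).hom ≫ μ[B] = ε[B] ≫ η[B]
    rw [braiding_naturality_left_assoc, Category.assoc, reassoc_of% @SelfSymmetric.braiding_braiding, HopfObj.antipode_right]
  antipode_right := by
    change (Δ[B] ≫ (β_ B B).hom) ≫ B ◁ HopfObj.antipode (X := B) ≫ (β_ B B).hom ≫ μ[B] = ε[B] ≫ η[B]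
    rw [braiding_naturality_right_assoc, Category.assoc, reassoc_of% @SelfSymmetric.braiding_braiding, HopfObj.antipode_left]

end OpCop

section Matrix
/-- The multiplication `id ⊗ d ⊗ id` of `X ⊗ Y`, where `d` is the evaluation. -/
def matrixMul (X Y : C) [ExactPairing X Y] : (X ⊗ Y) ⊗ (X ⊗ Y) ⟶ X ⊗ Y :=
  (α_ X Y (X ⊗ Y)).hom ≫ X ◁ ((α_ Y X Y).inv ≫ ε_ X Y ▷ Y ≫ (λ_ Y).hom)

theorem matrixMul_one_mul (X Y : C) [ExactPairing X Y] :
    η_ X Y ▷ (X ⊗ Y) ≫ matrixMul X Y = (λ_ (X ⊗ Y)).hom := by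
  calc _ = 𝟙 _ ⊗≫ (η_ X Y ▷ X ⊗≫ X ◁ ε_ X Y) ▷ Y ⊗≫ 𝟙 _ := by
        simp only [matrixMul]; monoidal
    _ = _ := by rw [ExactPairing.evaluation_coevaluation'']; monoidal

theorem matrixMul_mul_one (X Y : C) [ExactPairing X Y] :
    (X ⊗ Y) ◁ η_ X Y ≫ matrixMul X Y = (ρ_ (X ⊗ Y)).hom := by
  calc _ = 𝟙 _ ⊗≫ X ◁ (Y ◁ η_ X Y ⊗≫ ε_ X Y ▷ Y) ⊗≫ 𝟙 _ := by
        simp only [matrixMul]; monoidal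
    _ = _ := by rw [ExactPairing.coevaluation_evaluation'']; monoidal

theorem matrixMul_assoc (X Y : C) [ExactPairing X Y] :
    matrixMul X Y ▷ (X ⊗ Y) ≫ matrixMul X Y =
      (α_ (X ⊗ Y) (X ⊗ Y) (X ⊗ Y)).hom ≫ (X ⊗ Y) ◁ matrixMul X Y ≫ matrixMul X Y := by
  calc _ = 𝟙 _ ⊗≫ X ◁ (ε_ X Y ▷ (Y ⊗ X) ≫ 𝟙_ C ◁ ε_ X Y) ▷ Y ⊗≫ 𝟙 _ := by
        simp only [matrixMul]; monoidal
    _ = _ := by rw [← whisker_exchange]; simp only [matrixMul]; monoidal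

/-- The matrix algebra `X ⊗ Y` for a left dual `Y` of `X`: its multiplication is `id ⊗ d ⊗ id` and
its unit is the coevaluation. -/
def matrixAlgebra (X Y : C) [ExactPairing X Y] : Mon C where
  X := X ⊗ Y
  mon :=
  { one := η_ X Y
    mul := matrixMul X Y
    one_mul := matrixMul_one_mul X Y
    mul_one := matrixMul_mul_one X Y
    mul_assoc := matrixMul_assoc X Y }
end Matrix

section ModuleAlg
variable [BraidedCategory C]
/-- `A` is a left `H`-module algebra: a left `H`-module such that the unit and the multiplication of `A`
are `H`-linear, where `H` acts on `A ⊗ A` diagonally through the braiding of `H` and `A`. -/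
class ModuleAlgebra (H A : C) [MonObj H] [ComonObj H] [MonObj A] where
  act (H A) : H ⊗ A ⟶ A
  one_act : η[H] ▷ A ≫ act = (λ_ A).hom
  mul_act : μ[H] ▷ A ≫ act = (α_ H H A).hom ≫ H ◁ act ≫ act
  act_one : H ◁ η[A] ≫ act = (ρ_ H).hom ≫ ε[H] ≫ η[A]
  act_mul : H ◁ μ[A] ≫ act = Δ[H] ▷ (A ⊗ A) ≫ tensorμ H H A A ≫ (act ⊗ₘ act) ≫ μ[A]

section Smash
open ModuleAlgebra

/-- The morphism `h ⊗ a ↦ (h₁ · a) ⊗ h₂`, where `h₂` crosses `a` by the braiding. -/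
def twist (H A : C) [MonObj H] [ComonObj H] [MonObj A] [ModuleAlgebra H A] : H ⊗ A ⟶ A ⊗ H :=
  Δ[H] ▷ A ≫ (α_ H H A).hom ≫ H ◁ (β_ H A).hom ≫ (α_ H A H).inv ≫ act H A ▷ H

variable (H A : C) [MonObj A] [BimonObj H] [ModuleAlgebra H A] 

theorem one_twist : η[H] ▷ A ≫ twist H A = (λ_ A).hom ≫ (ρ_ A).inv ≫ A ◁ η[H] := by
  calc _ = (η[H] ≫ Δ[H]) ▷ A ⊗≫ H ◁ (β_ H A).hom ⊗≫ act H A ▷ H := by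
        simp only [twist]; monoidal
    _ = 𝟙 _ ⊗≫ η[H] ▷ A ⊗≫ H ◁ (η[H] ▷ A ≫ (β_ H A).hom) ⊗≫ act H A ▷ H := by
        rw [BimonObj.one_comul, MonObj.tensorObj.one_def, MonoidalCategory.tensorHom_def]; monoidal
    _ = 𝟙 _ ⊗≫ η[H] ▷ A ⊗≫ (H ⊗ A) ◁ η[H] ⊗≫ act H A ▷ H := by
        rw [braiding_naturality_left, braiding_tensorUnit_left]; monoidal
    _ = 𝟙 _ ⊗≫ η[H] ▷ A ⊗≫ ((H ⊗ A) ◁ η[H] ≫ act H A ▷ H) := by monoidal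
    _ = 𝟙 _ ⊗≫ (η[H] ▷ A ≫ act H A) ▷ (𝟙_ C) ⊗≫ A ◁ η[H] := by
        rw [whisker_exchange]; monoidal
    _ = _ := by rw [one_act]; monoidal

theorem twist_one : H ◁ η[A] ≫ twist H A = (ρ_ H).hom ≫ (λ_ H).inv ≫ η[A] ▷ H := by
  calc _ = 𝟙 _ ⊗≫ (H ◁ η[A] ≫ Δ[H] ▷ A) ⊗≫ H ◁ (β_ H A).hom ⊗≫ act H A ▷ H := by
        simp only [twist]; monoidal
    _ = 𝟙 _ ⊗≫ Δ[H] ⊗≫ H ◁ (H ◁ η[A] ≫ (β_ H A).hom) ⊗≫ act H A ▷ H := by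
        rw [whisker_exchange]; monoidal
    _ = 𝟙 _ ⊗≫ Δ[H] ⊗≫ (H ◁ η[A] ≫ act H A) ▷ H := by
        rw [braiding_naturality_right, braiding_tensorUnit_right]; monoidal
    _ = 𝟙 _ ⊗≫ (Δ[H] ≫ ε[H] ▷ H) ⊗≫ η[A] ▷ H := by
        rw [act_one]; monoidal
    _ = _ := by rw [ComonObj.counit_comul]; monoidal

theorem mul_twist : μ[H] ▷ A ≫ twist H A =
    (α_ H H A).hom ≫ H ◁ twist H A ≫ (α_ H A H).inv ≫ twist H A ▷ H ≫ (α_ A H H).hom ≫ A ◁ μ[H] := by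
  calc _ = 𝟙 _ ⊗≫ (μ[H] ≫ Δ[H]) ▷ A ⊗≫ H ◁ (β_ H A).hom ⊗≫ act H A ▷ H := by
        simp only [twist]; monoidal
    _ = 𝟙 _ ⊗≫ Δ[H] ▷ H ▷ A ⊗≫ H ◁ H ◁ Δ[H] ▷ A ⊗≫ H ◁ (β_ H H).hom ▷ H ▷ A ⊗≫ μ[H] ▷ (H ⊗ H) ▷ A
          ⊗≫ H ◁ (μ[H] ▷ A ≫ (β_ H A).hom) ⊗≫ act H A ▷ H := by
        rw [BimonObj.mul_comul, tensorμ, MonoidalCategory.tensorHom_def, MonoidalCategory.tensorHom_def]; monoidal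
    _ = 𝟙 _ ⊗≫ Δ[H] ▷ H ▷ A ⊗≫ H ◁ H ◁ Δ[H] ▷ A ⊗≫ H ◁ (β_ H H).hom ▷ H ▷ A
          ⊗≫ (μ[H] ▷ ((H ⊗ H) ⊗ A) ≫ H ◁ (β_ (H ⊗ H) A).hom) ⊗≫ ((H ⊗ A) ◁ μ[H] ≫ act H A ▷ H) := by
        rw [braiding_naturality_left]; monoidal
    _ = 𝟙 _ ⊗≫ Δ[H] ▷ H ▷ A ⊗≫ H ◁ H ◁ Δ[H] ▷ A ⊗≫ H ◁ (β_ H H).hom ▷ H ▷ A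
          ⊗≫ (H ⊗ H) ◁ (β_ (H ⊗ H) A).hom ⊗≫ (μ[H] ▷ A ≫ act H A) ▷ (H ⊗ H) ⊗≫ A ◁ μ[H] := by
        rw [← whisker_exchange, whisker_exchange (act H A)]; monoidal
    _ = 𝟙 _ ⊗≫ Δ[H] ▷ H ▷ A ⊗≫ H ◁ H ◁ Δ[H] ▷ A
          ⊗≫ H ◁ ((β_ H H).hom ▷ (H ⊗ A) ≫ (H ⊗ H) ◁ (β_ H A).hom) ⊗≫ H ◁ H ◁ (β_ H A).hom ▷ H
          ⊗≫ (H ◁ act H A ⊗≫ act H A) ▷ (H ⊗ H) ⊗≫ A ◁ μ[H] := by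
        rw [mul_act, braiding_tensor_left_hom]; monoidal
    _ = 𝟙 _ ⊗≫ (Δ[H] ▷ H ≫ (H ⊗ H) ◁ Δ[H]) ▷ A ⊗≫ (H ⊗ H ⊗ H) ◁ (β_ H A).hom
          ⊗≫ H ◁ (β_ H (H ⊗ A)).hom ▷ H
          ⊗≫ (H ◁ act H A ⊗≫ act H A) ▷ (H ⊗ H) ⊗≫ A ◁ μ[H] := by
        rw [← whisker_exchange, braiding_tensor_right_hom]; monoidal
    _ = 𝟙 _ ⊗≫ (Δ[H] ▷ H ≫ (H ⊗ H) ◁ Δ[H]) ▷ A ⊗≫ (H ⊗ H ⊗ H) ◁ (β_ H A).hom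
          ⊗≫ H ◁ ((β_ H (H ⊗ A)).hom ≫ act H A ▷ H) ▷ H
          ⊗≫ act H A ▷ (H ⊗ H) ⊗≫ A ◁ μ[H] := by
        monoidal
    _ = 𝟙 _ ⊗≫ H ◁ Δ[H] ▷ A ⊗≫ (Δ[H] ▷ (H ⊗ (H ⊗ A)) ≫ (H ⊗ H) ◁ (H ◁ (β_ H A).hom))
          ⊗≫ H ◁ (H ◁ act H A ≫ (β_ H A).hom) ▷ H
          ⊗≫ act H A ▷ (H ⊗ H) ⊗≫ A ◁ μ[H] := by
        rw [← braiding_naturality_right, ← whisker_exchange]; monoidal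
    _ = 𝟙 _ ⊗≫ H ◁ Δ[H] ▷ A ⊗≫ H ◁ (H ◁ (β_ H A).hom)
          ⊗≫ (Δ[H] ▷ (H ⊗ A) ≫ (H ⊗ H) ◁ act H A) ▷ H ⊗≫ H ◁ (β_ H A).hom ▷ H
          ⊗≫ act H A ▷ (H ⊗ H) ⊗≫ A ◁ μ[H] := by
        rw [← whisker_exchange]; monoidal
    _ = _ := by
        rw [← whisker_exchange]; simp only [twist]; monoidal

theorem twist_mul : H ◁ μ[A] ≫ twist H A =
    (α_ H A A).inv ≫ twist H A ▷ A ≫ (α_ A H A).hom ≫ A ◁ twist H A ≫ (α_ A A H).inv ≫ μ[A] ▷ H := by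
  calc _ = 𝟙 _ ⊗≫ (H ◁ μ[A] ≫ Δ[H] ▷ A) ⊗≫ H ◁ (β_ H A).hom ⊗≫ act H A ▷ H := by
        simp only [twist]; monoidal
    _ = 𝟙 _ ⊗≫ Δ[H] ▷ (A ⊗ A) ⊗≫ H ◁ (H ◁ μ[A] ≫ (β_ H A).hom) ⊗≫ act H A ▷ H := by
        rw [whisker_exchange]; monoidal
    _ = 𝟙 _ ⊗≫ Δ[H] ▷ (A ⊗ A) ⊗≫ H ◁ (β_ H (A ⊗ A)).hom ⊗≫ (H ◁ μ[A] ≫ act H A) ▷ H := by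
        rw [braiding_naturality_right]; monoidal
    _ = 𝟙 _ ⊗≫ Δ[H] ▷ (A ⊗ A) ⊗≫ (H ◁ (β_ H (A ⊗ A)).hom ⊗≫ Δ[H] ▷ ((A ⊗ A) ⊗ H)) ⊗≫
          H ◁ (β_ H A).hom ▷ A ▷ H ⊗≫ (act H A ▷ (H ⊗ A) ≫ A ◁ act H A) ▷ H ⊗≫ μ[A] ▷ H := by
        rw [act_mul, tensorμ, MonoidalCategory.tensorHom_def]; monoidal
    _ = 𝟙 _ ⊗≫ Δ[H] ▷ (A ⊗ A) ⊗≫ (H ◁ (β_ H (A ⊗ A)).hom ≫ Δ[H] ▷ ((A ⊗ A) ⊗ H)) ⊗≫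
          H ◁ (β_ H A).hom ▷ A ▷ H ⊗≫ (H ⊗ A) ◁ act H A ▷ H ⊗≫ act H A ▷ A ▷ H ⊗≫ μ[A] ▷ H := by
        rw [← whisker_exchange]; monoidal
    _ = 𝟙 _ ⊗≫ (Δ[H] ≫ Δ[H] ▷ H ≫ (α_ H H H).hom) ▷ (A ⊗ A) ⊗≫ H ◁ H ◁ (β_ H A).hom ▷ A ⊗≫
          H ◁ ((H ⊗ A) ◁ (β_ H A).hom ≫ (β_ H A).hom ▷ (A ⊗ H)) ⊗≫
          (H ⊗ A) ◁ act H A ▷ H ⊗≫ act H A ▷ A ▷ H ⊗≫ μ[A] ▷ H := by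
        rw [whisker_exchange, braiding_tensor_right_hom]; monoidal
    _ = 𝟙 _ ⊗≫ Δ[H] ▷ (A ⊗ A) ⊗≫ H ◁ (Δ[H] ▷ A ⊗≫ H ◁ (β_ H A).hom ⊗≫ (β_ H A).hom ▷ H) ▷ A ⊗≫
          (H ⊗ A) ◁ H ◁ (β_ H A).hom ⊗≫
          (H ⊗ A) ◁ act H A ▷ H ⊗≫ act H A ▷ A ▷ H ⊗≫ μ[A] ▷ H := by
        rw [← ComonObj.comul_assoc, whisker_exchange]; monoidal
    _ = 𝟙 _ ⊗≫ Δ[H] ▷ (A ⊗ A) ⊗≫ H ◁ (Δ[H] ▷ A ≫ (β_ (H ⊗ H) A).hom) ▷ A ⊗≫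
          (H ⊗ A) ◁ H ◁ (β_ H A).hom ⊗≫
          ((H ⊗ A) ◁ (act H A ▷ H) ≫ act H A ▷ (A ⊗ H)) ⊗≫ μ[A] ▷ H := by
        rw [braiding_tensor_left_hom]; monoidal
    _ = 𝟙 _ ⊗≫ Δ[H] ▷ (A ⊗ A) ⊗≫ H ◁ (β_ H A).hom ▷ A ⊗≫ (H ⊗ A) ◁ (Δ[H] ▷ A) ⊗≫
          ((H ⊗ A) ◁ (H ◁ (β_ H A).hom) ≫ act H A ▷ (H ⊗ (A ⊗ H))) ⊗≫ A ◁ act H A ▷ H ⊗≫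
          μ[A] ▷ H := by
        rw [braiding_naturality_left, whisker_exchange]; monoidal
    _ = 𝟙 _ ⊗≫ Δ[H] ▷ (A ⊗ A) ⊗≫ H ◁ (β_ H A).hom ▷ A ⊗≫
          ((H ⊗ A) ◁ (Δ[H] ▷ A) ≫ act H A ▷ ((H ⊗ H) ⊗ A)) ⊗≫
          A ◁ H ◁ (β_ H A).hom ⊗≫ A ◁ act H A ▷ H ⊗≫ μ[A] ▷ H := by
        rw [whisker_exchange]; monoidal
    _ = _ := by
        rw [whisker_exchange]; simp only [twist]; monoidal

/-- The multiplication of the smash product: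
`(m ⊗ m) (id ⊗ act ⊗ id ⊗ id) (id ⊗ id ⊗ C ⊗ id) (id ⊗ Δ ⊗ id ⊗ id)`. -/
def smashMul : (A ⊗ H) ⊗ (A ⊗ H) ⟶ A ⊗ H :=
  (α_ A H (A ⊗ H)).hom ≫ A ◁ ((α_ H A H).inv ≫ twist H A ▷ H ≫ (α_ A H H).hom) ≫
    (α_ A A (H ⊗ H)).inv ≫ (μ[A] ⊗ₘ μ[H])

/-- The unit of the smash product. -/
def smashOne : 𝟙_ C ⟶ A ⊗ H := (λ_ (𝟙_ C)).inv ≫ (η[A] ⊗ₘ η[H])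

theorem smash_one_mul : smashOne H A ▷ (A ⊗ H) ≫ smashMul H A = (λ_ (A ⊗ H)).hom := by
  calc _ = 𝟙 _ ⊗≫ η[A] ▷ (A ⊗ H) ⊗≫ A ◁ (η[H] ▷ A ≫ twist H A) ▷ H ⊗≫ (A ⊗ A) ◁ μ[H] ⊗≫ μ[A] ▷ H := by
        rw [smashOne, MonoidalCategory.tensorHom_def, smashMul, MonoidalCategory.tensorHom_def']; monoidal
    _ = 𝟙 _ ⊗≫ η[A] ▷ (A ⊗ H) ⊗≫ (A ⊗ A) ◁ (η[H] ▷ H ≫ μ[H]) ⊗≫ μ[A] ▷ H := by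
        rw [one_twist]; monoidal
    _ = 𝟙 _ ⊗≫ (η[A] ▷ A ≫ μ[A]) ▷ H ⊗≫ 𝟙 _ := by
        rw [MonObj.one_mul]; monoidal
    _ = _ := by rw [MonObj.one_mul]; monoidal

theorem smash_mul_one : (A ⊗ H) ◁ smashOne H A ≫ smashMul H A = (ρ_ (A ⊗ H)).hom := by
  calc _ = 𝟙 _ ⊗≫ A ◁ (H ◁ η[A]) ⊗≫ A ◁ ((H ⊗ A) ◁ η[H] ≫ twist H A ▷ H) ⊗≫ (A ⊗ A) ◁ μ[H] ⊗≫ μ[A] ▷ H := by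
        rw [smashOne, MonoidalCategory.tensorHom_def, smashMul, MonoidalCategory.tensorHom_def']; monoidal
    _ = 𝟙 _ ⊗≫ A ◁ (H ◁ η[A] ≫ twist H A) ⊗≫ (A ⊗ A) ◁ (H ◁ η[H] ≫ μ[H]) ⊗≫ μ[A] ▷ H := by
        rw [whisker_exchange]; monoidal
    _ = 𝟙 _ ⊗≫ (A ◁ η[A] ≫ μ[A]) ▷ H ⊗≫ 𝟙 _ := by
        rw [twist_one, MonObj.mul_one]; monoidal
    _ = _ := by rw [MonObj.mul_one]; monoidal

theorem smash_mul_assoc : smashMul H A ▷ (A ⊗ H) ≫ smashMul H A =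
    (α_ (A ⊗ H) (A ⊗ H) (A ⊗ H)).hom ≫ (A ⊗ H) ◁ smashMul H A ≫ smashMul H A := by
  calc _ = 𝟙 _ ⊗≫ A ◁ twist H A ▷ (H ⊗ A ⊗ H) ⊗≫ (A ⊗ A) ◁ μ[H] ▷ (A ⊗ H) ⊗≫
          (μ[A] ▷ (H ⊗ A) ≫ A ◁ twist H A) ▷ H ⊗≫ (A ⊗ A) ◁ μ[H] ⊗≫ μ[A] ▷ H := by
        rw [smashMul, MonoidalCategory.tensorHom_def']; monoidal
    _ = 𝟙 _ ⊗≫ A ◁ twist H A ▷ (H ⊗ A ⊗ H) ⊗≫ (A ⊗ A) ◁ (μ[H] ▷ A ≫ twist H A) ▷ H ⊗≫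
          (μ[A] ▷ (A ⊗ H ⊗ H) ≫ A ◁ (A ◁ μ[H])) ⊗≫ μ[A] ▷ H := by
        rw [← whisker_exchange]; monoidal
    _ = 𝟙 _ ⊗≫ A ◁ twist H A ▷ (H ⊗ A ⊗ H) ⊗≫
          (A ⊗ A) ◁ (𝟙 ((H ⊗ H) ⊗ A) ⊗≫ H ◁ twist H A ⊗≫ twist H A ▷ H ⊗≫ A ◁ μ[H]) ▷ H ⊗≫
          (A ⊗ A) ◁ (A ◁ μ[H]) ⊗≫ (μ[A] ▷ A ≫ μ[A]) ▷ H := by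
        rw [← whisker_exchange, mul_twist]; monoidal
    _ = 𝟙 _ ⊗≫ A ◁ (twist H A ▷ (H ⊗ A) ≫ (A ⊗ H) ◁ twist H A) ▷ H ⊗≫
          (A ⊗ A) ◁ (twist H A ▷ (H ⊗ H)) ⊗≫
          (A ⊗ A ⊗ A) ◁ (μ[H] ▷ H ≫ μ[H]) ⊗≫ A ◁ μ[A] ▷ H ⊗≫ μ[A] ▷ H := by
        rw [MonObj.mul_assoc A]; monoidal
    _ = 𝟙 _ ⊗≫ (A ⊗ H) ◁ (A ◁ twist H A ▷ H) ⊗≫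
          A ◁ (𝟙 (H ⊗ A ⊗ A) ⊗≫ twist H A ▷ A ⊗≫ A ◁ twist H A) ▷ (H ⊗ H) ⊗≫
          A ◁ ((A ⊗ A) ◁ (H ◁ μ[H] ≫ μ[H]) ≫ μ[A] ▷ H) ⊗≫ μ[A] ▷ H := by
        rw [MonObj.mul_assoc H, ← whisker_exchange]; monoidal
    _ = 𝟙 _ ⊗≫ (A ⊗ H) ◁ (A ◁ twist H A ▷ H) ⊗≫
          A ◁ (𝟙 (H ⊗ A ⊗ A) ⊗≫ twist H A ▷ A ⊗≫ A ◁ twist H A ⊗≫ μ[A] ▷ H) ▷ (H ⊗ H) ⊗≫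
          (A ⊗ A) ◁ (H ◁ μ[H] ≫ μ[H]) ⊗≫ μ[A] ▷ H := by
        rw [whisker_exchange]; monoidal
    _ = 𝟙 _ ⊗≫ (A ⊗ H) ◁ (A ◁ twist H A ▷ H) ⊗≫
          A ◁ (H ◁ μ[A] ≫ twist H A) ▷ (H ⊗ H) ⊗≫
          (A ⊗ A) ◁ (H ◁ μ[H] ≫ μ[H]) ⊗≫ μ[A] ▷ H := by
        rw [twist_mul]; monoidal
    _ = 𝟙 _ ⊗≫ (A ⊗ H) ◁ (A ◁ twist H A ▷ H) ⊗≫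
          A ◁ (H ◁ μ[A]) ▷ (H ⊗ H) ⊗≫ A ◁ (twist H A ▷ (H ⊗ H) ≫ (A ⊗ H) ◁ μ[H]) ⊗≫
          (A ⊗ A) ◁ μ[H] ⊗≫ μ[A] ▷ H := by
        monoidal
    _ = 𝟙 _ ⊗≫ (A ⊗ H) ◁ (A ◁ twist H A ▷ H) ⊗≫
          (A ⊗ H) ◁ (μ[A] ▷ (H ⊗ H) ≫ A ◁ μ[H]) ⊗≫ A ◁ twist H A ▷ H ⊗≫
          (A ⊗ A) ◁ μ[H] ⊗≫ μ[A] ▷ H := by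
        rw [← whisker_exchange]; monoidal
    _ = _ := by
        rw [← whisker_exchange, smashMul, MonoidalCategory.tensorHom_def']; monoidal

end Smash
end ModuleAlg

section Hat
variable [BraidedCategory C]

instance SelfSymmetric.dual (H D : C) [ExactPairing H D] [SelfSymmetric H] :
    SelfSymmetric (Dual H D) where
  braiding_eq_inv := by
    rw [← cancel_mono (β_ (Dual H D) (Dual H D)).hom, Iso.inv_hom_id,
      ← transpose_braiding (X := H) (Y := H), ← transpose_comp, SelfSymmetric.braiding_braiding,
      transpose_id]

/-- The Hopf algebra dual to `H`, with opposite multiplication and co-opposite comultiplication. -/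
def HatDual (H D : C) [ExactPairing H D] : C := OpCop (Dual H D)

variable (H D : C) [ExactPairing H D]

instance HatDual.hopfObj [HopfObj H] [SelfSymmetric H] : HopfObj (HatDual H D) :=
  inferInstanceAs (HopfObj (OpCop (Dual H D)))

/-- `HatDual H D` has the same underlying object `D`, hence is a left dual of `H`. -/
instance HatDual.exactPairing : ExactPairing H (HatDual H D) := inferInstanceAs (ExactPairing H D)

instance HatDual.selfSymmetric [SelfSymmetric H] : SelfSymmetric (HatDual H D) :=
  inferInstanceAs (SelfSymmetric (OpCop (Dual H D)))

theorem braiding_dual_eq_inv [SelfSymmetric H] : (β_ D H).hom = (β_ H D).inv := by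
  apply eval_ext' (X := H)
  calc _ = 𝟙 _ ⊗≫ (D ◁ (β_ H H).hom ⊗≫ ε_ H D ▷ H) ⊗≫ 𝟙 _ := by
        rw [braid_eval_left, SelfSymmetric.braiding_eq_inv (X := H)]; monoidal
    _ = _ := by rw [braid_eval_right]; monoidal

section
variable [HopfObj H] [SelfSymmetric H]

local notation "E" => HatDual H D

theorem HatDual.one_eval : η[E] ▷ H ≫ ε_ H E = (λ_ H).hom ≫ ε[H] := by
  change (transpose ε[H] : 𝟙_ C ⟶ D) ▷ H ≫ ε_ H D = _
  rw [transpose_eval, unit_eval]; monoidal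

theorem HatDual.eval_one : E ◁ η[H] ≫ ε_ H E = (ρ_ _).hom ≫ ε[E] := by
  change D ◁ η[H] ≫ ε_ H D = (ρ_ D).hom ≫ (transpose η[H] : D ⟶ 𝟙_ C)
  rw [← transpose_eval (X' := 𝟙_ C), unit_eval]; monoidal

theorem HatDual.mul_eval : μ[E] ▷ H ≫ ε_ H E =
    𝟙 _ ⊗≫ (E ⊗ E) ◁ Δ[H] ⊗≫ E ◁ (β_ E H).hom ▷ H ⊗≫ ε_ H E ▷ (E ⊗ H) ⊗≫ ε_ H E := by
  have h : μ[E] = (β_ E E).hom ≫ (transpose Δ[H] : E ⊗ E ⟶ E) := rfl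
  calc _ = 𝟙 _ ⊗≫ (β_ E E).hom ▷ H ⊗≫ ((transpose Δ[H] : E ⊗ E ⟶ E) ▷ H ≫ ε_ H E) := by
        rw [h]; monoidal
    _ = 𝟙 _ ⊗≫ ((β_ E E).hom ▷ H ≫ (E ⊗ E) ◁ Δ[H]) ⊗≫ E ◁ ε_ H E ▷ H ⊗≫ ε_ H E := by
        rw [transpose_eval, tensor_eval]; monoidal
    _ = 𝟙 _ ⊗≫ (E ⊗ E) ◁ Δ[H] ⊗≫ ((β_ E E).hom ▷ H ⊗≫ E ◁ ε_ H E) ▷ H ⊗≫ ε_ H E := by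
        rw [← whisker_exchange]; monoidal
    _ = _ := by
        rw [braid_eval_left, braiding_dual_eq_inv H E]; monoidal

theorem HatDual.eval_mul : E ◁ μ[H] ≫ ε_ H E =
    𝟙 _ ⊗≫ Δ[E] ▷ (H ⊗ H) ⊗≫ E ◁ (β_ E H).hom ▷ H ⊗≫ ε_ H E ▷ (E ⊗ H) ⊗≫ ε_ H E := by
  have h : Δ[E] = (transpose μ[H] : E ⟶ E ⊗ E) ≫ (β_ E E).hom := rfl
  symm
  calc _ = 𝟙 _ ⊗≫ Δ[E] ▷ (H ⊗ H) ⊗≫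
            (𝟙 ((E ⊗ E) ⊗ H) ⊗≫ E ◁ (β_ H E).inv ⊗≫ ε_ H E ▷ E ⊗≫ 𝟙 (E ⊗ 𝟙_ C)) ▷ H ⊗≫ ε_ H E := by
        rw [braiding_dual_eq_inv H E]; monoidal
    _ = 𝟙 _ ⊗≫ (transpose μ[H] : E ⟶ E ⊗ E) ▷ (H ⊗ H) ⊗≫ ((β_ E E).hom ≫ (β_ E E).hom) ▷ (H ⊗ H) ⊗≫
            E ◁ ε_ H E ▷ H ⊗≫ ε_ H E := by
        rw [← braid_eval_left, h]; monoidal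
    _ = 𝟙 _ ⊗≫ ((transpose μ[H] : E ⟶ E ⊗ E) ▷ (H ⊗ H) ≫ ε_ (H ⊗ H) (E ⊗ E)) := by
        rw [SelfSymmetric.braiding_braiding, tensor_eval]; monoidal
    _ = _ := by
        rw [transpose_eval]; monoidal

end

section Coaction
open ModuleAlgebra
variable [HopfObj H] [SelfSymmetric H]
local notation "E" => HatDual H D
variable {A : C} (δ : A ⟶ A ⊗ H)

/-- The action of `HatDual H D` on `A` that a right coaction `δ` of `H` induces. -/
def coactionAct : E ⊗ A ⟶ A :=
  E ◁ δ ≫ (α_ _ _ _).inv ≫ (β_ E A).hom ▷ H ≫ (α_ _ _ _).hom ≫ A ◁ ε_ H E ≫ (ρ_ A).hom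

theorem coactionAct_one (h : δ ≫ A ◁ ε[H] = (ρ_ A).inv) :
    η[E] ▷ A ≫ coactionAct H D δ = (λ_ A).hom := by
  calc _ = 𝟙 _ ⊗≫ (η[E] ▷ A ≫ E ◁ δ) ⊗≫ (β_ E A).hom ▷ H ⊗≫ A ◁ ε_ H E ⊗≫ 𝟙 _ := by
        rw [coactionAct]; monoidal
    _ = 𝟙 _ ⊗≫ δ ⊗≫ (η[E] ▷ A ≫ (β_ E A).hom) ▷ H ⊗≫ A ◁ ε_ H E ⊗≫ 𝟙 _ := by
        rw [← whisker_exchange]; monoidal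
    _ = 𝟙 _ ⊗≫ δ ⊗≫ A ◁ (η[E] ▷ H ≫ ε_ H E) ⊗≫ 𝟙 _ := by
        rw [braiding_naturality_left, braiding_tensorUnit_left]; monoidal
    _ = 𝟙 _ ⊗≫ (δ ≫ A ◁ ε[H]) ⊗≫ 𝟙 _ := by
        rw [HatDual.one_eval]; monoidal
    _ = _ := by rw [h]; monoidal

theorem coactionAct_mul (h : δ ≫ δ ▷ H ≫ (α_ A H H).hom = δ ≫ A ◁ Δ[H]) :
    μ[E] ▷ A ≫ coactionAct H D δ =
      (α_ E E A).hom ≫ E ◁ coactionAct H D δ ≫ coactionAct H D δ := by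
  calc _ = 𝟙 _ ⊗≫ (μ[E] ▷ A ≫ E ◁ δ) ⊗≫ (β_ E A).hom ▷ H ⊗≫ A ◁ ε_ H E ⊗≫ 𝟙 _ := by
        rw [coactionAct]; monoidal
    _ = 𝟙 _ ⊗≫ (E ⊗ E) ◁ δ ⊗≫ (μ[E] ▷ A ≫ (β_ E A).hom) ▷ H ⊗≫ A ◁ ε_ H E ⊗≫ 𝟙 _ := by
        rw [← whisker_exchange]; monoidal
    _ = 𝟙 _ ⊗≫ (E ⊗ E) ◁ δ ⊗≫ (β_ (E ⊗ E) A).hom ▷ H ⊗≫ A ◁ (μ[E] ▷ H ≫ ε_ H E) ⊗≫ 𝟙 _ := by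
        rw [braiding_naturality_left]; monoidal
    _ = 𝟙 _ ⊗≫ (E ⊗ E) ◁ δ ⊗≫ ((β_ (E ⊗ E) A).hom ▷ H ≫ (A ⊗ (E ⊗ E)) ◁ Δ[H]) ⊗≫
          A ◁ E ◁ (β_ E H).hom ▷ H ⊗≫ A ◁ ε_ H E ▷ (E ⊗ H) ⊗≫ A ◁ ε_ H E ⊗≫ 𝟙 _ := by
        rw [HatDual.mul_eval]; monoidal
    _ = 𝟙 _ ⊗≫ (E ⊗ E) ◁ (δ ≫ A ◁ Δ[H]) ⊗≫ E ◁ (β_ E A).hom ▷ (H ⊗ H) ⊗≫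
          ((β_ E A).hom ▷ (E ⊗ H) ≫ (A ⊗ E) ◁ (β_ E H).hom) ▷ H ⊗≫
          A ◁ (ε_ H E ▷ (E ⊗ H) ≫ 𝟙_ C ◁ ε_ H E) ⊗≫ 𝟙 _ := by
        rw [← whisker_exchange, braiding_tensor_left_hom]; monoidal
    _ = 𝟙 _ ⊗≫ (E ⊗ E) ◁ (δ ≫ δ ▷ H) ⊗≫ E ◁ ((β_ E A).hom ▷ H ⊗≫ A ◁ (β_ E H).hom) ▷ H ⊗≫
          ((β_ E A).hom ▷ (H ⊗ (E ⊗ H)) ≫ (A ⊗ E) ◁ (H ◁ ε_ H E)) ⊗≫ A ◁ ε_ H E ⊗≫ 𝟙 _ := by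
        rw [← h, ← whisker_exchange, ← whisker_exchange]; monoidal
    _ = 𝟙 _ ⊗≫ (E ⊗ E) ◁ δ ⊗≫ E ◁ (E ◁ δ ≫ (β_ E (A ⊗ H)).hom) ▷ H ⊗≫
          E ◁ (A ⊗ H) ◁ ε_ H E ⊗≫ (β_ E A).hom ▷ H ⊗≫ A ◁ ε_ H E ⊗≫ 𝟙 _ := by
        rw [← whisker_exchange, braiding_tensor_right_hom]; monoidal
    _ = 𝟙 _ ⊗≫ (E ⊗ E) ◁ δ ⊗≫ E ◁ (β_ E A).hom ▷ H ⊗≫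
          E ◁ (δ ▷ (E ⊗ H) ≫ (A ⊗ H) ◁ ε_ H E) ⊗≫ (β_ E A).hom ▷ H ⊗≫ A ◁ ε_ H E ⊗≫ 𝟙 _ := by
        rw [braiding_naturality_right]; monoidal
    _ = _ := by
        rw [← whisker_exchange, coactionAct]; monoidal

theorem act_coactionOne [MonObj A] (h : η[A] ≫ δ = η[A ⊗ H]) :
    E ◁ η[A] ≫ coactionAct H D δ = (ρ_ _).hom ≫ ε[E] ≫ η[A] := by
  calc _ = 𝟙 _ ⊗≫ E ◁ (η[A] ≫ δ) ⊗≫ (β_ E A).hom ▷ H ⊗≫ A ◁ ε_ H E ⊗≫ 𝟙 _ := by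
        rw [coactionAct]; monoidal
    _ = 𝟙 _ ⊗≫ E ◁ η[H] ⊗≫ (E ◁ η[A] ≫ (β_ E A).hom) ▷ H ⊗≫ A ◁ ε_ H E ⊗≫ 𝟙 _ := by
        rw [h, MonObj.tensorObj.one_def, MonoidalCategory.tensorHom_def']; monoidal
    _ = 𝟙 _ ⊗≫ E ◁ η[H] ⊗≫ (η[A] ▷ (E ⊗ H) ≫ A ◁ ε_ H E) ⊗≫ 𝟙 _ := by
        rw [braiding_naturality_right, braiding_tensorUnit_right]; monoidal
    _ = 𝟙 _ ⊗≫ (E ◁ η[H] ≫ ε_ H E) ⊗≫ η[A] ⊗≫ 𝟙 _ := by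
        rw [← whisker_exchange]; monoidal
    _ = _ := by rw [HatDual.eval_one]; monoidal

theorem act_coactionMul [MonObj A] (h : μ[A] ≫ δ = (δ ⊗ₘ δ) ≫ tensorμ A H A H ≫ (μ[A] ⊗ₘ μ[H])) :
    E ◁ μ[A] ≫ coactionAct H D δ = Δ[E] ▷ (A ⊗ A) ≫ tensorμ E E A A ≫
      (coactionAct H D δ ⊗ₘ coactionAct H D δ) ≫ μ[A] := by
  calc _ = 𝟙 _ ⊗≫ E ◁ (μ[A] ≫ δ) ⊗≫ (β_ E A).hom ▷ H ⊗≫ A ◁ ε_ H E ⊗≫ 𝟙 _ := by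
        rw [coactionAct]; monoidal
    _ = 𝟙 _ ⊗≫ E ◁ δ ▷ A ⊗≫ E ◁ (A ⊗ H) ◁ δ ⊗≫ E ◁ A ◁ (β_ H A).hom ▷ H ⊗≫
          E ◁ (A ⊗ A) ◁ μ[H] ⊗≫ (E ◁ μ[A] ≫ (β_ E A).hom) ▷ H ⊗≫ A ◁ ε_ H E ⊗≫ 𝟙 _ := by
        rw [h, MonoidalCategory.tensorHom_def, MonoidalCategory.tensorHom_def', tensorμ]; monoidal
    _ = 𝟙 _ ⊗≫ E ◁ δ ▷ A ⊗≫ E ◁ (A ⊗ H) ◁ δ ⊗≫ E ◁ A ◁ (β_ H A).hom ▷ H ⊗≫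
          ((E ⊗ (A ⊗ A)) ◁ μ[H] ≫ (β_ E (A ⊗ A)).hom ▷ H) ⊗≫
          (μ[A] ▷ (E ⊗ H) ≫ A ◁ ε_ H E) ⊗≫ 𝟙 _ := by
        rw [braiding_naturality_right]; monoidal
    _ = 𝟙 _ ⊗≫ E ◁ δ ▷ A ⊗≫ E ◁ (A ⊗ H) ◁ δ ⊗≫ E ◁ A ◁ (β_ H A).hom ▷ H ⊗≫
          (β_ E (A ⊗ A)).hom ▷ (H ⊗ H) ⊗≫ (A ⊗ A) ◁ (E ◁ μ[H] ≫ ε_ H E) ⊗≫ μ[A] := by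
        rw [← whisker_exchange, whisker_exchange]; monoidal
    _ = 𝟙 _ ⊗≫ E ◁ δ ▷ A ⊗≫ E ◁ (A ⊗ H) ◁ δ ⊗≫ E ◁ A ◁ (β_ H A).hom ▷ H ⊗≫
          ((β_ E (A ⊗ A)).hom ≫ (A ⊗ A) ◁ Δ[E]) ▷ (H ⊗ H) ⊗≫ (A ⊗ A) ◁ E ◁ (β_ E H).hom ▷ H ⊗≫
          (A ⊗ A) ◁ ε_ H E ▷ (E ⊗ H) ⊗≫ (A ⊗ A) ◁ ε_ H E ⊗≫ μ[A] := by
        rw [HatDual.eval_mul]; monoidal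
    _ = 𝟙 _ ⊗≫ (E ◁ (𝟙 (A ⊗ A) ⊗≫ δ ▷ A ⊗≫ (A ⊗ H) ◁ δ ⊗≫ A ◁ (β_ H A).hom ▷ H ⊗≫
            𝟙 ((A ⊗ A) ⊗ (H ⊗ H))) ≫ Δ[E] ▷ ((A ⊗ A) ⊗ (H ⊗ H))) ⊗≫
          (β_ (E ⊗ E) (A ⊗ A)).hom ▷ (H ⊗ H) ⊗≫ (A ⊗ A) ◁ E ◁ (β_ E H).hom ▷ H ⊗≫
          (A ⊗ A) ◁ ε_ H E ▷ (E ⊗ H) ⊗≫ (A ⊗ A) ◁ ε_ H E ⊗≫ μ[A] := by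
        rw [← braiding_naturality_left]; monoidal
    _ = 𝟙 _ ⊗≫ Δ[E] ▷ (A ⊗ A) ⊗≫ (E ⊗ E) ◁ δ ▷ A ⊗≫ (E ⊗ E) ◁ (A ⊗ H) ◁ δ ⊗≫
          E ◁ ((E ⊗ A) ◁ (β_ H A).hom ≫ (β_ E A).hom ▷ (A ⊗ H)) ▷ H ⊗≫
          (E ⊗ A) ◁ (β_ E A).hom ▷ (H ⊗ H) ⊗≫ (β_ E A).hom ▷ (A ⊗ E ⊗ H ⊗ H) ⊗≫
          A ◁ ((β_ E A).hom ▷ (E ⊗ H) ≫ (A ⊗ E) ◁ (β_ E H).hom) ▷ H ⊗≫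
          (A ⊗ A) ◁ ε_ H E ▷ (E ⊗ H) ⊗≫ (A ⊗ A) ◁ ε_ H E ⊗≫ μ[A] := by
        rw [whisker_exchange, braiding_tensor_left_hom, braiding_tensor_right_hom]; monoidal
    _ = 𝟙 _ ⊗≫ Δ[E] ▷ (A ⊗ A) ⊗≫ (E ⊗ E) ◁ δ ▷ A ⊗≫ (E ⊗ E) ◁ (A ⊗ H) ◁ δ ⊗≫
          E ◁ (β_ E A).hom ▷ (H ⊗ A ⊗ H) ⊗≫ (E ⊗ A) ◁ E ◁ (β_ H A).hom ▷ H ⊗≫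
          (E ⊗ A) ◁ (β_ E A).hom ▷ (H ⊗ H) ⊗≫
          ((β_ E A).hom ▷ (A ⊗ (E ⊗ H)) ≫ (A ⊗ E) ◁ (A ◁ (β_ E H).hom)) ▷ H ⊗≫
          A ◁ (β_ E A).hom ▷ (H ⊗ E ⊗ H) ⊗≫
          (A ⊗ A) ◁ ε_ H E ▷ (E ⊗ H) ⊗≫ (A ⊗ A) ◁ ε_ H E ⊗≫ μ[A] := by
        rw [whisker_exchange, ← whisker_exchange (β_ E A).hom (β_ E H).hom]; monoidal
    _ = 𝟙 _ ⊗≫ Δ[E] ▷ (A ⊗ A) ⊗≫ (E ⊗ E) ◁ δ ▷ A ⊗≫ (E ⊗ E) ◁ (A ⊗ H) ◁ δ ⊗≫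
          E ◁ (β_ E A).hom ▷ (H ⊗ A ⊗ H) ⊗≫
          (E ⊗ A) ◁ (E ◁ (β_ H A).hom ≫ (β_ E (A ⊗ H)).hom) ▷ H ⊗≫
          (β_ E A).hom ▷ (A ⊗ H ⊗ E ⊗ H) ⊗≫ A ◁ (β_ E A).hom ▷ (H ⊗ E ⊗ H) ⊗≫
          (A ⊗ A) ◁ ε_ H E ▷ (E ⊗ H) ⊗≫ (A ⊗ A) ◁ ε_ H E ⊗≫ μ[A] := by
        rw [← whisker_exchange, braiding_tensor_right_hom]; monoidal
    _ = 𝟙 _ ⊗≫ Δ[E] ▷ (A ⊗ A) ⊗≫ (E ⊗ E) ◁ δ ▷ A ⊗≫ (E ⊗ E) ◁ (A ⊗ H) ◁ δ ⊗≫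
          E ◁ (β_ E A).hom ▷ (H ⊗ A ⊗ H) ⊗≫
          (E ⊗ A) ◁ (β_ E (H ⊗ A)).hom ▷ H ⊗≫
          ((E ⊗ A) ◁ ((β_ H A).hom ▷ (E ⊗ H)) ≫ (β_ E A).hom ▷ ((A ⊗ H) ⊗ (E ⊗ H))) ⊗≫
          A ◁ (β_ E A).hom ▷ (H ⊗ E ⊗ H) ⊗≫
          (A ⊗ A) ◁ ε_ H E ▷ (E ⊗ H) ⊗≫ (A ⊗ A) ◁ ε_ H E ⊗≫ μ[A] := by
        rw [braiding_naturality_right]; monoidal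
    _ = 𝟙 _ ⊗≫ Δ[E] ▷ (A ⊗ A) ⊗≫ (E ⊗ E) ◁ δ ▷ A ⊗≫ (E ⊗ E) ◁ (A ⊗ H) ◁ δ ⊗≫
          E ◁ (β_ E A).hom ▷ (H ⊗ A ⊗ H) ⊗≫
          (E ⊗ A) ◁ (β_ E (H ⊗ A)).hom ▷ H ⊗≫
          (β_ E A).hom ▷ ((H ⊗ A) ⊗ (E ⊗ H)) ⊗≫
          A ◁ ((β_ (E ⊗ H) A).hom ≫ A ◁ ε_ H E) ▷ (E ⊗ H) ⊗≫ (A ⊗ A) ◁ ε_ H E ⊗≫ μ[A] := by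
        rw [whisker_exchange, braiding_tensor_left_hom]; monoidal
    _ = 𝟙 _ ⊗≫ Δ[E] ▷ (A ⊗ A) ⊗≫ (E ⊗ E) ◁ δ ▷ A ⊗≫ (E ⊗ E) ◁ (A ⊗ H) ◁ δ ⊗≫
          E ◁ (β_ E A).hom ▷ (H ⊗ A ⊗ H) ⊗≫
          (E ⊗ A) ◁ (β_ E H).hom ▷ (A ⊗ H) ⊗≫
          ((E ⊗ A) ◁ (H ◁ (β_ E A).hom ▷ H) ≫ (β_ E A).hom ▷ (H ⊗ ((A ⊗ E) ⊗ H))) ⊗≫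
          A ◁ ε_ H E ▷ (A ⊗ E ⊗ H) ⊗≫ (A ⊗ A) ◁ ε_ H E ⊗≫ μ[A] := by
        rw [← braiding_naturality_left, braiding_tensorUnit_left, braiding_tensor_right_hom]; monoidal
    _ = 𝟙 _ ⊗≫ Δ[E] ▷ (A ⊗ A) ⊗≫ (E ⊗ E) ◁ δ ▷ A ⊗≫ (E ⊗ E) ◁ (A ⊗ H) ◁ δ ⊗≫
          E ◁ (β_ E A).hom ▷ (H ⊗ A ⊗ H) ⊗≫
          (E ⊗ A) ◁ (β_ E H).hom ▷ (A ⊗ H) ⊗≫ (β_ E A).hom ▷ (H ⊗ (E ⊗ (A ⊗ H))) ⊗≫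
          A ◁ ((E ⊗ H) ◁ ((β_ E A).hom ▷ H) ≫ ε_ H E ▷ ((A ⊗ E) ⊗ H)) ⊗≫
          (A ⊗ A) ◁ ε_ H E ⊗≫ μ[A] := by
        rw [whisker_exchange]; monoidal
    _ = 𝟙 _ ⊗≫ Δ[E] ▷ (A ⊗ A) ⊗≫ (E ⊗ E) ◁ δ ▷ A ⊗≫
          ((E ⊗ (E ⊗ (A ⊗ H))) ◁ δ ≫ (E ◁ (β_ E (A ⊗ H)).hom) ▷ (A ⊗ H)) ⊗≫
          (β_ E A).hom ▷ (H ⊗ (E ⊗ (A ⊗ H))) ⊗≫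
          A ◁ (ε_ H E ▷ ((E ⊗ A) ⊗ H) ≫ 𝟙_ C ◁ ((β_ E A).hom ▷ H)) ⊗≫
          (A ⊗ A) ◁ ε_ H E ⊗≫ μ[A] := by
        rw [← whisker_exchange, braiding_tensor_right_hom]; monoidal
    _ = 𝟙 _ ⊗≫ Δ[E] ▷ (A ⊗ A) ⊗≫
          E ◁ (E ◁ δ ≫ (β_ E (A ⊗ H)).hom) ▷ A ⊗≫
          ((E ⊗ A) ◁ ((H ⊗ E) ◁ δ) ≫ (β_ E A).hom ▷ ((H ⊗ E) ⊗ (A ⊗ H))) ⊗≫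
          A ◁ ε_ H E ▷ (E ⊗ (A ⊗ H)) ⊗≫ A ◁ ((β_ E A).hom ▷ H) ⊗≫
          (A ⊗ A) ◁ ε_ H E ⊗≫ μ[A] := by
        rw [whisker_exchange]; monoidal
    _ = 𝟙 _ ⊗≫ Δ[E] ▷ (A ⊗ A) ⊗≫ E ◁ (β_ E A).hom ▷ A ⊗≫ E ◁ δ ▷ (E ⊗ A) ⊗≫
          (β_ E A).hom ▷ (H ⊗ (E ⊗ A)) ⊗≫
          A ◁ ((E ⊗ H) ◁ (E ◁ δ) ≫ ε_ H E ▷ (E ⊗ (A ⊗ H))) ⊗≫ A ◁ ((β_ E A).hom ▷ H) ⊗≫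
          (A ⊗ A) ◁ ε_ H E ⊗≫ μ[A] := by
        rw [braiding_naturality_right, whisker_exchange]; monoidal
    _ = _ := by
        rw [whisker_exchange, coactionAct, MonoidalCategory.tensorHom_def, tensorμ]; monoidal

end Coaction

section SmashHat
open ModuleAlgebra
variable [HopfObj H] [SelfSymmetric H] (A : C) [MonObj A] [ModuleAlgebra H A]
local notation "E" => HatDual H D

theorem twist_comul : twist H A ≫ A ◁ Δ[H] =
    Δ[H] ▷ A ≫ (α_ H H A).hom ≫ H ◁ (β_ H A).hom ≫ (α_ H A H).inv ≫ twist H A ▷ H ≫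
      (α_ A H H).hom := by
  calc _ = 𝟙 _ ⊗≫ Δ[H] ▷ A ⊗≫ H ◁ (β_ H A).hom ⊗≫ (act H A ▷ H ≫ A ◁ Δ[H]) := by
        simp only [twist]; monoidal
    _ = 𝟙 _ ⊗≫ Δ[H] ▷ A ⊗≫ H ◁ ((β_ H A).hom ≫ A ◁ Δ[H]) ⊗≫ act H A ▷ (H ⊗ H) := by
        rw [← whisker_exchange]; monoidal
    _ = 𝟙 _ ⊗≫ (Δ[H] ≫ H ◁ Δ[H]) ▷ A ⊗≫ H ◁ (β_ (H ⊗ H) A).hom ⊗≫ act H A ▷ (H ⊗ H) := by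
        rw [← braiding_naturality_left]; monoidal
    _ = 𝟙 _ ⊗≫ Δ[H] ▷ A ⊗≫ (Δ[H] ▷ (H ⊗ A) ≫ (H ⊗ H) ◁ (β_ H A).hom) ⊗≫
          H ◁ (β_ H A).hom ▷ H ⊗≫ act H A ▷ (H ⊗ H) := by
        rw [ComonObj.comul_assoc, braiding_tensor_left_hom]; monoidal
    _ = _ := by
        rw [← whisker_exchange, twist]; monoidal

/-- The coaction of `H` on the smash product through its second tensor factor. -/
def smashCoaction : A ⊗ H ⟶ (A ⊗ H) ⊗ H := A ◁ Δ[H] ≫ (α_ A H H).inv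

theorem smashCoaction_counit :
    smashCoaction H A ≫ (A ⊗ H) ◁ ε[H] = (ρ_ (A ⊗ H)).inv := by
  calc _ = 𝟙 _ ⊗≫ A ◁ (Δ[H] ≫ H ◁ ε[H]) ⊗≫ 𝟙 _ := by rw [smashCoaction]; monoidal
    _ = _ := by rw [ComonObj.comul_counit]; monoidal

theorem smashCoaction_coassoc :
    smashCoaction H A ≫ smashCoaction H A ▷ H ≫ (α_ (A ⊗ H) H H).hom =
      smashCoaction H A ≫ (A ⊗ H) ◁ Δ[H] := by
  calc _ = 𝟙 _ ⊗≫ A ◁ (Δ[H] ≫ Δ[H] ▷ H ≫ (α_ H H H).hom) ⊗≫ 𝟙 _ := by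
        rw [smashCoaction]; monoidal
    _ = _ := by rw [← ComonObj.comul_assoc, smashCoaction]; monoidal

theorem smashCoaction_one :
    smashOne H A ≫ smashCoaction H A =
      (λ_ (𝟙_ C)).inv ≫ (smashOne H A ⊗ₘ η[H]) := by
  calc _ = 𝟙 _ ⊗≫ η[A] ⊗≫ A ◁ (η[H] ≫ Δ[H]) ⊗≫ 𝟙 _ := by
        rw [smashOne, smashCoaction, MonoidalCategory.tensorHom_def]; monoidal
    _ = _ := by
        rw [BimonObj.one_comul, MonObj.tensorObj.one_def, smashOne,
          MonoidalCategory.tensorHom_def, MonoidalCategory.tensorHom_def,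
          MonoidalCategory.tensorHom_def]
        monoidal

theorem smashCoaction_mul :
    smashMul H A ≫ smashCoaction H A =
      (smashCoaction H A ⊗ₘ smashCoaction H A) ≫ tensorμ (A ⊗ H) H (A ⊗ H) H ≫
        (smashMul H A ⊗ₘ μ[H]) := by
  calc _ = 𝟙 _ ⊗≫ A ◁ twist H A ▷ H ⊗≫ (A ⊗ A) ◁ μ[H] ⊗≫ (μ[A] ▷ H ≫ A ◁ Δ[H]) ⊗≫ 𝟙 _ := by
        rw [smashMul, smashCoaction, MonoidalCategory.tensorHom_def']; monoidal
    _ = 𝟙 _ ⊗≫ A ◁ twist H A ▷ H ⊗≫ (A ⊗ A) ◁ (μ[H] ≫ Δ[H]) ⊗≫ μ[A] ▷ (H ⊗ H) ⊗≫ 𝟙 _ := by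
        rw [← whisker_exchange]; monoidal
    _ = 𝟙 _ ⊗≫ A ◁ (twist H A ≫ A ◁ Δ[H]) ▷ H ⊗≫ (A ⊗ A ⊗ H ⊗ H) ◁ Δ[H] ⊗≫
          (A ⊗ A ⊗ H) ◁ (β_ H H).hom ▷ H ⊗≫ (A ⊗ A) ◁ μ[H] ▷ (H ⊗ H) ⊗≫ (A ⊗ A ⊗ H) ◁ μ[H] ⊗≫
          μ[A] ▷ (H ⊗ H) ⊗≫ 𝟙 _ := by
        rw [BimonObj.mul_comul, tensorμ, MonoidalCategory.tensorHom_def,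
          MonoidalCategory.tensorHom_def]
        monoidal
    _ = 𝟙 _ ⊗≫ A ◁ Δ[H] ▷ (A ⊗ H) ⊗≫ A ◁ H ◁ (β_ H A).hom ▷ H ⊗≫
          A ◁ (twist H A ▷ (H ⊗ H) ≫ (A ⊗ H) ◁ (H ◁ Δ[H])) ⊗≫
          (A ⊗ A ⊗ H) ◁ (β_ H H).hom ▷ H ⊗≫ (A ⊗ A) ◁ μ[H] ▷ (H ⊗ H) ⊗≫ (A ⊗ A ⊗ H) ◁ μ[H] ⊗≫
          μ[A] ▷ (H ⊗ H) ⊗≫ 𝟙 _ := by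
        rw [twist_comul]; monoidal
    _ = 𝟙 _ ⊗≫ A ◁ Δ[H] ▷ (A ⊗ H) ⊗≫ A ◁ H ◁ ((β_ H A).hom ▷ H ≫ (A ⊗ H) ◁ Δ[H]) ⊗≫
          A ◁ (twist H A ▷ ((H ⊗ H) ⊗ H) ≫ (A ⊗ H) ◁ ((β_ H H).hom ▷ H)) ⊗≫
          (A ⊗ A) ◁ μ[H] ▷ (H ⊗ H) ⊗≫ (A ⊗ A ⊗ H) ◁ μ[H] ⊗≫ μ[A] ▷ (H ⊗ H) ⊗≫ 𝟙 _ := by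
        rw [← whisker_exchange]; monoidal
    _ = 𝟙 _ ⊗≫ A ◁ (Δ[H] ▷ (A ⊗ H) ≫ (H ⊗ H) ◁ (A ◁ Δ[H])) ⊗≫ A ◁ H ◁ (β_ H (A ⊗ H)).hom ▷ H ⊗≫
          A ◁ twist H A ▷ (H ⊗ H ⊗ H) ⊗≫
          (A ⊗ A) ◁ μ[H] ▷ (H ⊗ H) ⊗≫ ((A ⊗ A) ◁ (H ◁ μ[H]) ≫ μ[A] ▷ (H ⊗ H)) ⊗≫ 𝟙 _ := by
        rw [← whisker_exchange, ← whisker_exchange, braiding_tensor_right_hom]; monoidal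
    _ = _ := by
        rw [whisker_exchange, MonoidalCategory.tensorHom_def (smashCoaction H A),
          MonoidalCategory.tensorHom_def (smashMul H A), smashMul, smashCoaction,
          MonoidalCategory.tensorHom_def', tensorμ]
        monoidal

/-- The smash product `A # H`, an algebra on `A ⊗ H`. -/
def smashProduct (H A : C) [MonObj A] [BimonObj H] [ModuleAlgebra H A] : Mon C where
  X := A ⊗ H
  mon :=
  { one := smashOne H A
    mul := smashMul H A
    one_mul := smash_one_mul H A
    mul_one := smash_mul_one H A
    mul_assoc := smash_mul_assoc H A }

/-- The action `(id ⊗ d) (C ⊗ id) (id ⊗ Δ)` of `HatDual H D` on `H`. -/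
def hatAct : E ⊗ H ⟶ H :=
  E ◁ Δ[H] ≫ (α_ E H H).inv ≫ (β_ E H).hom ▷ H ≫ (α_ H E H).hom ≫ H ◁ ε_ H E ≫ (ρ_ H).hom

/-- The action `(id ⊗ hatAct) (C ⊗ id)` of `HatDual H D` on `A ⊗ H`. -/
def smashHatAct : E ⊗ (A ⊗ H) ⟶ A ⊗ H :=
  (α_ E A H).inv ≫ (β_ E A).hom ▷ H ≫ (α_ A E H).hom ≫ A ◁ hatAct H D

theorem smashHatAct_eq : smashHatAct H D A = coactionAct H D (smashCoaction H A) := by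
  rw [smashHatAct, hatAct, coactionAct, smashCoaction]
  calc _ = 𝟙 _ ⊗≫ ((β_ E A).hom ▷ H ≫ (A ⊗ E) ◁ Δ[H]) ⊗≫ A ◁ (β_ E H).hom ▷ H ⊗≫
        A ◁ H ◁ ε_ H E ⊗≫ 𝟙 _ := by monoidal
    _ = _ := by rw [← whisker_exchange, braiding_tensor_right_hom]; monoidal

/-- The smash product `A # H` is a left module algebra over `HatDual H D`, which acts on the factor `H`. -/
instance smashProduct.hatModuleAlgebra : ModuleAlgebra E (smashProduct H A).X where
  act := smashHatAct H D A
  one_act := by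
    rw [smashHatAct_eq]; exact coactionAct_one H D _ (smashCoaction_counit H A)
  mul_act := by
    rw [smashHatAct_eq]; exact coactionAct_mul H D _ (smashCoaction_coassoc H A)
  act_one := by
    rw [smashHatAct_eq]
    exact act_coactionOne (A := (smashProduct H A).X) H D _ (smashCoaction_one H A)
  act_mul := by
    rw [smashHatAct_eq]
    exact act_coactionMul (A := (smashProduct H A).X) H D _ (smashCoaction_mul H A)

end SmashHat

end Hat
end BraidedDuality

open BraidedDuality

/-!
The antipode `S` of a Hopf algebra `H` with a left dual and `C_{H,H} = C_{H,H}⁻¹` is invertible, as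
for finite-dimensional Hopf algebras. The coaction `f ↦ f₁ ⊗ f₀` of `H` on its dual and the action
`f ↦ f · S(h)` make the dual a Hopf module (`coact_ract_antipode`), so `integralProj`,
`P(f) = f₀ · S²(f₁)`, projects onto coinvariants (`integralProj_coact`, `ract_integralProj`) and
`f = P(f₀) · S(f₁)` (`coact_integralProj_ract`). Since `⟨P(eⁱ), S(eᵢ)⟩ = 1`
(`integralProj_trace`), the morphism `antipodeLeftInv` is a left inverse of `S`. The same result for
the dual Hopf algebra gives a right inverse by transposition, and so `isIso_antipode`. The
hypothesis on `C_{H,H}` makes the braidings of `H` with its dual mutually inverse as well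
(`br_br_dual`), so that over- and under-crossings of these strands need not be distinguished.

Let `E` be the dual with opposite multiplication and co-opposite comultiplication. The action of
`E` on `H` has an adjoint `hatCoact`, `f ↦ f₁ ⊗ f₀` with `f ⇀ x = f₁ ⟨f₀, x⟩`; since
`f₁ ⊗ f₀₁ ⊗ f₀₀` is a flipped comultiplication of `f₁` (`hatCoact_hatCoact`), the morphism `galois`,
`h ⊗ f ↦ h f₁ ⊗ f₀`, which sends `h # f` to the matrix of `x ↦ h (f ⇀ x)`, is invertible, with
inverse `h ⊗ f ↦ h S⁻¹(f₁) ⊗ f₀`. Similarly the twist `h ⊗ r ↦ h₁ · r ⊗ h₂` is invertible, with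
inverse `r ⊗ h ↦ h₂ ⊗ S⁻¹(h₁) · r` (`w_twist_twistInv`, `w_twistInv_twist`). The isomorphism is
`r ⊗ h ⊗ f ↦ S⁻¹(k₁) · r ⊗ k₂ ⊗ f₀`, where `k ⊗ f₀` is the image of `h ⊗ f` under `galois`. It is
multiplicative (`duality_mul`) because `galois` turns the product of `H # E` into that of matrices,
while `twistInv` is compatible with the multiplication of `R` (`twistInv_mul`) and the twist with
the action of `E` (`hatAct_twist`).

All identities are proved for morphisms between right-nested words `X ⊗ Y ⊗ ⋯ ⊗ T` with an
arbitrary tail `T`: a generator `f` acts on the first letters as `w11 f T`, `w21 f T`, and so on,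
and on later letters through `X ◁ _`. The `simp` set moves operations on later letters in front of
those on earlier letters, so that two composites that differ by interchange have the same normal
form. Formulas in Sweedler notation suppress the braidings.
-/

namespace BraidedDuality
set_option linter.unusedSectionVars false

/-! ### String diagrams on right-nested tensor words -/

section Words
variable {C : Type u} [Category.{v} C] [MonoidalCategory C]

/-- `f : X ⟶ Y` applied to the first letter of a right-nested word with tail `T`. -/
def w11 {X Y : C} (f : X ⟶ Y) (T : C) : X ⊗ T ⟶ Y ⊗ T := f ▷ T
/-- `f : X ⊗ Y ⟶ Z` applied to the first two letters of a right-nested word with tail `T`. -/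
def w21 {X Y Z : C} (f : X ⊗ Y ⟶ Z) (T : C) : X ⊗ Y ⊗ T ⟶ Z ⊗ T := (α_ X Y T).inv ≫ f ▷ T
/-- `f : X ⟶ Y ⊗ Z` applied to the first letter of a right-nested word with tail `T`. -/
def w12 {X Y Z : C} (f : X ⟶ Y ⊗ Z) (T : C) : X ⊗ T ⟶ Y ⊗ Z ⊗ T := f ▷ T ≫ (α_ Y Z T).hom
/-- `f : X ⊗ Y ⟶ Z ⊗ W` applied to the first two letters of a right-nested word with tail `T`. -/
def w22 {X Y Z W : C} (f : X ⊗ Y ⟶ Z ⊗ W) (T : C) : X ⊗ Y ⊗ T ⟶ Z ⊗ W ⊗ T :=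
  (α_ X Y T).inv ≫ f ▷ T ≫ (α_ Z W T).hom
/-- `f : X ⊗ Y ⟶ 𝟙_ C` deleting the first two letters of a right-nested word with tail `T`. -/
def w20 {X Y : C} (f : X ⊗ Y ⟶ 𝟙_ C) (T : C) : X ⊗ Y ⊗ T ⟶ T :=
  (α_ X Y T).inv ≫ f ▷ T ≫ (λ_ T).hom
/-- `f : 𝟙_ C ⟶ X ⊗ Y` inserting two letters in front of the word `T`. -/
def w02 {X Y : C} (f : 𝟙_ C ⟶ X ⊗ Y) (T : C) : T ⟶ X ⊗ Y ⊗ T :=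
  (λ_ T).inv ≫ f ▷ T ≫ (α_ X Y T).hom
/-- `f : X ⟶ 𝟙_ C` deleting the first letter of a right-nested word with tail `T`. -/
def w10 {X : C} (f : X ⟶ 𝟙_ C) (T : C) : X ⊗ T ⟶ T := f ▷ T ≫ (λ_ T).hom
/-- `f : 𝟙_ C ⟶ X` inserting a letter in front of the word `T`. -/
def w01 {X : C} (f : 𝟙_ C ⟶ X) (T : C) : T ⟶ X ⊗ T := (λ_ T).inv ≫ f ▷ T

variable {X Y Z W V U T T' : C}

theorem whiskerLeft_merge (f : X ⟶ Y) (g : Y ⟶ Z) : V ◁ f ≫ V ◁ g = V ◁ (f ≫ g) :=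
  (MonoidalCategory.whiskerLeft_comp V f g).symm
theorem whiskerLeft_merge_assoc (f : X ⟶ Y) (g : Y ⟶ Z) (h : V ⊗ Z ⟶ W) :
    V ◁ f ≫ V ◁ g ≫ h = V ◁ (f ≫ g) ≫ h := by
  rw [MonoidalCategory.whiskerLeft_comp, Category.assoc]

theorem w11_late (f : X ⟶ Z) (k : T ⟶ T') :
    w11 f T ≫ Z ◁ k = X ◁ k ≫ w11 f T' := by
  exact (whisker_exchange f k).symm
theorem w11_late_assoc (f : X ⟶ Z) (k : T ⟶ T') (h : Z ⊗ T' ⟶ U) :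
    w11 f T ≫ Z ◁ k ≫ h = X ◁ k ≫ w11 f T' ≫ h := by
  rw [← Category.assoc, w11_late, Category.assoc]
theorem w21_late (f : X ⊗ Y ⟶ Z) (k : T ⟶ T') :
    w21 f T ≫ Z ◁ k = X ◁ Y ◁ k ≫ w21 f T' := by
  simp only [w21, associator_inv_naturality_right_assoc, whisker_exchange, Category.assoc]
theorem w21_late_assoc (f : X ⊗ Y ⟶ Z) (k : T ⟶ T') (h : Z ⊗ T' ⟶ U) :
    w21 f T ≫ Z ◁ k ≫ h = X ◁ Y ◁ k ≫ w21 f T' ≫ h := by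
  rw [← Category.assoc, w21_late, Category.assoc]
theorem w12_late (f : X ⟶ Z ⊗ W) (k : T ⟶ T') :
    w12 f T ≫ Z ◁ W ◁ k = X ◁ k ≫ w12 f T' := by
  simp only [w12, whisker_exchange_assoc, Category.assoc, associator_naturality_right]
theorem w12_late_assoc (f : X ⟶ Z ⊗ W) (k : T ⟶ T') (h : Z ⊗ W ⊗ T' ⟶ U) :
    w12 f T ≫ Z ◁ W ◁ k ≫ h = X ◁ k ≫ w12 f T' ≫ h := by
  rw [← Category.assoc, w12_late, Category.assoc]
theorem w12_late' (f : X ⟶ Z ⊗ W) (k : T ⟶ T') (l : W ⊗ T' ⟶ V) :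
    w12 f T ≫ Z ◁ (W ◁ k ≫ l) = X ◁ k ≫ w12 f T' ≫ Z ◁ l := by
  rw [MonoidalCategory.whiskerLeft_comp, w12_late_assoc]
theorem w12_late_assoc' (f : X ⟶ Z ⊗ W) (k : T ⟶ T') (l : W ⊗ T' ⟶ V) (h : Z ⊗ V ⟶ U) :
    w12 f T ≫ Z ◁ (W ◁ k ≫ l) ≫ h = X ◁ k ≫ w12 f T' ≫ Z ◁ l ≫ h := by
  rw [MonoidalCategory.whiskerLeft_comp, Category.assoc, w12_late_assoc]
theorem w22_late (f : X ⊗ Y ⟶ Z ⊗ W) (k : T ⟶ T') :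
    w22 f T ≫ Z ◁ W ◁ k = X ◁ Y ◁ k ≫ w22 f T' := by
  simp only [w22, associator_inv_naturality_right_assoc, whisker_exchange_assoc, Category.assoc,
    associator_naturality_right]
theorem w22_late_assoc (f : X ⊗ Y ⟶ Z ⊗ W) (k : T ⟶ T') (h : Z ⊗ W ⊗ T' ⟶ U) :
    w22 f T ≫ Z ◁ W ◁ k ≫ h = X ◁ Y ◁ k ≫ w22 f T' ≫ h := by
  rw [← Category.assoc, w22_late, Category.assoc]
theorem w22_late' (f : X ⊗ Y ⟶ Z ⊗ W) (k : T ⟶ T') (l : W ⊗ T' ⟶ V) :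
    w22 f T ≫ Z ◁ (W ◁ k ≫ l) = X ◁ Y ◁ k ≫ w22 f T' ≫ Z ◁ l := by
  rw [MonoidalCategory.whiskerLeft_comp, w22_late_assoc]
theorem w22_late_assoc' (f : X ⊗ Y ⟶ Z ⊗ W) (k : T ⟶ T') (l : W ⊗ T' ⟶ V) (h : Z ⊗ V ⟶ U) :
    w22 f T ≫ Z ◁ (W ◁ k ≫ l) ≫ h = X ◁ Y ◁ k ≫ w22 f T' ≫ Z ◁ l ≫ h := by
  rw [MonoidalCategory.whiskerLeft_comp, Category.assoc, w22_late_assoc]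
theorem w20_late (f : X ⊗ Y ⟶ 𝟙_ C) (k : T ⟶ T') :
    w20 f T ≫ k = X ◁ Y ◁ k ≫ w20 f T' := by
  simp only [w20, associator_inv_naturality_right_assoc, whisker_exchange_assoc, Category.assoc,
    leftUnitor_naturality]
theorem w02_late (f : 𝟙_ C ⟶ Z ⊗ W) (k : T ⟶ T') :
    w02 f T ≫ Z ◁ W ◁ k = k ≫ w02 f T' := by
  simp only [w02, leftUnitor_inv_naturality_assoc, whisker_exchange_assoc, Category.assoc,
    associator_naturality_right]
theorem w02_late_assoc (f : 𝟙_ C ⟶ Z ⊗ W) (k : T ⟶ T') (h : Z ⊗ W ⊗ T' ⟶ U) :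
    w02 f T ≫ Z ◁ W ◁ k ≫ h = k ≫ w02 f T' ≫ h := by
  rw [← Category.assoc, w02_late, Category.assoc]
theorem w02_late' (f : 𝟙_ C ⟶ Z ⊗ W) (k : T ⟶ T') (l : W ⊗ T' ⟶ V) :
    w02 f T ≫ Z ◁ (W ◁ k ≫ l) = k ≫ w02 f T' ≫ Z ◁ l := by
  rw [MonoidalCategory.whiskerLeft_comp, w02_late_assoc]
theorem w02_late_assoc' (f : 𝟙_ C ⟶ Z ⊗ W) (k : T ⟶ T') (l : W ⊗ T' ⟶ V) (h : Z ⊗ V ⟶ U) :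
    w02 f T ≫ Z ◁ (W ◁ k ≫ l) ≫ h = k ≫ w02 f T' ≫ Z ◁ l ≫ h := by
  rw [MonoidalCategory.whiskerLeft_comp, Category.assoc, w02_late_assoc]
theorem w10_late (f : X ⟶ 𝟙_ C) (k : T ⟶ T') :
    w10 f T ≫ k = X ◁ k ≫ w10 f T' := by
  simp only [w10, whisker_exchange_assoc, Category.assoc, leftUnitor_naturality]
theorem w01_late (f : 𝟙_ C ⟶ Z) (k : T ⟶ T') :
    w01 f T ≫ Z ◁ k = k ≫ w01 f T' := by
  simp only [w01, leftUnitor_inv_naturality_assoc, whisker_exchange, Category.assoc]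
theorem w01_late_assoc (f : 𝟙_ C ⟶ Z) (k : T ⟶ T') (h : Z ⊗ T' ⟶ U) :
    w01 f T ≫ Z ◁ k ≫ h = k ≫ w01 f T' ≫ h := by
  rw [← Category.assoc, w01_late, Category.assoc]

attribute [simp] whiskerLeft_merge whiskerLeft_merge_assoc w11_late w11_late_assoc w21_late
  w21_late_assoc w12_late w12_late_assoc w12_late' w12_late_assoc' w22_late w22_late_assoc w22_late'
  w22_late_assoc' w20_late w02_late w02_late_assoc w02_late' w02_late_assoc' w10_late w01_late
  w01_late_assoc

theorem w22_comp {X Y Z W V U : C} (f : X ⊗ Y ⟶ Z ⊗ W) (g : Z ⊗ W ⟶ V ⊗ U) :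
    w22 f T ≫ w22 g T = w22 (f ≫ g) T := by simp [w22]
@[simp] theorem w22_id : w22 (𝟙 (X ⊗ Y)) T = 𝟙 _ := by simp [w22]

variable [BraidedCategory C]

/-- The braiding of the first two letters of a right-nested word with tail `T`. -/
abbrev br (X Y T : C) : X ⊗ Y ⊗ T ⟶ Y ⊗ X ⊗ T := w22 (β_ X Y).hom T
/-- The inverse of `br X Y T`. -/
abbrev ib (X Y T : C) : Y ⊗ X ⊗ T ⟶ X ⊗ Y ⊗ T := w22 (β_ X Y).inv T

@[simp] theorem br_ib : br X Y T ≫ ib X Y T = 𝟙 _ := by simp [w22_comp]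
@[simp] theorem ib_br : ib X Y T ≫ br X Y T = 𝟙 _ := by simp [w22_comp]
@[simp] theorem br_ib_assoc (h : X ⊗ Y ⊗ T ⟶ W) : br X Y T ≫ ib X Y T ≫ h = h := by
  rw [← Category.assoc, br_ib, Category.id_comp]
/-- The Yang-Baxter equation. -/
theorem br_br_br : br X Y (Z ⊗ T) ≫ Y ◁ br X Z T ≫ br Y Z (X ⊗ T) =
    X ◁ br Y Z T ≫ br X Z (Y ⊗ T) ≫ Z ◁ br X Y T := by
  calc _ = 𝟙 _ ⊗≫ ((α_ X Y Z).inv ≫ (β_ X Y).hom ▷ Z ≫ (α_ Y X Z).hom ≫ Y ◁ (β_ X Z).hom ≫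
        (α_ Y Z X).inv ≫ (β_ Y Z).hom ▷ X ≫ (α_ Z Y X).hom) ▷ T ⊗≫ 𝟙 _ := by
        simp only [br, w22]; monoidal
    _ = _ := by rw [yang_baxter]; simp only [br, w22]; monoidal

theorem w21_br (f : X ⊗ Y ⟶ Z) : w21 f (V ⊗ T) ≫ br Z V T =
    X ◁ br Y V T ≫ br X V (Y ⊗ T) ≫ V ◁ w21 f T := by
  calc _ = 𝟙 _ ⊗≫ (f ▷ V ≫ (β_ Z V).hom) ▷ T ⊗≫ 𝟙 _ := by simp only [w21, br, w22]; monoidal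
    _ = _ := by rw [braiding_naturality_left, braiding_tensor_left_hom]; simp only [w21, br, w22]; monoidal
theorem br_w21 (f : X ⊗ Y ⟶ Z) : V ◁ w21 f T ≫ br V Z T =
    br V X (Y ⊗ T) ≫ X ◁ br V Y T ≫ w21 f (V ⊗ T) := by
  calc _ = 𝟙 _ ⊗≫ (V ◁ f ≫ (β_ V Z).hom) ▷ T ⊗≫ 𝟙 _ := by simp only [w21, br, w22]; monoidal
    _ = _ := by rw [braiding_naturality_right, braiding_tensor_right_hom]; simp only [w21, br, w22]; monoidal
theorem w12_br (f : X ⟶ Y ⊗ Z) : br X V T ≫ V ◁ w12 f T =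
    w12 f (V ⊗ T) ≫ Y ◁ br Z V T ≫ br Y V (Z ⊗ T) := by
  calc _ = 𝟙 _ ⊗≫ ((β_ X V).hom ≫ V ◁ f) ▷ T ⊗≫ 𝟙 _ := by simp only [w12, br, w22]; monoidal
    _ = _ := by
      rw [← braiding_naturality_left, braiding_tensor_left_hom]; simp only [w12, br, w22]; monoidal
theorem br_w12 (f : X ⟶ Y ⊗ Z) : br V X T ≫ w12 f (V ⊗ T) =
    V ◁ w12 f T ≫ br V Y (Z ⊗ T) ≫ Y ◁ br V Z T := by
  calc _ = 𝟙 _ ⊗≫ ((β_ V X).hom ≫ f ▷ V) ▷ T ⊗≫ 𝟙 _ := by simp only [w12, br, w22]; monoidal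
    _ = _ := by
      rw [← braiding_naturality_right, braiding_tensor_right_hom]; simp only [w12, br, w22]; monoidal
theorem w11_br (f : X ⟶ Y) : w11 f (V ⊗ T) ≫ br Y V T = br X V T ≫ V ◁ w11 f T := by
  calc _ = 𝟙 _ ⊗≫ (f ▷ V ≫ (β_ Y V).hom) ▷ T ⊗≫ 𝟙 _ := by simp only [w11, br, w22]; monoidal
    _ = _ := by rw [braiding_naturality_left]; simp only [w11, br, w22]; monoidal
theorem br_w11 (f : X ⟶ Y) : V ◁ w11 f T ≫ br V Y T = br V X T ≫ w11 f (V ⊗ T) := by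
  calc _ = 𝟙 _ ⊗≫ (V ◁ f ≫ (β_ V Y).hom) ▷ T ⊗≫ 𝟙 _ := by simp only [w11, br, w22]; monoidal
    _ = _ := by rw [braiding_naturality_right]; simp only [w11, br, w22]; monoidal
theorem w01_br (f : 𝟙_ C ⟶ X) : w01 f (V ⊗ T) ≫ br X V T = V ◁ w01 f T := by
  calc _ = 𝟙 _ ⊗≫ (f ▷ V ≫ (β_ X V).hom) ▷ T ⊗≫ 𝟙 _ := by simp only [w01, br, w22]; monoidal
    _ = _ := by rw [braiding_naturality_left, braiding_tensorUnit_left]; simp only [w01]; monoidal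
theorem br_w01 (f : 𝟙_ C ⟶ X) : V ◁ w01 f T ≫ br V X T = w01 f (V ⊗ T) := by
  calc _ = 𝟙 _ ⊗≫ (V ◁ f ≫ (β_ V X).hom) ▷ T ⊗≫ 𝟙 _ := by simp only [w01, br, w22]; monoidal
    _ = _ := by rw [braiding_naturality_right, braiding_tensorUnit_right]; simp only [w01]; monoidal
theorem w10_br (f : X ⟶ 𝟙_ C) : br X V T ≫ V ◁ w10 f T = w10 f (V ⊗ T) := by
  calc _ = 𝟙 _ ⊗≫ ((β_ X V).hom ≫ V ◁ f) ▷ T ⊗≫ 𝟙 _ := by simp only [w10, br, w22]; monoidal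
    _ = _ := by rw [← braiding_naturality_left, braiding_tensorUnit_left]; simp only [w10]; monoidal
theorem br_w10 (f : X ⟶ 𝟙_ C) : br V X T ≫ w10 f (V ⊗ T) = V ◁ w10 f T := by
  calc _ = 𝟙 _ ⊗≫ ((β_ V X).hom ≫ f ▷ V) ▷ T ⊗≫ 𝟙 _ := by simp only [w10, br, w22]; monoidal
    _ = _ := by rw [← braiding_naturality_right, braiding_tensorUnit_right]; simp only [w10]; monoidal
theorem w02_br (f : 𝟙_ C ⟶ X ⊗ Y) : w02 f (V ⊗ T) ≫ X ◁ br Y V T ≫ br X V (Y ⊗ T) = V ◁ w02 f T := by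
  calc _ = 𝟙 _ ⊗≫ (f ▷ V ≫ (β_ (X ⊗ Y) V).hom) ▷ T ⊗≫ 𝟙 _ := by
        rw [braiding_tensor_left_hom]; simp only [w02, br, w22]; monoidal
    _ = _ := by rw [braiding_naturality_left, braiding_tensorUnit_left]; simp only [w02]; monoidal
theorem w20_br (f : X ⊗ Y ⟶ 𝟙_ C) :
    X ◁ br Y V T ≫ br X V (Y ⊗ T) ≫ V ◁ w20 f T = w20 f (V ⊗ T) := by
  calc _ = 𝟙 _ ⊗≫ ((β_ (X ⊗ Y) V).hom ≫ V ◁ f) ▷ T ⊗≫ 𝟙 _ := by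
        rw [braiding_tensor_left_hom]; simp only [w20, br, w22]; monoidal
    _ = _ := by rw [← braiding_naturality_left, braiding_tensorUnit_left]; simp only [w20]; monoidal
theorem br_w20 (f : X ⊗ Y ⟶ 𝟙_ C) :
    br V X (Y ⊗ T) ≫ X ◁ br V Y T ≫ w20 f (V ⊗ T) = V ◁ w20 f T := by
  calc _ = 𝟙 _ ⊗≫ ((β_ V (X ⊗ Y)).hom ≫ f ▷ V) ▷ T ⊗≫ 𝟙 _ := by
        rw [braiding_tensor_right_hom]; simp only [w20, br, w22]; monoidal
    _ = _ := by rw [← braiding_naturality_right, braiding_tensorUnit_right]; simp only [w20]; monoidal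

end Words

-- The converse of `whiskerLeft_merge`, which would make `simp` loop.
attribute [-simp] MonoidalCategory.whiskerLeft_comp

/-! ### The algebraic axioms on words -/

section Laws
variable {C : Type u} [Category.{v} C] [MonoidalCategory C] {A T : C}

theorem w_mul_assoc [MonObj A] :
    w21 μ[A] (A ⊗ T) ≫ w21 μ[A] T = A ◁ w21 μ[A] T ≫ w21 μ[A] T := by
  calc _ = 𝟙 _ ⊗≫ (μ[A] ▷ A ≫ μ[A]) ▷ T := by simp only [w21]; monoidal
    _ = _ := by rw [MonObj.mul_assoc]; simp only [w21]; monoidal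
@[simp] theorem w_one_mul [MonObj A] : w01 η[A] (A ⊗ T) ≫ w21 μ[A] T = 𝟙 _ := by
  calc _ = 𝟙 _ ⊗≫ (η[A] ▷ A ≫ μ[A]) ▷ T := by simp only [w01, w21]; monoidal
    _ = _ := by rw [MonObj.one_mul]; monoidal
@[simp] theorem w_mul_one [MonObj A] : A ◁ w01 η[A] T ≫ w21 μ[A] T = 𝟙 _ := by
  calc _ = 𝟙 _ ⊗≫ (A ◁ η[A] ≫ μ[A]) ▷ T := by simp only [w01, w21]; monoidal
    _ = _ := by rw [MonObj.mul_one]; monoidal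
@[simp] theorem w_mul_one_assoc [MonObj A] {Z : C} (h : A ⊗ T ⟶ Z) :
    A ◁ w01 η[A] T ≫ w21 μ[A] T ≫ h = h := by
  rw [← Category.assoc, w_mul_one, Category.id_comp]
theorem w_comul_assoc [ComonObj A] :
    w12 Δ[A] T ≫ A ◁ w12 Δ[A] T = w12 Δ[A] T ≫ w12 Δ[A] (A ⊗ T) := by
  calc _ = 𝟙 _ ⊗≫ (Δ[A] ≫ A ◁ Δ[A]) ▷ T ⊗≫ 𝟙 _ := by simp only [w12]; monoidal
    _ = _ := by rw [ComonObj.comul_assoc]; simp only [w12]; monoidal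
@[simp] theorem w_counit_comul [ComonObj A] : w12 Δ[A] T ≫ w10 ε[A] (A ⊗ T) = 𝟙 _ := by
  calc _ = 𝟙 _ ⊗≫ (Δ[A] ≫ ε[A] ▷ A) ▷ T ⊗≫ 𝟙 _ := by simp only [w12, w10]; monoidal
    _ = _ := by rw [ComonObj.counit_comul]; monoidal
@[simp] theorem w_counit_comul_assoc [ComonObj A] {Z : C} (h : A ⊗ T ⟶ Z) :
    w12 Δ[A] T ≫ w10 ε[A] (A ⊗ T) ≫ h = h := by
  rw [← Category.assoc, w_counit_comul, Category.id_comp]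
@[simp] theorem w_comul_counit [ComonObj A] : w12 Δ[A] T ≫ A ◁ w10 ε[A] T = 𝟙 _ := by
  calc _ = 𝟙 _ ⊗≫ (Δ[A] ≫ A ◁ ε[A]) ▷ T ⊗≫ 𝟙 _ := by simp only [w12, w10]; monoidal
    _ = _ := by rw [ComonObj.comul_counit]; monoidal
@[simp] theorem w_comul_counit_assoc [ComonObj A] {Z : C} (h : A ⊗ T ⟶ Z) :
    w12 Δ[A] T ≫ A ◁ w10 ε[A] T ≫ h = h := by
  rw [← Category.assoc, w_comul_counit, Category.id_comp]

theorem w_mul_comul [BraidedCategory C] [BimonObj A] : w21 μ[A] T ≫ w12 Δ[A] T =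
    w12 Δ[A] (A ⊗ T) ≫ A ◁ A ◁ w12 Δ[A] T ≫ A ◁ br A A (A ⊗ T) ≫
      w21 μ[A] (A ⊗ A ⊗ T) ≫ A ◁ w21 μ[A] T := by
  calc _ = 𝟙 _ ⊗≫ (μ[A] ≫ Δ[A]) ▷ T ⊗≫ 𝟙 _ := by simp only [w12, w21]; monoidal
    _ = _ := by
      rw [BimonObj.mul_comul, tensorμ, MonoidalCategory.tensorHom_def,
        MonoidalCategory.tensorHom_def]
      simp only [w12, w21, br, w22]; monoidal
@[simp] theorem w_one_counit [BraidedCategory C] [BimonObj A] : w01 η[A] T ≫ w10 ε[A] T = 𝟙 _ := by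
  calc _ = 𝟙 _ ⊗≫ (η[A] ≫ ε[A]) ▷ T ⊗≫ 𝟙 _ := by simp only [w10, w01]; monoidal
    _ = _ := by rw [BimonObj.one_counit]; monoidal
theorem w11_comp {X Y Z : C} (f : X ⟶ Y) (g : Y ⟶ Z) : w11 f T ≫ w11 g T = w11 (f ≫ g) T :=
  (comp_whiskerRight f g T).symm
@[simp] theorem w11_id {X : C} : w11 (𝟙 X) T = 𝟙 _ := id_whiskerRight X T

theorem eq_of_w11_eq {X Y : C} {f g : X ⟶ Y} (h : ∀ T, w11 f T = w11 g T) : f = g := by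
  have := h (𝟙_ C)
  simpa [w11] using this

section Hopf
open HopfObj
variable [BraidedCategory C] [HopfObj A]

theorem w_antipode_left : w12 Δ[A] T ≫ w11 𝒮[A] (A ⊗ T) ≫ w21 μ[A] T = w10 ε[A] T ≫ w01 η[A] T := by
  calc _ = 𝟙 _ ⊗≫ (Δ[A] ≫ 𝒮[A] ▷ A ≫ μ[A]) ▷ T := by simp only [w12, w11, w21]; monoidal
    _ = _ := by rw [antipode_left]; simp only [w10, w01]; monoidal
theorem w_antipode_right : w12 Δ[A] T ≫ A ◁ w11 𝒮[A] T ≫ w21 μ[A] T = w10 ε[A] T ≫ w01 η[A] T := by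
  calc _ = 𝟙 _ ⊗≫ (Δ[A] ≫ A ◁ 𝒮[A] ≫ μ[A]) ▷ T := by simp only [w12, w11, w21]; monoidal
    _ = _ := by rw [antipode_right]; simp only [w10, w01]; monoidal
theorem w_mul_antipode : w21 μ[A] T ≫ w11 𝒮[A] T =
    w11 𝒮[A] (A ⊗ T) ≫ A ◁ w11 𝒮[A] T ≫ br A A T ≫ w21 μ[A] T := by
  calc _ = 𝟙 _ ⊗≫ (μ[A] ≫ 𝒮[A]) ▷ T := by simp only [w11, w21]; monoidal
    _ = _ := by
      rw [mul_antipode, MonoidalCategory.tensorHom_def]; simp only [w11, w21, br, w22]; monoidal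
theorem w_antipode_comul : w11 𝒮[A] T ≫ w12 Δ[A] T =
    w12 Δ[A] T ≫ br A A T ≫ w11 𝒮[A] (A ⊗ T) ≫ A ◁ w11 𝒮[A] T := by
  calc _ = 𝟙 _ ⊗≫ (𝒮[A] ≫ Δ[A]) ▷ T ⊗≫ 𝟙 _ := by simp only [w11, w12]; monoidal
    _ = _ := by
      rw [antipode_comul, MonoidalCategory.tensorHom_def]; simp only [w11, w12, br, w22]; monoidal
@[simp] theorem w_one_antipode : w01 η[A] T ≫ w11 𝒮[A] T = w01 η[A] T := by
  calc _ = 𝟙 _ ⊗≫ (η[A] ≫ 𝒮[A]) ▷ T := by simp only [w01, w11]; monoidal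
    _ = _ := by rw [one_antipode]; simp only [w01]; monoidal
@[simp] theorem w_one_antipode_assoc {Z : C} (h : A ⊗ T ⟶ Z) :
    w01 η[A] T ≫ w11 𝒮[A] T ≫ h = w01 η[A] T ≫ h := by
  rw [← Category.assoc, w_one_antipode]
@[simp] theorem w_antipode_counit : w11 𝒮[A] T ≫ w10 ε[A] T = w10 ε[A] T := by
  calc _ = 𝟙 _ ⊗≫ (𝒮[A] ≫ ε[A]) ▷ T ⊗≫ 𝟙 _ := by simp only [w10, w11]; monoidal
    _ = _ := by rw [antipode_counit]; simp only [w10]; monoidal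
end Hopf

section Pairing
variable {X Y : C} [ExactPairing X Y]
@[simp] theorem w_coev_eval : w02 (η_ X Y) (X ⊗ T) ≫ X ◁ w20 (ε_ X Y) T = 𝟙 _ := by
  calc _ = 𝟙 _ ⊗≫ (η_ X Y ▷ X ⊗≫ X ◁ ε_ X Y) ▷ T ⊗≫ 𝟙 _ := by simp only [w02, w20]; monoidal
    _ = _ := by rw [ExactPairing.evaluation_coevaluation'']; monoidal
@[simp] theorem w_coev_eval_assoc {Z : C} (h : X ⊗ T ⟶ Z) :
    w02 (η_ X Y) (X ⊗ T) ≫ X ◁ w20 (ε_ X Y) T ≫ h = h := by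
  rw [← Category.assoc, w_coev_eval, Category.id_comp]
@[simp] theorem w_eval_coev : Y ◁ w02 (η_ X Y) T ≫ w20 (ε_ X Y) (Y ⊗ T) = 𝟙 _ := by
  calc _ = 𝟙 _ ⊗≫ (Y ◁ η_ X Y ⊗≫ ε_ X Y ▷ Y) ▷ T ⊗≫ 𝟙 _ := by simp only [w02, w20]; monoidal
    _ = _ := by rw [ExactPairing.coevaluation_evaluation'']; monoidal
@[simp] theorem w_eval_coev_assoc {Z : C} (h : Y ⊗ T ⟶ Z) :
    Y ◁ w02 (η_ X Y) T ≫ w20 (ε_ X Y) (Y ⊗ T) ≫ h = h := by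
  rw [← Category.assoc, w_eval_coev, Category.id_comp]
end Pairing

section Sym
variable [BraidedCategory C]
@[simp] theorem br_br_self [SelfSymmetric A] : br A A T ≫ br A A T = 𝟙 _ := by
  calc _ = 𝟙 _ ⊗≫ ((β_ A A).hom ≫ (β_ A A).hom) ▷ T ⊗≫ 𝟙 _ := by simp only [br, w22]; monoidal
    _ = _ := by rw [SelfSymmetric.braiding_braiding]; monoidal
@[simp] theorem br_br_self_assoc [SelfSymmetric A] {Z : C} (h : A ⊗ A ⊗ T ⟶ Z) :
    br A A T ≫ br A A T ≫ h = h := by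
  rw [← Category.assoc, br_br_self, Category.id_comp]
variable {D : C} [ExactPairing A D]
@[simp] theorem br_br_dual [SelfSymmetric A] : br D A T ≫ br A D T = 𝟙 _ := by
  calc _ = 𝟙 _ ⊗≫ ((β_ D A).hom ≫ (β_ A D).hom) ▷ T ⊗≫ 𝟙 _ := by simp only [br, w22]; monoidal
    _ = _ := by rw [braiding_dual_eq_inv A D, Iso.inv_hom_id]; monoidal
@[simp] theorem br_br_dual_assoc [SelfSymmetric A] {Z : C} (h : D ⊗ A ⊗ T ⟶ Z) :
    br D A T ≫ br A D T ≫ h = h := by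
  rw [← Category.assoc, br_br_dual, Category.id_comp]
@[simp] theorem br_br_dual' [SelfSymmetric A] : br A D T ≫ br D A T = 𝟙 _ := by
  calc _ = 𝟙 _ ⊗≫ ((β_ A D).hom ≫ (β_ D A).hom) ▷ T ⊗≫ 𝟙 _ := by simp only [br, w22]; monoidal
    _ = _ := by rw [braiding_dual_eq_inv A D, Iso.hom_inv_id]; monoidal
@[simp] theorem br_br_dual'_assoc [SelfSymmetric A] {Z : C} (h : A ⊗ D ⊗ T ⟶ Z) :
    br A D T ≫ br D A T ≫ h = h := by
  rw [← Category.assoc, br_br_dual', Category.id_comp]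
end Sym
end Laws

open HopfObj

/-! ### A left inverse of the antipode -/

section Integral
variable {C : Type u} [Category.{v} C] [MonoidalCategory C] [BraidedCategory C]
variable (H D : C) [HopfObj H] [ExactPairing H D]

local notation "mH" => w21 μ[H]
local notation "dH" => w12 Δ[H]
local notation "uH" => w01 η[H]
local notation "eH" => w10 ε[H]
local notation "sH" => w11 (antipode : H ⟶ H)
local notation "ssH" => w11 ((antipode : H ⟶ H) ≫ antipode)
local notation "bH" => w02 (η_ H D)
local notation "vH" => w20 (ε_ H D)

/-- The morphism `D ⟶ H ⊗ D`, `f ↦ f₁ ⊗ f₀`, with `⟨f₀, x⟩ f₁ = ⟨f, x₁⟩ x₂`. -/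
def coact : D ⟶ H ⊗ D :=
  𝟙 _ ⊗≫ D ◁ (η_ H D ≫ Δ[H] ▷ D) ⊗≫ ε_ H D ▷ (H ⊗ D) ⊗≫ 𝟙 _
/-- The right action `⟨f · h, x⟩ = ⟨f, h x⟩` of `H` on its dual. -/
def ract : D ⊗ H ⟶ D :=
  𝟙 _ ⊗≫ D ◁ (H ◁ η_ H D ⊗≫ μ[H] ▷ D) ⊗≫ ε_ H D ▷ D ⊗≫ 𝟙 _

variable {H D} {T T' W : C}

theorem w_coact : w12 (coact H D) T = D ◁ bH T ≫ D ◁ dH (D ⊗ T) ≫ vH (H ⊗ D ⊗ T) := by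
  simp only [coact, w12, w02, w20]; monoidal
theorem w_ract : w21 (ract H D) T = D ◁ H ◁ bH T ≫ D ◁ mH (D ⊗ T) ≫ vH (D ⊗ T) := by
  simp only [ract, w21, w02, w20]; monoidal
local notation "coa" => w12 (coact H D)
local notation "ra" => w21 (ract H D)

theorem coact_eval : coa (H ⊗ T) ≫ H ◁ vH T = D ◁ dH T ≫ vH (H ⊗ T) := by
  calc _ = D ◁ (bH (H ⊗ T) ≫ H ◁ vH T) ≫ D ◁ dH T ≫ vH (H ⊗ T) := by
        simp [w_coact]
    _ = _ := by simp
theorem ract_eval : ra (H ⊗ T) ≫ vH T = D ◁ mH T ≫ vH T := by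
  calc _ = D ◁ H ◁ (bH (H ⊗ T) ≫ H ◁ vH T) ≫ D ◁ mH T ≫ vH T := by
        simp [w_ract]
    _ = _ := by simp

theorem ract_ract : ra (H ⊗ T) ≫ ra T = D ◁ mH T ≫ ra T := by
  calc _ = D ◁ H ◁ H ◁ bH T ≫ (ra (H ⊗ H ⊗ D ⊗ T) ≫ D ◁ mH (D ⊗ T)) ≫ vH (D ⊗ T) := by
        simp [w_ract]
    _ = D ◁ H ◁ H ◁ bH T ≫ D ◁ H ◁ mH (D ⊗ T) ≫ (ra (H ⊗ D ⊗ T) ≫ vH (D ⊗ T)) := by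
        simp
    _ = D ◁ H ◁ H ◁ bH T ≫ D ◁ (H ◁ mH (D ⊗ T) ≫ mH (D ⊗ T)) ≫ vH (D ⊗ T) := by
        rw [ract_eval]; simp
    _ = _ := by rw [← w_mul_assoc]; simp [w_ract]

theorem ract_one : D ◁ uH T ≫ ra T = 𝟙 _ := by
  calc _ = D ◁ bH T ≫ D ◁ (uH (H ⊗ D ⊗ T) ≫ mH (D ⊗ T)) ≫ vH (D ⊗ T) := by
        simp [w_ract]
    _ = _ := by rw [w_one_mul]; simp

theorem coact_coact : coa T ≫ H ◁ coa T = coa T ≫ dH (D ⊗ T) := by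
  calc _ = D ◁ bH T ≫ (coa (H ⊗ D ⊗ T) ≫ H ◁ D ◁ dH (D ⊗ T)) ≫ H ◁ vH (H ⊗ D ⊗ T) := by
        nth_rw 2 [w_coact]; simp
    _ = D ◁ bH T ≫ D ◁ dH (D ⊗ T) ≫ (coa (H ⊗ H ⊗ D ⊗ T) ≫ H ◁ vH (H ⊗ D ⊗ T)) := by
        simp
    _ = D ◁ bH T ≫ D ◁ (dH (D ⊗ T) ≫ dH (H ⊗ D ⊗ T)) ≫ vH (H ⊗ H ⊗ D ⊗ T) := by
        rw [coact_eval]; simp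
    _ = _ := by rw [← w_comul_assoc, w_coact]; simp

theorem coact_counit : coa T ≫ eH (D ⊗ T) = 𝟙 _ := by
  calc _ = D ◁ bH T ≫ D ◁ (dH (D ⊗ T) ≫ H ◁ eH (D ⊗ T)) ≫ vH (D ⊗ T) := by
        rw [w_coact]; simp
    _ = _ := by rw [w_comul_counit]; simp

/-- `S(h) x₁ ⊗ x₂ = (S(h₂) x)₁ ⊗ h₁ (S(h₂) x)₂`. -/
theorem antipode_mul_comul : sH (H ⊗ T) ≫ H ◁ dH T ≫ mH (H ⊗ T) =
    dH (H ⊗ T) ≫ H ◁ sH (H ⊗ T) ≫ H ◁ mH T ≫ H ◁ dH T ≫ br H H (H ⊗ T) ≫ H ◁ mH T := by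
  symm
  calc _ = dH (H ⊗ T) ≫ H ◁ sH (H ⊗ T) ≫ H ◁ (mH T ≫ dH T) ≫ br H H (H ⊗ T) ≫ H ◁ mH T := by
        simp
    _ = dH (H ⊗ T) ≫ H ◁ (sH (H ⊗ T) ≫ dH (H ⊗ T)) ≫ H ◁ H ◁ H ◁ dH T ≫ H ◁ H ◁ br H H (H ⊗ T) ≫
          (H ◁ mH (H ⊗ H ⊗ T) ≫ br H H (H ⊗ H ⊗ T)) ≫ H ◁ H ◁ mH T ≫ H ◁ mH T := by
        rw [w_mul_comul]; simp
    _ = dH (H ⊗ T) ≫ H ◁ dH (H ⊗ T) ≫ H ◁ br H H (H ⊗ T) ≫ H ◁ sH (H ⊗ H ⊗ T) ≫ H ◁ H ◁ sH (H ⊗ T) ≫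
          H ◁ H ◁ H ◁ dH T ≫ H ◁ H ◁ br H H (H ⊗ T) ≫
          br H H (H ⊗ H ⊗ H ⊗ T) ≫ H ◁ br H H (H ⊗ H ⊗ T) ≫ mH (H ⊗ H ⊗ H ⊗ T) ≫
          H ◁ (H ◁ mH T ≫ mH T) := by
        rw [w_antipode_comul, br_w21]; simp
    _ = dH (H ⊗ T) ≫ H ◁ dH (H ⊗ T) ≫ H ◁ br H H (H ⊗ T) ≫
          (H ◁ sH (H ⊗ H ⊗ T) ≫ br H H (H ⊗ H ⊗ T)) ≫ H ◁ H ◁ H ◁ dH T ≫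
          H ◁ H ◁ (sH (H ⊗ H ⊗ T) ≫ br H H (H ⊗ T)) ≫ H ◁ br H H (H ⊗ H ⊗ T) ≫
          mH (H ⊗ H ⊗ H ⊗ T) ≫ H ◁ mH (H ⊗ T) ≫ H ◁ mH T := by
        rw [← w_mul_assoc]; simp
    _ = (dH (H ⊗ T) ≫ H ◁ dH (H ⊗ T)) ≫ H ◁ br H H (H ⊗ T) ≫ br H H (H ⊗ H ⊗ T) ≫
          sH (H ⊗ H ⊗ H ⊗ T) ≫ H ◁ H ◁ H ◁ dH T ≫
          H ◁ H ◁ br H H (H ⊗ T) ≫ H ◁ br H H (H ⊗ H ⊗ T) ≫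
          mH (H ⊗ H ⊗ H ⊗ T) ≫ H ◁ H ◁ sH (H ⊗ T) ≫ H ◁ mH (H ⊗ T) ≫ H ◁ mH T := by
        rw [br_w11, w11_br]; simp
    _ = dH (H ⊗ T) ≫ br H H (H ⊗ T) ≫ sH (H ⊗ H ⊗ T) ≫ H ◁ H ◁ dH T ≫
          H ◁ (dH (H ⊗ H ⊗ T) ≫ H ◁ br H H (H ⊗ T) ≫ br H H (H ⊗ H ⊗ T)) ≫
          mH (H ⊗ H ⊗ H ⊗ T) ≫ H ◁ H ◁ sH (H ⊗ T) ≫ H ◁ mH (H ⊗ T) ≫ H ◁ mH T := by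
        rw [w_comul_assoc, Category.assoc, ← reassoc_of% @w12_br]; simp
    _ = dH (H ⊗ T) ≫ br H H (H ⊗ T) ≫ sH (H ⊗ H ⊗ T) ≫ H ◁ H ◁ dH T ≫ H ◁ br H H (H ⊗ T) ≫
          mH (H ⊗ H ⊗ T) ≫ H ◁ (dH (H ⊗ T) ≫ H ◁ sH (H ⊗ T) ≫ mH (H ⊗ T)) ≫ H ◁ mH T := by
        rw [← w12_br]; simp
    _ = dH (H ⊗ T) ≫ br H H (H ⊗ T) ≫ sH (H ⊗ H ⊗ T) ≫ H ◁ H ◁ dH T ≫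
          H ◁ (br H H (H ⊗ T) ≫ H ◁ eH (H ⊗ T)) ≫ mH (H ⊗ T) ≫ H ◁ (uH (H ⊗ T) ≫ mH T) := by
        rw [w_antipode_right]; simp
    _ = dH (H ⊗ T) ≫ br H H (H ⊗ T) ≫ sH (H ⊗ H ⊗ T) ≫ H ◁ eH (H ⊗ T) ≫ H ◁ dH T ≫
          mH (H ⊗ T) := by
        rw [w_one_mul, w10_br]; simp
    _ = dH (H ⊗ T) ≫ (br H H (H ⊗ T) ≫ H ◁ eH (H ⊗ T)) ≫ sH (H ⊗ T) ≫ H ◁ dH T ≫ mH (H ⊗ T) := by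
        simp
    _ = _ := by rw [w10_br, w_counit_comul_assoc]

/-- The middle strand of `D ⊗ H ⊗ H` may leave the evaluation of the outer two on either side. -/
theorem br_dual_eval [SelfSymmetric H] : br D H (H ⊗ T) ≫ H ◁ vH T = D ◁ br H H T ≫ vH (H ⊗ T) := by
  rw [← br_w20, br_br_dual_assoc]

/-- `S(v₂) v₃ ⊗ v₁ = 1 ⊗ v`. -/
theorem comul_antipode_cancel : dH T ≫ dH (H ⊗ T) ≫ br H H (H ⊗ T) ≫ sH (H ⊗ H ⊗ T) ≫
    H ◁ br H H T ≫ mH (H ⊗ T) = uH (H ⊗ T) := by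
  calc _ = (dH T ≫ dH (H ⊗ T)) ≫ br H H (H ⊗ T) ≫ H ◁ br H H T ≫ sH (H ⊗ H ⊗ T) ≫ mH (H ⊗ T) := by
        simp
    _ = dH T ≫ (H ◁ dH T ≫ br H H (H ⊗ T) ≫ H ◁ br H H T) ≫ sH (H ⊗ H ⊗ T) ≫ mH (H ⊗ T) := by
        rw [← w_comul_assoc]; simp
    _ = dH T ≫ br H H T ≫ (dH (H ⊗ T) ≫ sH (H ⊗ H ⊗ T) ≫ mH (H ⊗ T)) := by
        rw [← br_w12]; simp
    _ = dH T ≫ (br H H T ≫ eH (H ⊗ T)) ≫ uH (H ⊗ T) := by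
        rw [w_antipode_left]; simp
    _ = (dH T ≫ H ◁ eH T) ≫ uH (H ⊗ T) := by
        rw [br_w10]; simp
    _ = _ := by rw [w_comul_counit, Category.id_comp]

/-- `S(h₂) S²(h₁) = ε(h)`. -/
theorem comul_antipode_antipode : dH T ≫ ssH (H ⊗ T) ≫ H ◁ sH T ≫ br H H T ≫ mH T =
    eH T ≫ uH T := by
  calc _ = dH T ≫ sH (H ⊗ T) ≫ (sH (H ⊗ T) ≫ H ◁ sH T ≫ br H H T ≫ mH T) := by
        rw [← w11_comp]; simp
    _ = (dH T ≫ sH (H ⊗ T) ≫ mH T) ≫ sH T := by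
        rw [← w_mul_antipode]; simp
    _ = _ := by rw [w_antipode_left, Category.assoc, w_one_antipode]

/-- The projection `f ↦ f₀ · S²(f₁)` of the dual onto its coinvariants, which are integrals. -/
def integralProj (H D : C) [HopfObj H] [ExactPairing H D] : D ⟶ D :=
  coact H D ≫ (antipode ≫ antipode : H ⟶ H) ▷ D ≫ (β_ H D).hom ≫ ract H D
local notation "pD" => w11 (integralProj H D)

theorem w_integralProj : pD T = coa T ≫ ssH (D ⊗ T) ≫ br H D T ≫ ra T := by
  simp only [integralProj, w12, w11, w22, w21]; monoidal

theorem br_coact (V : C) : br V D T ≫ coa (V ⊗ T) =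
    V ◁ coa T ≫ br V H (D ⊗ T) ≫ H ◁ br V D T := br_w12 _

variable [SelfSymmetric H]

/-- The coaction of `f · S(h)` is `h₁ f₁ ⊗ f₀ · S(h₂)`, the compatibility of a Hopf module. -/
theorem coact_ract_antipode : D ◁ sH T ≫ ra T ≫ coa T =
    D ◁ dH T ≫ br D H (H ⊗ T) ≫ H ◁ coa (H ⊗ T) ≫ mH (D ⊗ H ⊗ T) ≫ H ◁ D ◁ sH T ≫ H ◁ ra T := by
  symm
  calc _ = D ◁ H ◁ bH T ≫ D ◁ dH (H ⊗ D ⊗ T) ≫ br D H (H ⊗ H ⊗ D ⊗ T) ≫ H ◁ coa (H ⊗ H ⊗ D ⊗ T) ≫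
          mH (D ⊗ H ⊗ H ⊗ D ⊗ T) ≫ H ◁ D ◁ sH (H ⊗ D ⊗ T) ≫ H ◁ D ◁ mH (D ⊗ T) ≫ H ◁ vH (D ⊗ T) := by
        rw [w_ract]; simp
    _ = D ◁ H ◁ bH T ≫ D ◁ dH (H ⊗ D ⊗ T) ≫ br D H (H ⊗ H ⊗ D ⊗ T) ≫ H ◁ D ◁ sH (H ⊗ D ⊗ T) ≫
          H ◁ D ◁ mH (D ⊗ T) ≫ H ◁ (coa (H ⊗ D ⊗ T) ≫ H ◁ vH (D ⊗ T)) ≫ mH (D ⊗ T) := by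
        simp
    _ = D ◁ H ◁ bH T ≫ D ◁ dH (H ⊗ D ⊗ T) ≫ D ◁ H ◁ sH (H ⊗ D ⊗ T) ≫
          D ◁ H ◁ mH (D ⊗ T) ≫ D ◁ H ◁ dH (D ⊗ T) ≫ (br D H (H ⊗ H ⊗ D ⊗ T) ≫ H ◁ vH (H ⊗ D ⊗ T)) ≫
          mH (D ⊗ T) := by
        rw [coact_eval]; simp
    _ = D ◁ H ◁ bH T ≫ D ◁ (dH (H ⊗ D ⊗ T) ≫ H ◁ sH (H ⊗ D ⊗ T) ≫
          H ◁ mH (D ⊗ T) ≫ H ◁ dH (D ⊗ T) ≫ br H H (H ⊗ D ⊗ T) ≫ H ◁ mH (D ⊗ T)) ≫ vH (H ⊗ D ⊗ T) := by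
        rw [br_dual_eval]; simp
    _ = D ◁ H ◁ bH T ≫ D ◁ sH (H ⊗ D ⊗ T) ≫ D ◁ H ◁ dH (D ⊗ T) ≫
          (ra (H ⊗ H ⊗ D ⊗ T) ≫ vH (H ⊗ D ⊗ T)) := by
        rw [← antipode_mul_comul, ract_eval]; simp
    _ = D ◁ sH T ≫ ra T ≫ D ◁ bH T ≫ D ◁ dH (D ⊗ T) ≫ vH (H ⊗ D ⊗ T) := by
        simp
    _ = _ := by rw [w_coact]

/-- `P(f)` is coinvariant, i.e. `⟨P(f), x₁⟩ x₂ = ⟨P(f), x⟩ 1`. -/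
theorem integralProj_coact : pD T ≫ coa T = pD T ≫ uH (D ⊗ T) := by
  calc _ = coa T ≫ sH (D ⊗ T) ≫ (sH (D ⊗ T) ≫ br H D T) ≫ ra T ≫ coa T := by
        rw [w_integralProj, ← w11_comp]; simp
    _ = coa T ≫ sH (D ⊗ T) ≫ br H D T ≫ (D ◁ sH T ≫ ra T ≫ coa T) := by
        rw [w11_br]; simp
    _ = coa T ≫ sH (D ⊗ T) ≫ (br H D T ≫ D ◁ dH T) ≫ br D H (H ⊗ T) ≫ H ◁ coa (H ⊗ T) ≫
          mH (D ⊗ H ⊗ T) ≫ H ◁ D ◁ sH T ≫ H ◁ ra T := by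
        rw [coact_ract_antipode]; simp
    _ = coa T ≫ (sH (D ⊗ T) ≫ dH (D ⊗ T)) ≫ H ◁ (br H D T ≫ coa (H ⊗ T)) ≫
          mH (D ⊗ H ⊗ T) ≫ H ◁ D ◁ sH T ≫ H ◁ ra T := by
        rw [w12_br]; simp
    _ = coa T ≫ dH (D ⊗ T) ≫ br H H (D ⊗ T) ≫ sH (H ⊗ D ⊗ T) ≫ H ◁ H ◁ coa T ≫
          H ◁ (sH (H ⊗ D ⊗ T) ≫ br H H (D ⊗ T)) ≫ mH (H ⊗ D ⊗ T) ≫ H ◁ br H D T ≫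
          H ◁ D ◁ sH T ≫ H ◁ ra T := by
        rw [w_antipode_comul, br_coact]; simp
    _ = (coa T ≫ H ◁ coa T) ≫ dH (H ⊗ D ⊗ T) ≫ br H H (H ⊗ D ⊗ T) ≫ sH (H ⊗ H ⊗ D ⊗ T) ≫
          H ◁ br H H (D ⊗ T) ≫ mH (H ⊗ D ⊗ T) ≫ H ◁ sH (D ⊗ T) ≫ H ◁ br H D T ≫
          H ◁ D ◁ sH T ≫ H ◁ ra T := by
        rw [w11_br]; simp
    _ = coa T ≫ (dH (D ⊗ T) ≫ dH (H ⊗ D ⊗ T) ≫ br H H (H ⊗ D ⊗ T) ≫ sH (H ⊗ H ⊗ D ⊗ T) ≫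
          H ◁ br H H (D ⊗ T) ≫ mH (H ⊗ D ⊗ T)) ≫ H ◁ sH (D ⊗ T) ≫ H ◁ br H D T ≫
          H ◁ D ◁ sH T ≫ H ◁ ra T := by
        rw [coact_coact]; simp
    _ = coa T ≫ uH (H ⊗ D ⊗ T) ≫ H ◁ sH (D ⊗ T) ≫ H ◁ (br H D T ≫ D ◁ sH T) ≫ H ◁ ra T := by
        rw [comul_antipode_cancel]; simp
    _ = _ := by rw [← w11_br, w_integralProj, ← w11_comp]; simp

theorem mul_antipode_antipode : mH T ≫ ssH T = ssH (H ⊗ T) ≫ H ◁ ssH T ≫ mH T := by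
  calc _ = (mH T ≫ sH T) ≫ sH T := by rw [← w11_comp, Category.assoc]
    _ = sH (H ⊗ T) ≫ H ◁ sH T ≫ br H H T ≫ (mH T ≫ sH T) := by
        nth_rw 1 [w_mul_antipode]; simp
    _ = sH (H ⊗ T) ≫ H ◁ sH T ≫ (br H H T ≫ sH (H ⊗ T)) ≫ H ◁ sH T ≫ br H H T ≫ mH T := by
        rw [w_mul_antipode]; simp
    _ = sH (H ⊗ T) ≫ H ◁ sH T ≫ H ◁ sH T ≫ (br H H T ≫ H ◁ sH T) ≫ br H H T ≫ mH T := by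
        rw [← br_w11]; simp
    _ = _ := by rw [← w11_br, ← w11_comp, ← w11_comp]; simp

/-- Right multiplication by an antipode is absorbed by the projection. -/
theorem ract_integralProj : D ◁ sH T ≫ ra T ≫ pD T = D ◁ eH T ≫ pD T := by
  calc _ = (D ◁ sH T ≫ ra T ≫ coa T) ≫ ssH (D ⊗ T) ≫ br H D T ≫ ra T := by
        rw [w_integralProj]; simp
    _ = D ◁ dH T ≫ br D H (H ⊗ T) ≫ H ◁ coa (H ⊗ T) ≫ H ◁ H ◁ D ◁ sH T ≫ H ◁ H ◁ ra T ≫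
          (mH (D ⊗ T) ≫ ssH (D ⊗ T)) ≫ br H D T ≫ ra T := by
        rw [coact_ract_antipode]; simp
    _ = D ◁ dH T ≫ (br D H (H ⊗ T) ≫ H ◁ coa (H ⊗ T)) ≫ H ◁ H ◁ D ◁ sH T ≫ H ◁ H ◁ ra T ≫
          ssH (H ⊗ D ⊗ T) ≫ H ◁ ssH (D ⊗ T) ≫ (mH (D ⊗ T) ≫ br H D T) ≫ ra T := by
        rw [mul_antipode_antipode]; simp
    _ = D ◁ dH T ≫ coa (H ⊗ H ⊗ T) ≫ H ◁ br D H (H ⊗ T) ≫ (br H H (D ⊗ H ⊗ T) ≫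
          ssH (H ⊗ D ⊗ H ⊗ T)) ≫ H ◁ ssH (D ⊗ H ⊗ T) ≫ H ◁ H ◁ D ◁ sH T ≫ H ◁ H ◁ ra T ≫
          H ◁ br H D T ≫ br H D (H ⊗ T) ≫ (D ◁ mH T ≫ ra T) := by
        rw [w12_br, w21_br]; simp
    _ = D ◁ dH T ≫ coa (H ⊗ H ⊗ T) ≫ H ◁ br D H (H ⊗ T) ≫ H ◁ ssH (D ⊗ H ⊗ T) ≫
          (br H H (D ⊗ H ⊗ T) ≫ H ◁ ssH (D ⊗ H ⊗ T)) ≫ H ◁ H ◁ D ◁ sH T ≫ H ◁ H ◁ ra T ≫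
          H ◁ br H D T ≫ br H D (H ⊗ T) ≫ ra (H ⊗ T) ≫ ra T := by
        rw [← br_w11, ract_ract]; simp
    _ = D ◁ dH T ≫ coa (H ⊗ H ⊗ T) ≫ H ◁ (br D H (H ⊗ T) ≫ ssH (D ⊗ H ⊗ T)) ≫
          ssH (H ⊗ D ⊗ H ⊗ T) ≫ H ◁ H ◁ D ◁ sH T ≫ H ◁ H ◁ ra T ≫
          (br H H (D ⊗ T) ≫ H ◁ br H D T ≫ br H D (H ⊗ T)) ≫ ra (H ⊗ T) ≫ ra T := by
        rw [← w11_br]; simp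
    _ = D ◁ dH T ≫ coa (H ⊗ H ⊗ T) ≫ H ◁ D ◁ ssH (H ⊗ T) ≫ ssH (D ⊗ H ⊗ H ⊗ T) ≫
          H ◁ D ◁ H ◁ sH T ≫ H ◁ (br D H (H ⊗ T) ≫ (H ◁ ra T ≫ br H D T)) ≫
          (br H D (H ⊗ T) ≫ D ◁ br H H T ≫ ra (H ⊗ T)) ≫ ra T := by
        rw [← br_w11, br_br_br]; simp
    _ = D ◁ dH T ≫ coa (H ⊗ H ⊗ T) ≫ H ◁ D ◁ ssH (H ⊗ T) ≫ ssH (D ⊗ H ⊗ H ⊗ T) ≫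
          H ◁ D ◁ H ◁ sH T ≫ H ◁ D ◁ br H H T ≫ H ◁ (ra (H ⊗ T) ≫ ra T) ≫ br H D T ≫ ra T := by
        rw [br_w21, br_br_dual_assoc, ← br_w21]; simp
    _ = coa (H ⊗ T) ≫ H ◁ D ◁ (dH T ≫ ssH (H ⊗ T) ≫ H ◁ sH T ≫ br H H T ≫ mH T) ≫
          ssH (D ⊗ H ⊗ T) ≫ H ◁ ra T ≫ br H D T ≫ ra T := by
        rw [ract_ract]; simp
    _ = coa (H ⊗ T) ≫ H ◁ D ◁ eH T ≫ H ◁ (D ◁ uH T ≫ ra T) ≫ ssH (D ⊗ T) ≫ br H D T ≫ ra T := by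
        rw [comul_antipode_antipode]; simp
    _ = _ := by rw [ract_one, w_integralProj]; simp

theorem integralProj_idem : pD T ≫ pD T = pD T := by
  calc _ = (pD T ≫ coa T) ≫ ssH (D ⊗ T) ≫ br H D T ≫ ra T := by
        nth_rw 2 [w_integralProj]; simp
    _ = pD T ≫ ((uH (D ⊗ T) ≫ sH (D ⊗ T)) ≫ sH (D ⊗ T)) ≫ br H D T ≫ ra T := by
        rw [integralProj_coact, ← w11_comp]; simp
    _ = pD T ≫ (uH (D ⊗ T) ≫ br H D T) ≫ ra T := by
        rw [w_one_antipode, w_one_antipode]; simp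
    _ = pD T ≫ (D ◁ uH T ≫ ra T) := by
        rw [w01_br]
    _ = _ := by rw [ract_one, Category.comp_id]

/-- Each `f` is `P(f₀) · S(f₁)`. -/
theorem coact_integralProj_ract :
    coa T ≫ H ◁ pD T ≫ br H D T ≫ D ◁ sH T ≫ ra T = 𝟙 _ := by
  calc _ = (coa T ≫ H ◁ coa T) ≫ H ◁ ssH (D ⊗ T) ≫ H ◁ br H D T ≫ (H ◁ ra T ≫ br H D T) ≫
          D ◁ sH T ≫ ra T := by
        rw [w_integralProj]; simp
    _ = coa T ≫ dH (D ⊗ T) ≫ H ◁ ssH (D ⊗ T) ≫ H ◁ br H D T ≫ br H D (H ⊗ T) ≫ D ◁ br H H T ≫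
          D ◁ H ◁ sH T ≫ (ra (H ⊗ T) ≫ ra T) := by
        rw [coact_coact, br_w21]; simp
    _ = coa T ≫ dH (D ⊗ T) ≫ H ◁ (ssH (D ⊗ T) ≫ br H D T) ≫ br H D (H ⊗ T) ≫ D ◁ br H H T ≫
          D ◁ H ◁ sH T ≫ D ◁ mH T ≫ ra T := by
        rw [ract_ract]; simp
    _ = coa T ≫ (dH (D ⊗ T) ≫ H ◁ br H D T ≫ br H D (H ⊗ T)) ≫ D ◁ H ◁ ssH T ≫
          D ◁ (br H H T ≫ H ◁ sH T) ≫ D ◁ mH T ≫ ra T := by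
        rw [w11_br]; simp
    _ = coa T ≫ br H D T ≫ D ◁ (dH T ≫ sH (H ⊗ T) ≫ H ◁ ssH T ≫ br H H T ≫ mH T) ≫ ra T := by
        rw [← w12_br, ← w11_br]; simp
    _ = coa T ≫ br H D T ≫ D ◁ (dH T ≫ H ◁ sH T ≫ (sH (H ⊗ T) ≫ H ◁ sH T ≫ br H H T ≫ mH T)) ≫
          ra T := by
        rw [← w11_comp]; simp
    _ = coa T ≫ br H D T ≫ D ◁ ((dH T ≫ H ◁ sH T ≫ mH T) ≫ sH T) ≫ ra T := by
        rw [← w_mul_antipode]; simp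
    _ = coa T ≫ (br H D T ≫ D ◁ eH T) ≫ (D ◁ uH T ≫ ra T) := by
        rw [w_antipode_right, Category.assoc, w_one_antipode]; simp
    _ = _ := by rw [ract_one, w10_br, Category.comp_id, coact_counit]

theorem ract_one_eval : ra T ≫ D ◁ uH T ≫ vH T = vH T := by
  calc _ = D ◁ H ◁ uH T ≫ (ra (H ⊗ T) ≫ vH T) := by simp
    _ = D ◁ (H ◁ uH T ≫ mH T) ≫ vH T := by rw [ract_eval]; simp
    _ = _ := by rw [w_mul_one]; simp

theorem coev_counit_coact : bH T ≫ eH (D ⊗ T) ≫ coa T = bH T := by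
  calc _ = bH T ≫ dH (D ⊗ T) ≫ (bH (H ⊗ H ⊗ D ⊗ T) ≫ H ◁ vH (H ⊗ D ⊗ T)) ≫ eH (H ⊗ D ⊗ T) := by
        rw [w_coact]; simp
    _ = _ := by rw [w_coev_eval]; simp

/-- `⟨P(eⁱ), S(eᵢ)⟩ = 1`. -/
theorem integralProj_trace :
    bH T ≫ H ◁ pD T ≫ br H D T ≫ D ◁ sH T ≫ vH T = 𝟙 _ := by
  calc _ = (bH T ≫ eH (D ⊗ T) ≫ coa T) ≫ H ◁ pD T ≫ br H D T ≫ D ◁ sH T ≫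
          (ra T ≫ D ◁ uH T ≫ vH T) := by
        rw [coev_counit_coact, ract_one_eval]
    _ = bH T ≫ eH (D ⊗ T) ≫ (coa T ≫ H ◁ pD T ≫ br H D T ≫ D ◁ sH T ≫
          ra T) ≫ D ◁ uH T ≫ vH T := by
        simp
    _ = uH T ≫ (bH (H ⊗ T) ≫ H ◁ vH T) ≫ eH T := by
        rw [coact_integralProj_ract]; simp
    _ = _ := by rw [w_coev_eval, Category.id_comp, w_one_counit]

/-- The left inverse `h ↦ f₁ ⟨P(f₀), S(eᵢ)⟩` of the antipode, where `f = P(eⁱ) · h`, the projection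
`P` is `integralProj`, and `eᵢ ⊗ eⁱ` is the coevaluation. -/
def antipodeLeftInv (H D : C) [HopfObj H] [ExactPairing H D] : H ⟶ H :=
  𝟙 _ ⊗≫ (η_ H D ≫ H ◁ integralProj H D) ▷ H ⊗≫ H ◁ ract H D ⊗≫ H ◁ coact H D ⊗≫
    (β_ H H).hom ▷ D ⊗≫ H ◁ H ◁ integralProj H D ⊗≫
      H ◁ ((β_ H D).hom ≫ D ◁ antipode ≫ ε_ H D) ⊗≫ 𝟙 _

theorem w_antipodeLeftInv : w11 (antipodeLeftInv H D) T =
    bH (H ⊗ T) ≫ H ◁ pD (H ⊗ T) ≫ H ◁ ra T ≫ H ◁ coa T ≫ br H H (D ⊗ T) ≫ H ◁ H ◁ pD T ≫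
      H ◁ br H D T ≫ H ◁ D ◁ sH T ≫ H ◁ vH T := by
  simp only [antipodeLeftInv, w11, w02, w20, w12, w22, w21]; monoidal

theorem w_antipode_leftInv : sH T ≫ w11 (antipodeLeftInv H D) T = 𝟙 _ := by
  calc _ = bH (H ⊗ T) ≫ H ◁ pD (H ⊗ T) ≫ H ◁ (D ◁ sH T ≫ ra T ≫ coa T) ≫ br H H (D ⊗ T) ≫
          H ◁ H ◁ pD T ≫ H ◁ br H D T ≫ H ◁ D ◁ sH T ≫ H ◁ vH T := by
        rw [w_antipodeLeftInv]; simp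
    _ = bH (H ⊗ T) ≫ H ◁ D ◁ dH T ≫ H ◁ (pD (H ⊗ H ⊗ T) ≫ br D H (H ⊗ T)) ≫ H ◁ H ◁ coa (H ⊗ T) ≫
          H ◁ mH (D ⊗ H ⊗ T) ≫ H ◁ H ◁ D ◁ sH T ≫ H ◁ H ◁ ra T ≫ br H H (D ⊗ T) ≫
          H ◁ H ◁ pD T ≫ H ◁ br H D T ≫ H ◁ D ◁ sH T ≫ H ◁ vH T := by
        rw [coact_ract_antipode]; simp
    _ = bH (H ⊗ T) ≫ H ◁ D ◁ dH T ≫ H ◁ br D H (H ⊗ T) ≫ H ◁ H ◁ (pD (H ⊗ T) ≫ coa (H ⊗ T)) ≫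
          H ◁ mH (D ⊗ H ⊗ T) ≫ H ◁ H ◁ D ◁ sH T ≫ H ◁ H ◁ ra T ≫ br H H (D ⊗ T) ≫
          H ◁ H ◁ pD T ≫ H ◁ br H D T ≫ H ◁ D ◁ sH T ≫ H ◁ vH T := by
        rw [w11_br]; simp
    _ = bH (H ⊗ T) ≫ H ◁ D ◁ dH T ≫ H ◁ br D H (H ⊗ T) ≫ H ◁ H ◁ pD (H ⊗ T) ≫
          H ◁ (H ◁ uH (D ⊗ H ⊗ T) ≫ mH (D ⊗ H ⊗ T)) ≫ br H H (D ⊗ H ⊗ T) ≫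
          H ◁ H ◁ (D ◁ sH T ≫ ra T ≫ pD T) ≫ H ◁ br H D T ≫ H ◁ D ◁ sH T ≫ H ◁ vH T := by
        rw [integralProj_coact]; simp [-w_mul_one, -w_mul_one_assoc]
    _ = bH (H ⊗ T) ≫ H ◁ D ◁ (dH T ≫ H ◁ eH T) ≫ H ◁ br D H T ≫ H ◁ H ◁ (pD T ≫ pD T) ≫
          br H H (D ⊗ T) ≫ H ◁ br H D T ≫ H ◁ D ◁ sH T ≫ H ◁ vH T := by
        rw [ract_integralProj, w_mul_one]; simp
    _ = (bH (H ⊗ T) ≫ H ◁ br D H T ≫ br H H (D ⊗ T)) ≫ H ◁ H ◁ pD T ≫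
          H ◁ br H D T ≫ H ◁ D ◁ sH T ≫ H ◁ vH T := by
        rw [integralProj_idem, w_comul_counit]; simp
    _ = H ◁ (bH T ≫ H ◁ pD T ≫ br H D T ≫ D ◁ sH T ≫ vH T) := by
        rw [w02_br]; simp
    _ = _ := by rw [integralProj_trace]; simp

theorem antipode_leftInv : (antipode : H ⟶ H) ≫ antipodeLeftInv H D = 𝟙 H :=
  eq_of_w11_eq fun T => by rw [← w11_comp, w_antipode_leftInv, w11_id]

end Integral

/-! ### Invertibility of the antipode -/

section InverseAntipode
variable {C : Type u} [Category.{v} C] [MonoidalCategory C] [BraidedCategory C]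
variable (H D : C) [HopfObj H] [ExactPairing H D] [SelfSymmetric H] {T : C}

local notation "sH" => w11 (antipode : H ⟶ H)
local notation "bH" => w02 (η_ H D)
local notation "vH" => w20 (ε_ H D)

theorem w_transpose_eval (f : H ⟶ H) :
    w11 (transpose f : D ⟶ D) (H ⊗ T) ≫ vH T = D ◁ w11 f T ≫ vH T := by
  calc _ = 𝟙 _ ⊗≫ ((transpose f : D ⟶ D) ▷ H ≫ ε_ H D) ▷ T ⊗≫ 𝟙 _ := by
        simp only [w11, w20]; monoidal
    _ = _ := by rw [transpose_eval]; simp only [w11, w20]; monoidal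

theorem coev_antipode : bH T ≫ sH (D ⊗ T) =
    bH T ≫ H ◁ w11 (transpose (antipode : H ⟶ H) : D ⟶ D) T := by
  symm
  calc _ = bH T ≫ H ◁ w11 (transpose (antipode : H ⟶ H) : D ⟶ D) T ≫
          H ◁ (D ◁ bH T ≫ vH (D ⊗ T)) := by
        rw [w_eval_coev]; simp
    _ = bH T ≫ H ◁ D ◁ bH T ≫
          H ◁ (w11 (transpose (antipode : H ⟶ H) : D ⟶ D) (H ⊗ D ⊗ T) ≫ vH (D ⊗ T)) := by
        simp [-w_eval_coev, -w_eval_coev_assoc]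
    _ = bH T ≫ sH (D ⊗ T) ≫ (bH (H ⊗ D ⊗ T) ≫ H ◁ vH (D ⊗ T)) := by
        rw [w_transpose_eval]; simp [-w_coev_eval, -w_coev_eval_assoc]
    _ = _ := by rw [w_coev_eval, Category.comp_id]

/-- The right inverse is the transpose of the left inverse for the dual Hopf algebra. -/
theorem exists_antipode_rightInv (H D : C) [HopfObj H] [ExactPairing H D] [SelfSymmetric H] :
    ∃ k : H ⟶ H, k ≫ antipode = 𝟙 H := by
  let : ExactPairing (Dual H D) H := exactPairing_swap H D
  obtain ⟨l, hl⟩ : ∃ l : D ⟶ D, (transpose (antipode : H ⟶ H) : D ⟶ D) ≫ l = 𝟙 D :=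
    ⟨antipodeLeftInv (Dual H D) H, antipode_leftInv (H := Dual H D) (D := H)⟩
  let k : H ⟶ H := 𝟙 _ ⊗≫ η_ H D ▷ H ⊗≫ H ◁ l ▷ H ⊗≫ H ◁ ε_ H D ⊗≫ 𝟙 _
  have hk (T : C) : w11 k T = w02 (η_ H D) (H ⊗ T) ≫ H ◁ w11 l (H ⊗ T) ≫ H ◁ w20 (ε_ H D) T := by
    simp only [k, w11, w02, w20]; monoidal
  refine ⟨k, eq_of_w11_eq fun T => ?_⟩
  calc _ = (w02 (η_ H D) (H ⊗ T) ≫ w11 (antipode : H ⟶ H) (D ⊗ H ⊗ T)) ≫ H ◁ w11 l (H ⊗ T) ≫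
          H ◁ w20 (ε_ H D) T := by
        rw [← w11_comp, hk]; simp
    _ = w02 (η_ H D) (H ⊗ T) ≫
          H ◁ (w11 (transpose (antipode : H ⟶ H) : D ⟶ D) (H ⊗ T) ≫ w11 l (H ⊗ T)) ≫
          H ◁ w20 (ε_ H D) T := by
        rw [coev_antipode]; simp
    _ = _ := by rw [w11_comp, hl, w11_id]; simp

/-- The antipode of a Hopf algebra with a left dual and a symmetric self-braiding is invertible. -/
theorem isIso_antipode (H D : C) [HopfObj H] [ExactPairing H D] [SelfSymmetric H] :
    IsIso (antipode : H ⟶ H) := by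
  obtain ⟨k, hk⟩ := exists_antipode_rightInv H D
  have hl := antipode_leftInv (H := H) (D := D)
  have : antipodeLeftInv H D = k := by
    rw [← Category.id_comp (antipodeLeftInv H D), ← hk, Category.assoc, hl, Category.comp_id]
  exact ⟨k, this ▸ hl, hk⟩

end InverseAntipode

section InverseAntipodeLaws
variable {C : Type u} [Category.{v} C] [MonoidalCategory C] [BraidedCategory C]
variable {H : C} [HopfObj H] [SelfSymmetric H] [IsIso (antipode : H ⟶ H)] {T : C}

local notation "mH" => w21 μ[H]
local notation "dH" => w12 Δ[H]
local notation "uH" => w01 η[H]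
local notation "eH" => w10 ε[H]
local notation "sH" => w11 (antipode : H ⟶ H)
local notation "siH" => w11 (inv (antipode : H ⟶ H))

theorem w_antipode_inv : sH T ≫ siH T = 𝟙 _ := by rw [w11_comp, IsIso.hom_inv_id, w11_id]
theorem w_inv_antipode : siH T ≫ sH T = 𝟙 _ := by rw [w11_comp, IsIso.inv_hom_id, w11_id]

theorem cancel_w_antipode {X : C} {f g : X ⟶ H ⊗ T} (h : f ≫ sH T = g ≫ sH T) : f = g := by
  rw [← Category.comp_id f, ← Category.comp_id g, ← w_antipode_inv, reassoc_of% h]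

/-- `k₂ S⁻¹(k₁) = ε(k)`. -/
theorem comul_inv_antipode_right :
    dH T ≫ br H H T ≫ H ◁ siH T ≫ mH T = eH T ≫ uH T := by
  apply cancel_w_antipode
  calc _ = dH T ≫ br H H T ≫ H ◁ siH T ≫ (mH T ≫ sH T) := by simp
    _ = dH T ≫ (br H H T ≫ sH (H ⊗ T)) ≫ H ◁ (siH T ≫ sH T) ≫ br H H T ≫ mH T := by
        rw [w_mul_antipode]; simp
    _ = dH T ≫ H ◁ sH T ≫ (br H H T ≫ br H H T) ≫ mH T := by
        rw [w_inv_antipode, ← br_w11]; simp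
    _ = _ := by
        rw [br_br_self, Category.id_comp, w_antipode_right, Category.assoc, w_one_antipode]

/-- `S⁻¹(k₂) k₁ = ε(k)`. -/
theorem comul_inv_antipode_left :
    dH T ≫ br H H T ≫ siH (H ⊗ T) ≫ mH T = eH T ≫ uH T := by
  apply cancel_w_antipode
  calc _ = dH T ≫ br H H T ≫ siH (H ⊗ T) ≫ (mH T ≫ sH T) := by simp
    _ = dH T ≫ br H H T ≫ (siH (H ⊗ T) ≫ sH (H ⊗ T)) ≫ H ◁ sH T ≫ br H H T ≫ mH T := by
        rw [w_mul_antipode]; simp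
    _ = dH T ≫ (br H H T ≫ H ◁ sH T) ≫ br H H T ≫ mH T := by
        rw [w_inv_antipode]; simp
    _ = dH T ≫ sH (H ⊗ T) ≫ (br H H T ≫ br H H T) ≫ mH T := by
        rw [← w11_br]; simp
    _ = _ := by
        rw [br_br_self, Category.id_comp, w_antipode_left, Category.assoc, w_one_antipode]

/-- Coassociativity of the co-opposite comultiplication: both sides are `k ↦ k₃ ⊗ k₂ ⊗ k₁`. -/
theorem comul_br_comul_br : dH T ≫ br H H T ≫ dH (H ⊗ T) ≫ br H H (H ⊗ T) =
    dH T ≫ br H H T ≫ H ◁ dH T ≫ H ◁ br H H T := by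
  calc _ = dH T ≫ (br H H T ≫ dH (H ⊗ T)) ≫ br H H (H ⊗ T) := by simp
    _ = (dH T ≫ H ◁ dH T) ≫ br H H (H ⊗ T) ≫ H ◁ br H H T ≫ br H H (H ⊗ T) := by
        rw [br_w12]; simp
    _ = dH T ≫ (dH (H ⊗ T) ≫ H ◁ br H H T ≫ br H H (H ⊗ T)) ≫ H ◁ br H H T := by
        rw [w_comul_assoc, br_br_br]; simp
    _ = _ := by rw [← w12_br]; simp

end InverseAntipodeLaws

/-! ### The dual Hopf algebra acting on `H` -/

section HatAction
variable {C : Type u} [Category.{v} C] [MonoidalCategory C] [BraidedCategory C]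
variable (H D : C) [HopfObj H] [ExactPairing H D] [SelfSymmetric H]

local notation "E" => HatDual H D
local notation "mH" => w21 μ[H]
local notation "dH" => w12 Δ[H]
local notation "eH" => w10 ε[H]
local notation "bE" => w02 (η_ H (HatDual H D))
local notation "vE" => w20 (ε_ H (HatDual H D))
local notation "mE" => w21 μ[HatDual H D]
local notation "uE" => w01 η[HatDual H D]

/-- The morphism `E ⟶ H ⊗ E`, `f ↦ f₁ ⊗ f₀`, adjoint to the action of `E` on `H`:
`f₁ ⊗ f₀ = (f ⇀ eᵢ) ⊗ eⁱ`, where `eᵢ ⊗ eⁱ` is the coevaluation. -/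
def hatCoact : E ⟶ H ⊗ E :=
  𝟙 _ ⊗≫ E ◁ η_ H E ⊗≫ hatAct H D ▷ E

variable {H D} {T : C}

local notation "kap" => w21 (hatAct H D)
local notation "kapc" => w12 (hatCoact H D)

theorem w_hatAct : kap T = E ◁ dH T ≫ br E H (H ⊗ T) ≫ H ◁ vE T := by
  simp only [hatAct, w21, w12, w22, w20]; monoidal
theorem w_hatCoact : kapc T = E ◁ bE T ≫ kap (E ⊗ T) := by
  simp only [hatCoact, w21, w12, w02]; monoidal

theorem hatAct_comul : kap T ≫ dH T = E ◁ dH T ≫ br E H (H ⊗ T) ≫ H ◁ kap T := by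
  calc _ = E ◁ dH T ≫ (br E H (H ⊗ T) ≫ dH (E ⊗ H ⊗ T)) ≫ H ◁ H ◁ vE T := by
        rw [w_hatAct]; simp
    _ = E ◁ (dH T ≫ dH (H ⊗ T)) ≫ br E H (H ⊗ H ⊗ T) ≫ H ◁ br E H (H ⊗ T) ≫ H ◁ H ◁ vE T := by
        rw [br_w12]; simp
    _ = _ := by rw [← w_comul_assoc, w_hatAct]; simp

/-- `f₁ ⟨f₀, x⟩ = f ⇀ x`. -/
theorem hatCoact_eval : kapc (H ⊗ T) ≫ H ◁ vE T = kap T := by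
  calc _ = E ◁ (bE (H ⊗ T) ≫ H ◁ vE T) ≫ kap T := by
        rw [w_hatCoact]; simp [-w_coev_eval, -w_coev_eval_assoc]
    _ = _ := by rw [w_coev_eval]; simp

theorem hatAct_counit : kap T ≫ eH T = vE T := by
  calc _ = E ◁ dH T ≫ (br E H (H ⊗ T) ≫ eH (E ⊗ H ⊗ T)) ≫ vE T := by
        rw [w_hatAct]; simp
    _ = E ◁ (dH T ≫ eH (H ⊗ T)) ≫ vE T := by
        rw [br_w10]; simp
    _ = _ := by rw [w_counit_comul]; simp

theorem hatCoact_counit : kapc T ≫ eH (E ⊗ T) = 𝟙 _ := by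
  rw [w_hatCoact, Category.assoc, hatAct_counit, w_eval_coev]

theorem coev_hatCoact : bE T ≫ H ◁ kapc T = bE T ≫ dH (E ⊗ T) ≫ br H H (E ⊗ T) := by
  calc _ = bE T ≫ H ◁ E ◁ bE T ≫ H ◁ E ◁ dH (E ⊗ T) ≫
          H ◁ (br E H (H ⊗ E ⊗ T) ≫ H ◁ vE (E ⊗ T)) := by
        rw [w_hatCoact, w_hatAct]; simp
    _ = bE T ≫ dH (E ⊗ T) ≫ br H H (E ⊗ T) ≫ (bE (H ⊗ H ⊗ E ⊗ T) ≫ H ◁ vE (H ⊗ E ⊗ T)) := by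
        rw [br_dual_eval]; simp [-w_coev_eval, -w_coev_eval_assoc]
    _ = _ := by rw [w_coev_eval]; simp

/-- The action on `H` commutes with the co-opposite comultiplication through the first factor:
`(f ⇀ x)₂ ⊗ (f ⇀ x)₁ = (f ⇀ x₂) ⊗ x₁`. -/
theorem hatAct_comul_br : kap T ≫ dH T ≫ br H H T = E ◁ dH T ≫ E ◁ br H H T ≫ kap (H ⊗ T) := by
  calc _ = (kap T ≫ dH T) ≫ br H H T := by simp
    _ = E ◁ dH T ≫ br E H (H ⊗ T) ≫ H ◁ E ◁ dH T ≫ H ◁ br E H (H ⊗ T) ≫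
          (H ◁ H ◁ vE T ≫ br H H T) := by
        rw [hatAct_comul]; simp [w_hatAct]
    _ = E ◁ dH T ≫ br E H (H ⊗ T) ≫ H ◁ E ◁ dH T ≫ H ◁ br E H (H ⊗ T) ≫
          br H H (E ⊗ H ⊗ T) ≫ H ◁ (br H E (H ⊗ T) ≫ br E H (H ⊗ T) ≫ H ◁ vE T) := by
        rw [br_br_dual'_assoc]; simp
    _ = E ◁ dH T ≫ E ◁ H ◁ dH T ≫ br E H (H ⊗ H ⊗ T) ≫ H ◁ br E H (H ⊗ T) ≫
          br H H (E ⊗ H ⊗ T) ≫ H ◁ br H E (H ⊗ T) ≫ H ◁ E ◁ br H H T ≫ H ◁ vE (H ⊗ T) := by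
        rw [br_dual_eval]; simp
    _ = E ◁ dH T ≫ E ◁ H ◁ dH T ≫ (br E H (H ⊗ H ⊗ T) ≫ H ◁ br E H (H ⊗ T) ≫
          br H H (E ⊗ H ⊗ T)) ≫ H ◁ br H E (H ⊗ T) ≫ H ◁ E ◁ br H H T ≫ H ◁ vE (H ⊗ T) := by
        simp
    _ = E ◁ dH T ≫ E ◁ H ◁ dH T ≫ E ◁ br H H (H ⊗ T) ≫ br E H (H ⊗ H ⊗ T) ≫
          H ◁ (br E H (H ⊗ T) ≫ br H E (H ⊗ T)) ≫ H ◁ E ◁ br H H T ≫ H ◁ vE (H ⊗ T) := by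
        rw [br_br_br]; simp [-br_br_dual, -br_br_dual_assoc, -br_br_dual', -br_br_dual'_assoc]
    _ = E ◁ dH T ≫ E ◁ (br H H T ≫ dH (H ⊗ T)) ≫ br E H (H ⊗ H ⊗ T) ≫ H ◁ vE (H ⊗ T) := by
        rw [br_w12, br_br_dual]; simp
    _ = _ := by rw [w_hatAct]; simp

/-- `f₁ ⊗ f₀₁ ⊗ f₀₀ = f₁₂ ⊗ f₁₁ ⊗ f₀`: `hatCoact` is a coaction of the co-opposite coalgebra. -/
theorem hatCoact_hatCoact : kapc T ≫ H ◁ kapc T = kapc T ≫ dH (E ⊗ T) ≫ br H H (E ⊗ T) := by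
  calc _ = E ◁ (bE T ≫ H ◁ kapc T) ≫ kap (H ⊗ E ⊗ T) := by
        nth_rw 1 [w_hatCoact]; simp
    _ = E ◁ bE T ≫ (kap (E ⊗ T) ≫ dH (E ⊗ T) ≫ br H H (E ⊗ T)) := by
        rw [coev_hatCoact, hatAct_comul_br]; simp
    _ = _ := by rw [w_hatCoact]; simp

theorem one_hatAct : uE (H ⊗ T) ≫ kap T = 𝟙 _ := by
  have h : η[E] ▷ H ≫ hatAct H D = (λ_ H).hom := coactionAct_one H D Δ[H] (ComonObj.comul_counit H)
  calc _ = 𝟙 _ ⊗≫ (η[E] ▷ H ≫ hatAct H D) ▷ T := by simp only [w01, w21]; monoidal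
    _ = _ := by rw [h]; monoidal

theorem mul_hatAct : mE (H ⊗ T) ≫ kap T = E ◁ kap T ≫ kap T := by
  have h : μ[E] ▷ H ≫ hatAct H D = (α_ E E H).hom ≫ E ◁ hatAct H D ≫ hatAct H D :=
    coactionAct_mul H D Δ[H] (ComonObj.comul_assoc H).symm
  calc _ = 𝟙 _ ⊗≫ (μ[E] ▷ H ≫ hatAct H D) ▷ T := by simp only [w21]; monoidal
    _ = _ := by rw [h]; simp only [w21]; monoidal

theorem hatAct_mul : E ◁ mH T ≫ kap T =
    w12 Δ[E] (H ⊗ H ⊗ T) ≫ E ◁ br E H (H ⊗ T) ≫ kap (E ⊗ H ⊗ T) ≫ H ◁ kap T ≫ mH T := by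
  have h : E ◁ μ[H] ≫ hatAct H D = Δ[E] ▷ (H ⊗ H) ≫ tensorμ E E H H ≫
      (hatAct H D ⊗ₘ hatAct H D) ≫ μ[H] := act_coactionMul H D Δ[H] (BimonObj.mul_comul H)
  calc _ = 𝟙 _ ⊗≫ (E ◁ μ[H] ≫ hatAct H D) ▷ T := by simp only [w21]; monoidal
    _ = _ := by
      rw [h, tensorμ, MonoidalCategory.tensorHom_def]; simp only [w21, w12, br, w22]; monoidal

theorem mul_hatCoact : mE T ≫ kapc T = E ◁ kapc T ≫ kap (E ⊗ T) := by
  calc _ = E ◁ E ◁ bE T ≫ (mE (H ⊗ E ⊗ T) ≫ kap (E ⊗ T)) := by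
        rw [w_hatCoact]; simp
    _ = _ := by rw [mul_hatAct, w_hatCoact]; simp

theorem one_hatCoact : uE T ≫ kapc T = bE T := by
  calc _ = bE T ≫ (uE (H ⊗ E ⊗ T) ≫ kap (E ⊗ T)) := by rw [w_hatCoact]; simp
    _ = _ := by rw [one_hatAct, Category.comp_id]

end HatAction

section Galois
variable {C : Type u} [Category.{v} C] [MonoidalCategory C] [BraidedCategory C]
variable (H D : C) [HopfObj H] [ExactPairing H D] [SelfSymmetric H] {T : C}

local notation "E" => HatDual H D
local notation "mH" => w21 μ[H]
local notation "dH" => w12 Δ[H]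
local notation "uH" => w01 η[H]
local notation "eH" => w10 ε[H]
local notation "siH" => w11 (inv (antipode : H ⟶ H))
local notation "kapc" => w12 (hatCoact H D)

theorem hatCoact_antipode_left [IsIso (antipode : H ⟶ H)] :
    H ◁ kapc T ≫ mH (E ⊗ T) ≫ H ◁ kapc T ≫ H ◁ siH (E ⊗ T) ≫ mH (E ⊗ T) = 𝟙 _ := by
  calc _ = H ◁ (kapc T ≫ H ◁ kapc T) ≫ H ◁ H ◁ siH (E ⊗ T) ≫
          (mH (H ⊗ E ⊗ T) ≫ mH (E ⊗ T)) := by simp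
    _ = H ◁ kapc T ≫ H ◁ (dH (E ⊗ T) ≫ br H H (E ⊗ T) ≫ H ◁ siH (E ⊗ T) ≫ mH (E ⊗ T)) ≫
          mH (E ⊗ T) := by
        rw [hatCoact_hatCoact, w_mul_assoc]; simp
    _ = H ◁ (kapc T ≫ eH (E ⊗ T)) ≫ (H ◁ uH (E ⊗ T) ≫ mH (E ⊗ T)) := by
        rw [comul_inv_antipode_right]; simp [-w_mul_one, -w_mul_one_assoc]
    _ = _ := by rw [hatCoact_counit, w_mul_one]; simp

theorem hatCoact_antipode_right [IsIso (antipode : H ⟶ H)] :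
    H ◁ kapc T ≫ H ◁ siH (E ⊗ T) ≫ mH (E ⊗ T) ≫ H ◁ kapc T ≫ mH (E ⊗ T) = 𝟙 _ := by
  calc _ = H ◁ (kapc T ≫ H ◁ kapc T) ≫ H ◁ siH (H ⊗ E ⊗ T) ≫
          (mH (H ⊗ E ⊗ T) ≫ mH (E ⊗ T)) := by simp
    _ = H ◁ kapc T ≫ H ◁ (dH (E ⊗ T) ≫ br H H (E ⊗ T) ≫ siH (H ⊗ E ⊗ T) ≫ mH (E ⊗ T)) ≫
          mH (E ⊗ T) := by
        rw [hatCoact_hatCoact, w_mul_assoc]; simp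
    _ = H ◁ (kapc T ≫ eH (E ⊗ T)) ≫ (H ◁ uH (E ⊗ T) ≫ mH (E ⊗ T)) := by
        rw [comul_inv_antipode_left]; simp [-w_mul_one, -w_mul_one_assoc]
    _ = _ := by rw [hatCoact_counit, w_mul_one]; simp

end Galois

/-! ### The inverse of the twist -/

section Twist
open ModuleAlgebra
variable {C : Type u} [Category.{v} C] [MonoidalCategory C] [BraidedCategory C]
variable (H R : C) [HopfObj H] [MonObj R] [ModuleAlgebra H R]

local notation "mH" => w21 μ[H]
local notation "dH" => w12 Δ[H]
local notation "uH" => w01 η[H]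
local notation "eH" => w10 ε[H]
local notation "siH" => w11 (inv (antipode : H ⟶ H))
local notation "mR" => w21 μ[R]
local notation "uR" => w01 η[R]
local notation "aR" => w21 (act H R)
local notation "tw" => w22 (twist H R)

/-- The inverse `r ⊗ h ↦ h₂ ⊗ S⁻¹(h₁) · r` of `twist H R`, for an invertible antipode `S`. -/
noncomputable def twistInv [IsIso (antipode : H ⟶ H)] : R ⊗ H ⟶ H ⊗ R :=
  (β_ H R).inv ≫ (Δ[H] ≫ (β_ H H).hom ≫ H ◁ inv antipode) ▷ R ≫ (α_ H H R).hom ≫ H ◁ act H R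

local notation "ti" => w22 (twistInv H R)

variable {H R} {T : C}

theorem w_mul_act : mH (R ⊗ T) ≫ aR T = H ◁ aR T ≫ aR T := by
  calc _ = 𝟙 _ ⊗≫ (μ[H] ▷ R ≫ act H R) ▷ T := by simp only [w21]; monoidal
    _ = _ := by rw [mul_act]; simp only [w21]; monoidal

theorem w_one_act : uH (R ⊗ T) ≫ aR T = 𝟙 _ := by
  calc _ = 𝟙 _ ⊗≫ (η[H] ▷ R ≫ act H R) ▷ T := by simp only [w01, w21]; monoidal
    _ = _ := by rw [one_act]; monoidal

theorem w_mul_twist : mH (R ⊗ T) ≫ tw T = H ◁ tw T ≫ tw (H ⊗ T) ≫ R ◁ mH T := by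
  calc _ = 𝟙 _ ⊗≫ (μ[H] ▷ R ≫ twist H R) ▷ T ⊗≫ 𝟙 _ := by simp only [w21, w22]; monoidal
    _ = _ := by rw [mul_twist]; simp only [w21, w22]; monoidal

theorem w_twist_mul : H ◁ mR T ≫ tw T = tw (R ⊗ T) ≫ R ◁ tw T ≫ mR (H ⊗ T) := by
  calc _ = 𝟙 _ ⊗≫ (H ◁ μ[R] ≫ twist H R) ▷ T ⊗≫ 𝟙 _ := by simp only [w21, w22]; monoidal
    _ = _ := by rw [twist_mul]; simp only [w21, w22]; monoidal

theorem w_twist_one : H ◁ uR T ≫ tw T = uR (H ⊗ T) := by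
  calc _ = 𝟙 _ ⊗≫ (H ◁ η[R] ≫ twist H R) ▷ T ⊗≫ 𝟙 _ := by simp only [w01, w22]; monoidal
    _ = _ := by rw [twist_one]; simp only [w01]; monoidal

variable [SelfSymmetric H]

theorem w_twist : tw T = dH (R ⊗ T) ≫ br H H (R ⊗ T) ≫ H ◁ aR T ≫ br H R T := by
  calc _ = dH (R ⊗ T) ≫ (br H H (R ⊗ T) ≫ br H H (R ⊗ T)) ≫ H ◁ br H R T ≫ aR (H ⊗ T) := by
        rw [br_br_self]; simp only [twist, br, w12, w21, w22]; monoidal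
    _ = _ := by rw [br_w21]; simp only [Category.assoc]

/-- The twist is linear for the action of the dual, which sees only `h₂` in `h₁ · r ⊗ h₂`. -/
theorem hatAct_twist {D : C} [ExactPairing H D] :
    HatDual H D ◁ tw T ≫ br (HatDual H D) R (H ⊗ T) ≫ R ◁ w21 (hatAct H D) T =
      w21 (hatAct H D) (R ⊗ T) ≫ tw T := by
  calc _ = HatDual H D ◁ dH (R ⊗ T) ≫ HatDual H D ◁ br H H (R ⊗ T) ≫ HatDual H D ◁ H ◁ aR T ≫
          (HatDual H D ◁ br H R T ≫ br (HatDual H D) R (H ⊗ T) ≫ R ◁ w21 (hatAct H D) T) := by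
        rw [w_twist]; simp
    _ = (HatDual H D ◁ dH (R ⊗ T) ≫ HatDual H D ◁ br H H (R ⊗ T) ≫
          w21 (hatAct H D) (H ⊗ R ⊗ T)) ≫ H ◁ aR T ≫ br H R T := by
        rw [← w21_br]; simp
    _ = _ := by rw [← hatAct_comul_br, w_twist]; simp

variable [IsIso (antipode : H ⟶ H)]

theorem w_twistInv : ti T =
    ib H R T ≫ dH (R ⊗ T) ≫ br H H (R ⊗ T) ≫ H ◁ siH (R ⊗ T) ≫ H ◁ aR T := by
  simp only [twistInv, ib, br, w11, w12, w21, w22]; monoidal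

theorem w_twist_twistInv : tw T ≫ ti T = 𝟙 _ := by
  calc _ = (dH (R ⊗ T) ≫ br H H (R ⊗ T) ≫ dH (H ⊗ R ⊗ T) ≫ br H H (H ⊗ R ⊗ T)) ≫
          H ◁ siH (H ⊗ R ⊗ T) ≫ H ◁ (H ◁ aR T ≫ aR T) := by
        rw [w_twist, w_twistInv]; simp
    _ = dH (R ⊗ T) ≫ br H H (R ⊗ T) ≫
          H ◁ (dH (R ⊗ T) ≫ br H H (R ⊗ T) ≫ siH (H ⊗ R ⊗ T) ≫ mH (R ⊗ T)) ≫ H ◁ aR T := by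
        rw [comul_br_comul_br, ← w_mul_act]; simp
    _ = dH (R ⊗ T) ≫ (br H H (R ⊗ T) ≫ H ◁ eH (R ⊗ T)) ≫ H ◁ (uH (R ⊗ T) ≫ aR T) := by
        rw [comul_inv_antipode_left]; simp
    _ = _ := by rw [w10_br, w_one_act]; simp

theorem w_twistInv_twist : ti T ≫ tw T = 𝟙 _ := by
  calc _ = ib H R T ≫ (dH (R ⊗ T) ≫ br H H (R ⊗ T) ≫ dH (H ⊗ R ⊗ T) ≫ br H H (H ⊗ R ⊗ T)) ≫
          H ◁ H ◁ siH (R ⊗ T) ≫ H ◁ (H ◁ aR T ≫ aR T) ≫ br H R T := by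
        rw [w_twist, w_twistInv]; simp
    _ = ib H R T ≫ dH (R ⊗ T) ≫ br H H (R ⊗ T) ≫
          H ◁ (dH (R ⊗ T) ≫ br H H (R ⊗ T) ≫ H ◁ siH (R ⊗ T) ≫ mH (R ⊗ T)) ≫ H ◁ aR T ≫
          br H R T := by
        rw [comul_br_comul_br, ← w_mul_act]; simp
    _ = ib H R T ≫ dH (R ⊗ T) ≫ (br H H (R ⊗ T) ≫ H ◁ eH (R ⊗ T)) ≫ H ◁ (uH (R ⊗ T) ≫ aR T) ≫
          br H R T := by
        rw [comul_inv_antipode_right]; simp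
    _ = ib H R T ≫ (dH (R ⊗ T) ≫ eH (H ⊗ R ⊗ T)) ≫ br H R T := by
        rw [w10_br, w_one_act, MonoidalCategory.whiskerLeft_id, Category.id_comp, Category.assoc]
    _ = _ := by rw [w_counit_comul, Category.id_comp, ib_br]

/-- `twist_mul` solved for `twistInv`. -/
theorem twistInv_mul : R ◁ tw T ≫ mR (H ⊗ T) ≫ ti T = ti (R ⊗ T) ≫ H ◁ mR T := by
  symm
  calc _ = ti (R ⊗ T) ≫ H ◁ mR T ≫ (tw T ≫ ti T) := by
        rw [w_twist_twistInv, Category.comp_id]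
    _ = ti (R ⊗ T) ≫ (H ◁ mR T ≫ tw T) ≫ ti T := by simp only [Category.assoc]
    _ = (ti (R ⊗ T) ≫ tw (R ⊗ T)) ≫ R ◁ tw T ≫ mR (H ⊗ T) ≫ ti T := by
        rw [w_twist_mul]; simp only [Category.assoc]
    _ = _ := by rw [w_twistInv_twist, Category.id_comp]

theorem twistInv_one : uR (H ⊗ T) ≫ ti T = H ◁ uR T := by
  rw [← w_twist_one, Category.assoc, w_twist_twistInv, Category.comp_id]

end Twist

/-! ### The isomorphism on words -/

section Duality
open ModuleAlgebra
variable {C : Type u} [Category.{v} C] [MonoidalCategory C] [BraidedCategory C]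
variable (H D R : C) [HopfObj H] [ExactPairing H D] [SelfSymmetric H] [MonObj R]
  [ModuleAlgebra H R]

local notation "E" => HatDual H D
local notation "mH" => w21 μ[H]
local notation "uH" => w01 η[H]
local notation "siH" => w11 (inv (antipode : H ⟶ H))
local notation "mR" => w21 μ[R]
local notation "uR" => w01 η[R]
local notation "tw" => w22 (twist H R)
local notation "ti" => w22 (twistInv H R)
local notation "bE" => w02 (η_ H (HatDual H D))
local notation "vE" => w20 (ε_ H (HatDual H D))
local notation "mE" => w21 μ[HatDual H D]
local notation "uE" => w01 η[HatDual H D]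
local notation "dE" => w12 Δ[HatDual H D]
local notation "kap" => w21 (hatAct H D)
local notation "kapc" => w12 (hatCoact H D)

/-- The automorphism `h ⊗ f ↦ h f₁ ⊗ f₀` of `H ⊗ E`, where `f ↦ f₁ ⊗ f₀` is `hatCoact H D`. -/
def galois : H ⊗ E ⟶ H ⊗ E := H ◁ hatCoact H D ≫ (α_ H H E).inv ≫ μ[H] ▷ E

/-- The inverse `h ⊗ f ↦ h S⁻¹(f₁) ⊗ f₀` of `galois H D`. -/
noncomputable def galoisInv [IsIso (antipode : H ⟶ H)] : H ⊗ E ⟶ H ⊗ E :=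
  H ◁ hatCoact H D ≫ (α_ H H E).inv ≫ (H ◁ inv antipode ≫ μ[H]) ▷ E

local notation "gal" => w22 (galois H D)
local notation "gali" => w22 (galoisInv H D)

/-- The multiplication of `(R # H) # E`, on right-nested words. -/
def smashSmashMulWord (T : C) : R ⊗ H ⊗ E ⊗ R ⊗ H ⊗ E ⊗ T ⟶ R ⊗ H ⊗ E ⊗ T :=
  R ◁ H ◁ dE (R ⊗ H ⊗ E ⊗ T) ≫ R ◁ H ◁ E ◁ br E R (H ⊗ E ⊗ T) ≫
    R ◁ H ◁ E ◁ R ◁ br E H (E ⊗ T) ≫ R ◁ H ◁ br E R (H ⊗ E ⊗ E ⊗ T) ≫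
    R ◁ H ◁ R ◁ kap (E ⊗ E ⊗ T) ≫ R ◁ tw (H ⊗ E ⊗ E ⊗ T) ≫ mR (H ⊗ H ⊗ E ⊗ E ⊗ T) ≫
    R ◁ mH (E ⊗ E ⊗ T) ≫ R ◁ H ◁ mE T

/-- The multiplication of `R ⊗ (H ⊗ E)`, on right-nested words. -/
def tensorMatrixMulWord (T : C) : R ⊗ H ⊗ E ⊗ R ⊗ H ⊗ E ⊗ T ⟶ R ⊗ H ⊗ E ⊗ T :=
  R ◁ H ◁ br E R (H ⊗ E ⊗ T) ≫ R ◁ br H R (E ⊗ H ⊗ E ⊗ T) ≫ R ◁ R ◁ H ◁ vE (E ⊗ T) ≫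
    mR (H ⊗ E ⊗ T)

variable {T : C}

theorem w_galois : gal T = H ◁ kapc T ≫ mH (E ⊗ T) := by
  simp only [galois, w22, w21, w12]; monoidal

/-- The product `f₁ · (r ⊗ h) ⊗ f₂ g` inside `(R # H) # E`, followed by `galois` in its last two
factors: as `H` is a module algebra over `E`, the comultiplication of `f` is absorbed, and
what remains is the action of `f` on `r ⊗ galois(h ⊗ g)`. -/
theorem smash_galois :
    dE (R ⊗ H ⊗ E ⊗ T) ≫ E ◁ br E R (H ⊗ E ⊗ T) ≫ E ◁ R ◁ br E H (E ⊗ T) ≫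
      br E R (H ⊗ E ⊗ E ⊗ T) ≫ R ◁ kap (E ⊗ E ⊗ T) ≫
      R ◁ H ◁ (E ◁ kapc T ≫ kap (E ⊗ T)) ≫ R ◁ mH (E ⊗ T) =
    E ◁ R ◁ gal T ≫ br E R (H ⊗ E ⊗ T) ≫ R ◁ kap (E ⊗ T) := by
  calc _ = E ◁ R ◁ H ◁ kapc T ≫
          (dE (R ⊗ H ⊗ H ⊗ E ⊗ T) ≫ E ◁ br E R (H ⊗ H ⊗ E ⊗ T) ≫ br E R (E ⊗ H ⊗ H ⊗ E ⊗ T)) ≫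
          R ◁ (E ◁ br E H (H ⊗ E ⊗ T) ≫ kap (E ⊗ H ⊗ E ⊗ T) ≫ H ◁ kap (E ⊗ T) ≫ mH (E ⊗ T)) := by
        simp
    _ = E ◁ R ◁ H ◁ kapc T ≫ br E R (H ⊗ H ⊗ E ⊗ T) ≫
          R ◁ (dE (H ⊗ H ⊗ E ⊗ T) ≫ E ◁ br E H (H ⊗ E ⊗ T) ≫ kap (E ⊗ H ⊗ E ⊗ T) ≫
            H ◁ kap (E ⊗ T) ≫ mH (E ⊗ T)) := by
        rw [← w12_br]; simp
    _ = _ := by rw [← hatAct_mul, w_galois]; simp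

/-- After `galois`, the second factor `r' # h' # f'` of the product enters only through
`galois(h' ⊗ f')`, and neither the comultiplication nor the multiplication of `E` is left. -/
theorem smashSmashMulWord_galois : smashSmashMulWord H D R T ≫ R ◁ gal T =
    R ◁ H ◁ E ◁ R ◁ gal T ≫ R ◁ H ◁ br E R (H ⊗ E ⊗ T) ≫ R ◁ H ◁ R ◁ kap (E ⊗ T) ≫
      R ◁ tw (H ⊗ E ⊗ T) ≫ mR (H ⊗ H ⊗ E ⊗ T) ≫ R ◁ mH (E ⊗ T) := by
  calc _ = R ◁ H ◁ dE (R ⊗ H ⊗ E ⊗ T) ≫ R ◁ H ◁ E ◁ br E R (H ⊗ E ⊗ T) ≫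
        R ◁ H ◁ E ◁ R ◁ br E H (E ⊗ T) ≫ R ◁ H ◁ br E R (H ⊗ E ⊗ E ⊗ T) ≫
        R ◁ H ◁ R ◁ kap (E ⊗ E ⊗ T) ≫ R ◁ tw (H ⊗ E ⊗ E ⊗ T) ≫ mR (H ⊗ H ⊗ E ⊗ E ⊗ T) ≫
        R ◁ H ◁ H ◁ (mE T ≫ kapc T) ≫ R ◁ (mH (H ⊗ E ⊗ T) ≫ mH (E ⊗ T)) := by
        rw [smashSmashMulWord, w_galois]; simp
    _ = R ◁ H ◁ (dE (R ⊗ H ⊗ E ⊗ T) ≫ E ◁ br E R (H ⊗ E ⊗ T) ≫ E ◁ R ◁ br E H (E ⊗ T) ≫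
          br E R (H ⊗ E ⊗ E ⊗ T) ≫ R ◁ kap (E ⊗ E ⊗ T) ≫
          R ◁ H ◁ (E ◁ kapc T ≫ kap (E ⊗ T)) ≫ R ◁ mH (E ⊗ T)) ≫
        R ◁ tw (H ⊗ E ⊗ T) ≫ mR (H ⊗ H ⊗ E ⊗ T) ≫ R ◁ mH (E ⊗ T) := by
        rw [w_mul_assoc, mul_hatCoact]; simp
    _ = _ := by rw [smash_galois]; simp

/-- `hatCoact_eval` with a strand `R` between the two factors. -/
theorem braid_hatCoact_eval :
    E ◁ br H R T ≫ kapc (R ⊗ H ⊗ T) ≫ H ◁ br E R (H ⊗ T) ≫ H ◁ R ◁ vE T = kap (R ⊗ T) := by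
  calc _ = kapc (H ⊗ R ⊗ T) ≫ H ◁ (E ◁ br H R T ≫ br E R (H ⊗ T) ≫ R ◁ vE T) := by simp
    _ = _ := by rw [w20_br, hatCoact_eval]

theorem one_galois : uE T ≫ uH (E ⊗ T) ≫ gal T = bE T := by
  calc _ = uE T ≫ kapc T ≫ (uH (H ⊗ E ⊗ T) ≫ mH (E ⊗ T)) := by rw [w_galois]; simp
    _ = _ := by rw [w_one_mul, Category.comp_id, one_hatCoact]

variable [IsIso (antipode : H ⟶ H)]

theorem w_galoisInv : gali T = H ◁ kapc T ≫ H ◁ siH (E ⊗ T) ≫ mH (E ⊗ T) := by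
  simp only [galoisInv, w22, w21, w12, w11]; monoidal

theorem w_galois_galoisInv : gal T ≫ gali T = 𝟙 _ := by
  rw [w_galois, w_galoisInv, Category.assoc, hatCoact_antipode_left]

theorem w_galoisInv_galois : gali T ≫ gal T = 𝟙 _ := by
  rw [w_galois, w_galoisInv, Category.assoc, Category.assoc, hatCoact_antipode_right]

/-- The isomorphism `r ⊗ h ⊗ f ↦ S⁻¹(k₁) · r ⊗ k₂ ⊗ f₀`, `k = h f₁`, from `(R # H) # E` to
`R ⊗ (H ⊗ E)`, on right-nested words. -/
noncomputable def dualityWord (T : C) : R ⊗ H ⊗ E ⊗ T ⟶ R ⊗ H ⊗ E ⊗ T :=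
  R ◁ gal T ≫ ti (E ⊗ T) ≫ br H R (E ⊗ T)

/-- The inverse of `dualityWord`. -/
noncomputable def dualityInvWord (T : C) : R ⊗ H ⊗ E ⊗ T ⟶ R ⊗ H ⊗ E ⊗ T :=
  ib H R (E ⊗ T) ≫ tw (E ⊗ T) ≫ R ◁ gali T

theorem dualityWord_inv : dualityWord H D R T ≫ dualityInvWord H D R T = 𝟙 _ := by
  calc _ = R ◁ gal T ≫ (ti (E ⊗ T) ≫ (br H R (E ⊗ T) ≫ ib H R (E ⊗ T)) ≫ tw (E ⊗ T)) ≫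
          R ◁ gali T := by
        simp only [dualityWord, dualityInvWord, Category.assoc]
    _ = _ := by
        rw [br_ib, Category.id_comp, w_twistInv_twist, Category.id_comp, whiskerLeft_merge,
          w_galois_galoisInv, MonoidalCategory.whiskerLeft_id]

theorem dualityInvWord_word : dualityInvWord H D R T ≫ dualityWord H D R T = 𝟙 _ := by
  calc _ = ib H R (E ⊗ T) ≫ tw (E ⊗ T) ≫ (R ◁ gali T ≫ R ◁ gal T) ≫ ti (E ⊗ T) ≫
          br H R (E ⊗ T) := by
        simp only [dualityWord, dualityInvWord, Category.assoc]
    _ = _ := by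
        rw [whiskerLeft_merge, w_galoisInv_galois, MonoidalCategory.whiskerLeft_id,
          Category.id_comp, reassoc_of% @w_twist_twistInv, ib_br]

/-- The product in `(R # H) # E`, mapped to `R ⊗ (H ⊗ E)`: no twist is left, only its inverse. -/
theorem smashSmashMulWord_duality : smashSmashMulWord H D R T ≫ dualityWord H D R T =
    R ◁ H ◁ E ◁ (R ◁ gal T ≫ ti (E ⊗ T)) ≫ R ◁ H ◁ kap (R ⊗ E ⊗ T) ≫ R ◁ mH (R ⊗ E ⊗ T) ≫
      ti (R ⊗ E ⊗ T) ≫ H ◁ mR (E ⊗ T) ≫ br H R (E ⊗ T) := by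
  calc _ = (smashSmashMulWord H D R T ≫ R ◁ gal T) ≫ ti (E ⊗ T) ≫ br H R (E ⊗ T) := by
        simp only [dualityWord, Category.assoc]
    _ = R ◁ H ◁ E ◁ R ◁ gal T ≫ R ◁ H ◁ E ◁ (ti (E ⊗ T) ≫ tw (E ⊗ T)) ≫
          R ◁ H ◁ br E R (H ⊗ E ⊗ T) ≫ R ◁ H ◁ R ◁ kap (E ⊗ T) ≫
          R ◁ tw (H ⊗ E ⊗ T) ≫ mR (H ⊗ H ⊗ E ⊗ T) ≫ R ◁ mH (E ⊗ T) ≫ ti (E ⊗ T) ≫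
          br H R (E ⊗ T) := by
        rw [smashSmashMulWord_galois, w_twistInv_twist]; simp
    _ = R ◁ H ◁ E ◁ R ◁ gal T ≫ R ◁ H ◁ E ◁ ti (E ⊗ T) ≫
          R ◁ H ◁ (E ◁ tw (E ⊗ T) ≫ br E R (H ⊗ E ⊗ T) ≫ R ◁ kap (E ⊗ T)) ≫
          R ◁ tw (H ⊗ E ⊗ T) ≫ mR (H ⊗ H ⊗ E ⊗ T) ≫ R ◁ mH (E ⊗ T) ≫ ti (E ⊗ T) ≫
          br H R (E ⊗ T) := by
        simp
    _ = R ◁ H ◁ E ◁ R ◁ gal T ≫ R ◁ H ◁ E ◁ ti (E ⊗ T) ≫ R ◁ H ◁ kap (R ⊗ E ⊗ T) ≫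
          R ◁ (H ◁ tw (E ⊗ T) ≫ tw (H ⊗ E ⊗ T) ≫ R ◁ mH (E ⊗ T)) ≫ mR (H ⊗ E ⊗ T) ≫ ti (E ⊗ T) ≫
          br H R (E ⊗ T) := by
        rw [hatAct_twist]; simp
    _ = R ◁ H ◁ E ◁ R ◁ gal T ≫ R ◁ H ◁ E ◁ ti (E ⊗ T) ≫ R ◁ H ◁ kap (R ⊗ E ⊗ T) ≫
          R ◁ mH (R ⊗ E ⊗ T) ≫ (R ◁ tw (E ⊗ T) ≫ mR (H ⊗ E ⊗ T) ≫ ti (E ⊗ T)) ≫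
          br H R (E ⊗ T) := by
        rw [← w_mul_twist]; simp
    _ = _ := by rw [twistInv_mul]; simp

/-- `dualityWord` carries the multiplication of `(R # H) # E` to that of `R ⊗ (H ⊗ E)`. -/
theorem duality_mul : smashSmashMulWord H D R T ≫ dualityWord H D R T =
    R ◁ H ◁ E ◁ dualityWord H D R T ≫ dualityWord H D R (R ⊗ H ⊗ E ⊗ T) ≫
      tensorMatrixMulWord H D R T := by
  symm
  calc _ = R ◁ H ◁ E ◁ (R ◁ gal T ≫ ti (E ⊗ T)) ≫
          R ◁ H ◁ (E ◁ br H R (E ⊗ T) ≫ kapc (R ⊗ H ⊗ E ⊗ T) ≫ H ◁ br E R (H ⊗ E ⊗ T) ≫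
            H ◁ R ◁ vE (E ⊗ T)) ≫ R ◁ mH (R ⊗ E ⊗ T) ≫ ti (R ⊗ E ⊗ T) ≫
          (br H R (R ⊗ E ⊗ T) ≫ R ◁ br H R (E ⊗ T) ≫ mR (H ⊗ E ⊗ T)) := by
        rw [tensorMatrixMulWord, dualityWord, dualityWord, w_galois, w_galois]; simp
    _ = _ := by rw [smashSmashMulWord_duality, braid_hatCoact_eval, ← br_w21]

theorem duality_one : uE T ≫ uH (E ⊗ T) ≫ uR (H ⊗ E ⊗ T) ≫ dualityWord H D R T =
    bE T ≫ uR (H ⊗ E ⊗ T) := by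
  calc _ = (uE T ≫ uH (E ⊗ T) ≫ gal T) ≫ (uR (H ⊗ E ⊗ T) ≫ ti (E ⊗ T)) ≫ br H R (E ⊗ T) := by
        rw [dualityWord]; simp
    _ = _ := by rw [one_galois, twistInv_one, br_w01]

end Duality

/-! ### The isomorphism of algebras -/

section Main
open ModuleAlgebra
variable {C : Type u} [Category.{v} C] [MonoidalCategory C] [BraidedCategory C]
variable (H D R : C) [HopfObj H] [ExactPairing H D] [SelfSymmetric H] [MonObj R]
  [ModuleAlgebra H R]

local notation "E" => HatDual H D

/-- The multiplication of `(R # H) # E`, typed by tensor products of `R`, `H` and `E`. -/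
def smashSmashMul : ((R ⊗ H) ⊗ E) ⊗ ((R ⊗ H) ⊗ E) ⟶ (R ⊗ H) ⊗ E :=
  μ[(smashProduct E (smashProduct H R).X).X]

/-- The unit of `(R # H) # E`, typed by tensor products of `R`, `H` and `E`. -/
def smashSmashOne : 𝟙_ C ⟶ (R ⊗ H) ⊗ E := η[(smashProduct E (smashProduct H R).X).X]

/-- The multiplication of `R ⊗ (H ⊗ E)`, where `H ⊗ E` is the matrix algebra, typed by tensor
products of `R`, `H` and `E`. -/
def tensorMatrixMul : (R ⊗ H ⊗ E) ⊗ (R ⊗ H ⊗ E) ⟶ R ⊗ H ⊗ E := μ[R ⊗ (matrixAlgebra H E).X]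

/-- The unit of `R ⊗ (H ⊗ E)`, where `H ⊗ E` is the matrix algebra, typed by tensor
products of `R`, `H` and `E`. -/
def tensorMatrixOne : 𝟙_ C ⟶ R ⊗ H ⊗ E := η[R ⊗ (matrixAlgebra H E).X]

theorem smashSmash_mul :
    smashSmashMul H D R =
      𝟙 _ ⊗≫ smashSmashMulWord H D R (𝟙_ C) ⊗≫ 𝟙 _ := by
  change (α_ (R ⊗ H) E ((R ⊗ H) ⊗ E)).hom ≫ (R ⊗ H) ◁ ((α_ E (R ⊗ H) E).inv ≫
    (Δ[E] ▷ (R ⊗ H) ≫ (α_ E E (R ⊗ H)).hom ≫ E ◁ (β_ E (R ⊗ H)).hom ≫ (α_ E (R ⊗ H) E).inv ≫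
      smashHatAct H D R ▷ E) ▷ E ≫ (α_ (R ⊗ H) E E).hom) ≫
    (α_ (R ⊗ H) (R ⊗ H) (E ⊗ E)).inv ≫ (smashMul H R ⊗ₘ μ[E]) = _
  rw [MonoidalCategory.tensorHom_def, braiding_tensor_right_hom, smashMul,
    MonoidalCategory.tensorHom_def, smashHatAct]
  simp only [smashSmashMulWord, br, w12, w22, w21]
  monoidal

theorem smashSmash_one :
    smashSmashOne H D R =
      w01 η[E] (𝟙_ C) ≫ w01 η[H] (E ⊗ 𝟙_ C) ≫ w01 η[R] (H ⊗ E ⊗ 𝟙_ C) ⊗≫ 𝟙 _ := by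
  change (λ_ (𝟙_ C)).inv ≫ (((λ_ (𝟙_ C)).inv ≫ (η[R] ⊗ₘ η[H])) ⊗ₘ η[E]) = _
  rw [MonoidalCategory.tensorHom_def', MonoidalCategory.tensorHom_def']
  simp only [w01]
  monoidal

theorem tensorMatrix_mul :
    tensorMatrixMul H D R =
      𝟙 _ ⊗≫ tensorMatrixMulWord H D R (𝟙_ C) ⊗≫ 𝟙 _ := by
  change tensorμ R (H ⊗ E) R (H ⊗ E) ≫ (μ[R] ⊗ₘ matrixMul H E) = _
  rw [tensorμ, MonoidalCategory.tensorHom_def', braiding_tensor_left_hom, matrixMul]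
  simp only [tensorMatrixMulWord, br, w20, w22, w21]
  monoidal

theorem tensorMatrix_one :
    tensorMatrixOne H D R =
      w02 (η_ H E) (𝟙_ C) ≫ w01 η[R] (H ⊗ E ⊗ 𝟙_ C) ⊗≫ 𝟙 _ := by
  change (λ_ (𝟙_ C)).inv ≫ (η[R] ⊗ₘ η_ H E) = _
  rw [MonoidalCategory.tensorHom_def']
  simp only [w01, w02]
  monoidal

variable [IsIso (antipode : H ⟶ H)]

/-- The isomorphism `(R # H) # E ≅ R ⊗ (H ⊗ E)` of objects. -/
noncomputable def dualityIso : (R ⊗ H) ⊗ E ≅ R ⊗ H ⊗ E where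
  hom := 𝟙 _ ⊗≫ dualityWord H D R (𝟙_ C) ⊗≫ 𝟙 _
  inv := 𝟙 _ ⊗≫ dualityInvWord H D R (𝟙_ C) ⊗≫ 𝟙 _
  hom_inv_id := by
    calc _ = 𝟙 _ ⊗≫ (dualityWord H D R (𝟙_ C) ≫ dualityInvWord H D R (𝟙_ C)) ⊗≫ 𝟙 _ := by monoidal
      _ = _ := by rw [dualityWord_inv]; monoidal
  inv_hom_id := by
    calc _ = 𝟙 _ ⊗≫ (dualityInvWord H D R (𝟙_ C) ≫ dualityWord H D R (𝟙_ C)) ⊗≫ 𝟙 _ := by monoidal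
      _ = _ := by rw [dualityInvWord_word]; monoidal

theorem dualityIso_hom_whiskerRight (T : C) : (dualityIso H D R).hom ▷ T =
    𝟙 _ ⊗≫ dualityWord H D R T ⊗≫ 𝟙 _ := by
  simp only [dualityIso, dualityWord, br, w22]
  monoidal

theorem dualityIso_mul :
    smashSmashMul H D R ≫ (dualityIso H D R).hom =
      ((dualityIso H D R).hom ⊗ₘ (dualityIso H D R).hom) ≫ tensorMatrixMul H D R := by
  calc _ = 𝟙 _ ⊗≫ (smashSmashMulWord H D R (𝟙_ C) ≫ dualityWord H D R (𝟙_ C)) ⊗≫ 𝟙 _ := by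
        rw [smashSmash_mul, dualityIso]; monoidal
    _ = ((R ⊗ H) ⊗ E) ◁ (dualityIso H D R).hom ≫
          𝟙 _ ⊗≫ dualityWord H D R (R ⊗ H ⊗ E ⊗ 𝟙_ C) ⊗≫
          tensorMatrixMulWord H D R (𝟙_ C) ⊗≫ 𝟙 _ := by
        rw [duality_mul, dualityIso]; monoidal
    _ = ((R ⊗ H) ⊗ E) ◁ (dualityIso H D R).hom ≫
          𝟙 _ ⊗≫ (dualityIso H D R).hom ▷ (R ⊗ H ⊗ E ⊗ 𝟙_ C) ⊗≫
          tensorMatrixMulWord H D R (𝟙_ C) ⊗≫ 𝟙 _ := by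
        rw [dualityIso_hom_whiskerRight]; monoidal
    _ = ((R ⊗ H) ⊗ E) ◁ (dualityIso H D R).hom ≫ (dualityIso H D R).hom ▷ (R ⊗ H ⊗ E) ≫
          (𝟙 _ ⊗≫ tensorMatrixMulWord H D R (𝟙_ C) ⊗≫ 𝟙 _) := by
        monoidal
    _ = _ := by rw [← tensorMatrix_mul, MonoidalCategory.tensorHom_def', Category.assoc]

theorem dualityIso_one :
    smashSmashOne H D R ≫ (dualityIso H D R).hom =
      tensorMatrixOne H D R := by
  calc _ = (w01 η[E] (𝟙_ C) ≫ w01 η[H] (E ⊗ 𝟙_ C) ≫ w01 η[R] (H ⊗ E ⊗ 𝟙_ C) ≫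
          dualityWord H D R (𝟙_ C)) ⊗≫ 𝟙 _ := by
        rw [smashSmash_one, dualityIso]; monoidal
    _ = _ := by rw [duality_one, tensorMatrix_one]; monoidal

end Main

end BraidedDuality

open BraidedDuality
theorem theorem2p8 {C : Type u} [Category.{v} C] [MonoidalCategory C] [BraidedCategory C]
    (H D R : C) [HopfObj H] [ExactPairing H D] [SelfSymmetric H] [MonObj R] [ModuleAlgebra H R] :
    Nonempty (smashProduct (HatDual H D) (smashProduct H R).X ≅
      Mon.mk (R ⊗ (matrixAlgebra H (HatDual H D)).X)) := by
  have : IsIso (HopfObj.antipode : H ⟶ H) := isIso_antipode H D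
  exact ⟨Mon.mkIso (dualityIso H D R) (dualityIso_one H D R) (dualityIso_mul H D R)⟩
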